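/- Let $0<T<\infty$. All matrix-valued functions below (except $P$ and $X$) are real and piecewise continuous on $[0,T]$: finitely many break points, finite one-sided limits, right-continuous on $[0,T)$ and left-continuous at $T$. **System and filter.** Let $N$ be the LTV system $$\dot x_N=A_Nx_N+B_ww+B_dd,\quad v=C_vx_N+D_{vw}w+D_{vd}d,\quad e_I=C_Ix_N+D_{Iw}w+D_{Id}d,\quad e_E=C_Ex_N .$$ Let $\Psi_v=(A_1,B_1,C_1,D_1)$ be an LTV system with input $v$ and state $x_v$, and let $\Psi_w=(A_2,B_2,C_2,D_2)$ be an LTV system with input $w$ and state $x_w$. Put $\Psi=\mathrm{diag}(\Psi_v,\Psi_w)$ and $M=\mathrm{diag}(M_v,-M_w)$ with $M_v(t)\succ0$, $M_w(t)\succ0$ symmetric. Let $D_1(t),D_2(t)$ have full column rank. These pointwise conditions hold uniformly on $[0,T]$, that is, also for the one-sided limits: for some $\delta>0$, each of $M_v,\ M_w,\ D_1^\top D_1,\ D_2^\top D_2$ is $\succeq\delta I$ on $[0,T]$. Let $\gamma>0$. **Robust performance DLMI.** Connect $v,w$ to $\Psi$ and let $z$ be its output. The extended system has state $x=(x_N,x_v,x_w)\in\mathbb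 R^n$, input $(w,d)$ and outputs $z=\mathcal C_zx+\mathcal D_z(w,d)$, $e_I=\mathcal C_Ix+\mathcal D_I(w,d)$, $e_E=\mathcal C_Ex$; let $\dot x=\mathcal Ax+\mathcal B(w,d)$. Put $Q=\mathcal C_I^\top\mathcal C_I$, $S=\mathcal C_I^\top\mathcal D_I$, $R=\mathcal D_I^\top\mathcal D_I-\gamma^2\mathrm{diag}(0,I)$, $F=\mathcal C_E(T)^\top\mathcal C_E(T)$ and $$DLMI_{Rob}(P,M,\gamma^2,t)=\begin{bmatrix}\dot P+\mathcal A^\top P+P\mathcal A&P\mathcal B\\ \mathcal B^\top P&0\end{bmatrix}+\begin{bmatrix}Q&S\\S^\top&R\end{bmatrix}+\begin{bmatrix}\mathcal C_z^\top\\ \mathcal D_z^\top\end{bmatrix}M\begin{bmatrix}\mathcal C_z&\mathcal D_z\end{bmatrix}.$$ **Finite horizon factors.** A factor $U_v$ of $(\Psi_v,M_v)$ is a system $\big(A_1,\,B_1,\,W^{-\top}(B_1^\top X+D_1^\top M_vC_1),\,W\big)$, where $W$ is square with $W^\top W=D_1^\top M_vD_1$, and $X:[0,T]\to\mathbb S^{n_1}$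 ($n_1$ the dimension of $x_v$) is continuous with $X(T)=0$ and solves $$\dot X+A_1^\top X+XA_1+C_1^\top M_vC_1-(XB_1+C_1^\top M_vD_1)(D_1^\top M_vD_1)^{-1}(XB_1+C_1^\top M_vD_1)^\top=0$$ on $[0,T)$ with right derivative $\dot X$ (the ordinary derivative away from break points). A factor $U_w$ of $(\Psi_w,M_w)$ is defined in the same way. **Scaled system.** $N_{scl}$ has input $(\tilde w,\tilde d)$ and outputs $(\tilde v,e_I)$ and $e_E$. It is the cascade $w=U_w^{-1}\tilde w$, $d=\gamma^{-1}\tilde d$, then $N$, then $\tilde v=U_vv$. Its nominal performance is $$\|N_{scl}\|_{[0,T]}=\sup\left[\frac{\|e_E(T)\|_2^2+\|(\tilde v,e_I)\|_{2,[0,T]}^2}{\|(\tilde w,\tilde d)\|_{2,[0,T]}^2}\right]^{1/2},$$ the supremum being over nonzero $(\tilde w,\tilde d)\in L_2[0,T]$ with zero initial state (and $0$ if there is no such input). **Claim.** Factors $U_v$ and $U_w$ exist, and for every choice of them the following are equivalent: 1. there are $\epsilon>0$ and a differentiable $P:[0,T]\to\mathbb S^n$ with $P(T)\ge F$ and $DLMI_{Rob}(P,M,\gamma^2,t)\le-\epsilon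 I$ for all $t\in[0,T]$; 2. $\|N_{scl}\|_{[0,T]}\le1-\hat\epsilon$ for some $\hat\epsilon\in(0,1]$. -/

import Mathlib

open Set Filter Topology MeasureTheory Matrix

noncomputable section

namespace FiniteHorizon

/-- `f` is piecewise continuous on `[0,T]`: continuous off a finite set of break points, with a
finite left limit everywhere, and with the value at a break point equal to the right limit
(at the end point `T`, equal to the left limit). In particular `f` is bounded on `[0,T]`. -/
def PiecewiseContinuous {E : Type*} [TopologicalSpace E] (T : ℝ) (f : ℝ → E) : Prop :=
  (∃ s : Finset ℝ, ∀ t ∈ Icc 0 T, t ∉ s → ContinuousWithinAt f (Icc 0 T) t) ∧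
  (∀ t ∈ Ico 0 T, ContinuousWithinAt f (Ici t) t) ∧
  (∀ t ∈ Ioc 0 T, ∃ l : E, Tendsto f (𝓝[<] t) (𝓝 l)) ∧
  ContinuousWithinAt f (Iic T) T

/-- `M(t) ≻ 0` on `[0,T]`, uniformly: for a continuous `M` this is `M(t) ≻ 0` for all `t`; for a
piecewise continuous `M` it is `M(t) ≻ 0` for all `t`, one-sided limits included. -/
def UniformlyPosDef {n : Type*} [DecidableEq n] (T : ℝ)
    (M : ℝ → Matrix n n ℝ) : Prop :=
  ∃ δ : ℝ, 0 < δ ∧ ∀ t ∈ Icc 0 T, (M t - δ • (1 : Matrix n n ℝ)).PosSemidef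

/-! ### Linear time-varying systems -/

/-- State-space data of `ẋ = A x + B u`, `y = C x + D u`. -/
structure LTV (n m p : Type*) where
  A : ℝ → Matrix n n ℝ
  B : ℝ → Matrix n m ℝ
  C : ℝ → Matrix p n ℝ
  D : ℝ → Matrix p m ℝ

/-- All state-space matrices are piecewise continuous on `[0,T]`. -/
def LTV.Regular {n m p : Type*} (H : LTV n m p) (T : ℝ) : Prop :=
  PiecewiseContinuous T H.A ∧ PiecewiseContinuous T H.B ∧
  PiecewiseContinuous T H.C ∧ PiecewiseContinuous T H.D

/-- Realization of the inverse of a square system (with invertible feedthrough). -/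
def LTV.inv {n m : Type*} [Fintype m] [DecidableEq m] (U : LTV n m m) : LTV n m m where
  A t := U.A t - U.B t * (U.D t)⁻¹ * U.C t
  B t := U.B t * (U.D t)⁻¹
  C t := -((U.D t)⁻¹ * U.C t)
  D t := (U.D t)⁻¹

/-- A system whose output is split into `e_I = C_I x + D_I d` (penalized in `L₂[0,T]`) and
`e_E = C_E x` (penalized at the final time). -/
structure PerfLTV (n m nI nE : Type*) where
  A : ℝ → Matrix n n ℝ
  B : ℝ → Matrix n m ℝ
  CI : ℝ → Matrix nI n ℝ
  DI : ℝ → Matrix nI m ℝ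
  CE : ℝ → Matrix nE n ℝ

/-- `‖u‖²` in `L₂[0,T]`, with the Euclidean norm pointwise. -/
def energy {m : Type*} [Fintype m] (T : ℝ) (u : ℝ → m → ℝ) : ℝ :=
  ∫ t in (0 : ℝ)..T, u t ⬝ᵥ u t

/-- `u ∈ L₂[0,T]`. -/
def IsL2 {m : Type*} [Fintype m] (T : ℝ) (u : ℝ → m → ℝ) : Prop :=
  MemLp u 2 (volume.restrict (Icc 0 T))

namespace PerfLTV

variable {n m nI nE : Type*} [Fintype n] [Fintype m] [Fintype nI] [Fintype nE]

/-- `x` solves `ẋ = A x + B d`, `x(0) = 0` on `[0,T]` (in integrated form, since `d` is only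
an `L₂` signal). -/
def IsState (H : PerfLTV n m nI nE) (T : ℝ) (d : ℝ → m → ℝ) (x : ℝ → n → ℝ) : Prop :=
  ContinuousOn x (Icc 0 T) ∧
  ∀ t ∈ Icc 0 T, x t = ∫ s in (0 : ℝ)..t, (H.A s *ᵥ x s + H.B s *ᵥ d s)

/-- The output `e_I`. -/
def outI (H : PerfLTV n m nI nE) (d : ℝ → m → ℝ) (x : ℝ → n → ℝ) (t : ℝ) : nI → ℝ :=
  H.CI t *ᵥ x t + H.DI t *ᵥ d t

/-- The output `e_E`. -/
def outE (H : PerfLTV n m nI nE) (x : ℝ → n → ℝ) (t : ℝ) : nE → ℝ :=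
  H.CE t *ᵥ x t

/-- The nominal performance `‖H‖_{[0,T]}`: the supremum over the inputs `0 ≠ d ∈ L₂[0,T]` of
`((‖e_E(T)‖² + ‖e_I‖²) / ‖d‖²)^{1/2}`. -/
def perf (H : PerfLTV n m nI nE) (T : ℝ) : ENNReal :=
  ⨆ (d : ℝ → m → ℝ) (x : ℝ → n → ℝ) (_ : IsL2 T d) (_ : 0 < energy T d)
    (_ : H.IsState T d x),
    ENNReal.ofReal (Real.sqrt
      ((H.outE x T ⬝ᵥ H.outE x T + energy T (H.outI d x)) / energy T d))

end PerfLTV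

/-- The (known part of the) uncertain system: inputs `w, d`, outputs `v, e_I, e_E`. -/
structure UncertainLTV (nN nv nw nd nI nE : Type*) where
  A : ℝ → Matrix nN nN ℝ
  Bw : ℝ → Matrix nN nw ℝ
  Bd : ℝ → Matrix nN nd ℝ
  Cv : ℝ → Matrix nv nN ℝ
  Dvw : ℝ → Matrix nv nw ℝ
  Dvd : ℝ → Matrix nv nd ℝ
  CI : ℝ → Matrix nI nN ℝ
  DIw : ℝ → Matrix nI nw ℝ
  DId : ℝ → Matrix nI nd ℝ
  CE : ℝ → Matrix nE nN ℝ

/-- All state-space matrices are piecewise continuous on `[0,T]`. -/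
def UncertainLTV.Regular {nN nv nw nd nI nE : Type*}
    (N : UncertainLTV nN nv nw nd nI nE) (T : ℝ) : Prop :=
  PiecewiseContinuous T N.A ∧ PiecewiseContinuous T N.Bw ∧ PiecewiseContinuous T N.Bd ∧
  PiecewiseContinuous T N.Cv ∧ PiecewiseContinuous T N.Dvw ∧ PiecewiseContinuous T N.Dvd ∧
  PiecewiseContinuous T N.CI ∧ PiecewiseContinuous T N.DIw ∧ PiecewiseContinuous T N.DId ∧
  PiecewiseContinuous T N.CE

/-- An IQC filter `Ψ` with inputs `v, w` and output `z`. -/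
structure IQCFilter (nψ nv nw nz : Type*) where
  A : ℝ → Matrix nψ nψ ℝ
  Bv : ℝ → Matrix nψ nv ℝ
  Bw : ℝ → Matrix nψ nw ℝ
  C : ℝ → Matrix nz nψ ℝ
  Dv : ℝ → Matrix nz nv ℝ
  Dw : ℝ → Matrix nz nw ℝ

/-- The block diagonal filter `Ψ = diag(Ψ_v, Ψ_w)`. -/
def diagFilter {n1 n2 nv nw p1 p2 : Type*} (Ψv : LTV n1 nv p1) (Ψw : LTV n2 nw p2) :
    IQCFilter (n1 ⊕ n2) nv nw (p1 ⊕ p2) where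
  A t := fromBlocks (Ψv.A t) 0 0 (Ψw.A t)
  Bv t := fromRows (Ψv.B t) 0
  Bw t := fromRows 0 (Ψw.B t)
  C t := fromBlocks (Ψv.C t) 0 0 (Ψw.C t)
  Dv t := fromRows (Ψv.D t) 0
  Dw t := fromRows 0 (Ψw.D t)

/-- The block diagonal multiplier `M = diag(M_v, -M_w)`. -/
def diagMultiplier {p1 p2 : Type*} (Mv : ℝ → Matrix p1 p1 ℝ) (Mw : ℝ → Matrix p2 p2 ℝ)
    (t : ℝ) : Matrix (p1 ⊕ p2) (p1 ⊕ p2) ℝ :=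
  fromBlocks (Mv t) 0 0 (-Mw t)

/-! ### The extended system and the robust performance DLMI -/

namespace Ext

variable {nN nv nw nd nI nE nψ nz : Type*}
  [Fintype nN] [Fintype nv] [Fintype nI] [Fintype nE] [Fintype nψ] [Fintype nz]
  [DecidableEq nw] [DecidableEq nd]
  (N : UncertainLTV nN nv nw nd nI nE) (Ψ : IQCFilter nψ nv nw nz)

/-- State matrix of the extended system; the state is `(x_N, x_ψ)`. -/
def A (t : ℝ) : Matrix (nN ⊕ nψ) (nN ⊕ nψ) ℝ :=
  fromBlocks (N.A t) 0 (Ψ.Bv t * N.Cv t) (Ψ.A t)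

/-- Input matrix of the extended system; the input is `(w, d)`. -/
def B (t : ℝ) : Matrix (nN ⊕ nψ) (nw ⊕ nd) ℝ :=
  fromBlocks (N.Bw t) (N.Bd t) (Ψ.Bv t * N.Dvw t + Ψ.Bw t) (Ψ.Bv t * N.Dvd t)

/-- State-to-`z` matrix. -/
def Cz (t : ℝ) : Matrix nz (nN ⊕ nψ) ℝ := fromCols (Ψ.Dv t * N.Cv t) (Ψ.C t)

/-- Input-to-`z` matrix. -/
def Dz (t : ℝ) : Matrix nz (nw ⊕ nd) ℝ :=
  fromCols (Ψ.Dv t * N.Dvw t + Ψ.Dw t) (Ψ.Dv t * N.Dvd t)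

/-- State-to-`e_I` matrix. -/
def CI (nψ : Type*) (t : ℝ) : Matrix nI (nN ⊕ nψ) ℝ := fromCols (N.CI t) 0

/-- Input-to-`e_I` matrix. -/
def DI (t : ℝ) : Matrix nI (nw ⊕ nd) ℝ := fromCols (N.DIw t) (N.DId t)

/-- State-to-`e_E` matrix. -/
def CE (nψ : Type*) (t : ℝ) : Matrix nE (nN ⊕ nψ) ℝ := fromCols (N.CE t) 0

/-- `Q = C_Iᵀ C_I`. -/
def Q (nψ : Type*) (t : ℝ) : Matrix (nN ⊕ nψ) (nN ⊕ nψ) ℝ := (CI N nψ t)ᵀ * CI N nψ t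

/-- `S = C_Iᵀ D_I`. -/
def S (nψ : Type*) (t : ℝ) : Matrix (nN ⊕ nψ) (nw ⊕ nd) ℝ := (CI N nψ t)ᵀ * DI N t

/-- `R = D_Iᵀ D_I - γ² diag(0, I)`. -/
def R (γ : ℝ) (t : ℝ) : Matrix (nw ⊕ nd) (nw ⊕ nd) ℝ :=
  (DI N t)ᵀ * DI N t - γ ^ 2 • fromBlocks 0 0 0 1

/-- `F = C_E(T)ᵀ C_E(T)`. -/
def F (nψ : Type*) (T : ℝ) : Matrix (nN ⊕ nψ) (nN ⊕ nψ) ℝ :=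
  (CE N nψ T)ᵀ * CE N nψ T

/-- The entrywise derivative of `P` on `[0,T]` (one-sided at the end points). -/
def dotOn {n : Type*} (T : ℝ) (P : ℝ → Matrix n n ℝ) (t : ℝ) : Matrix n n ℝ :=
  Matrix.of fun i j => derivWithin (fun s => P s i j) (Icc 0 T) t

/-- The left-hand side `DLMI_Rob(P, M, γ², t)` of the robust performance DLMI. -/
def DLMI (T γ : ℝ) (M : ℝ → Matrix nz nz ℝ)
    (P : ℝ → Matrix (nN ⊕ nψ) (nN ⊕ nψ) ℝ) (t : ℝ) :
    Matrix ((nN ⊕ nψ) ⊕ (nw ⊕ nd)) ((nN ⊕ nψ) ⊕ (nw ⊕ nd)) ℝ :=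
  fromBlocks (dotOn T P t + (A N Ψ t)ᵀ * P t + P t * A N Ψ t) (P t * B N Ψ t)
      ((B N Ψ t)ᵀ * P t) 0
    + fromBlocks (Q N nψ t) (S N nψ t) (S N nψ t)ᵀ (R N γ t)
    + (fromCols (Cz N Ψ t) (Dz N Ψ t))ᵀ * M t * fromCols (Cz N Ψ t) (Dz N Ψ t)

/-- `P : [0,T] → 𝕊ⁿ` is differentiable, `P(T) ≥ F` and
`DLMI_Rob(P, M, γ², t) ≤ -ε I` for all `t ∈ [0,T]`. -/
def SatisfiesDLMI [DecidableEq nN] [DecidableEq nψ] (T γ ε : ℝ) (M : ℝ → Matrix nz nz ℝ)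
    (P : ℝ → Matrix (nN ⊕ nψ) (nN ⊕ nψ) ℝ) : Prop :=
  (∀ t ∈ Icc 0 T, (P t).IsSymm) ∧
  (∀ i j, DifferentiableOn ℝ (fun t => P t i j) (Icc 0 T)) ∧
  (P T - F N nψ T).PosSemidef ∧
  ∀ t ∈ Icc 0 T, (-(ε • 1) - DLMI N Ψ T γ M P t).PosSemidef

end Ext

/-! ### Finite horizon factorization -/

section Factor

variable {n m p : Type*} [Fintype n] [Fintype m] [Fintype p] [DecidableEq m]
  (Ψ : LTV n m p) (M : ℝ → Matrix p p ℝ)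

/-- The right-hand side of the Riccati equation
`Ẋ = -(Aᵀ X + X A + Q - (X B + S) R⁻¹ (X B + S)ᵀ)` with
`Q = Cᵀ M C`, `S = Cᵀ M D`, `R = Dᵀ M D`. -/
def riccatiRHS (t : ℝ) (X : Matrix n n ℝ) : Matrix n n ℝ :=
  -((Ψ.A t)ᵀ * X + X * Ψ.A t + (Ψ.C t)ᵀ * M t * Ψ.C t
    - (X * Ψ.B t + (Ψ.C t)ᵀ * M t * Ψ.D t) * ((Ψ.D t)ᵀ * M t * Ψ.D t)⁻¹
      * (X * Ψ.B t + (Ψ.C t)ᵀ * M t * Ψ.D t)ᵀ)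

/-- `X : [0,T] → 𝕊ⁿ` solves the Riccati equation with `X(T) = 0`. As the coefficients are only
piecewise continuous (continuous from the right), `X` is continuous and the equation holds for
the right derivative; away from the break points this is the two-sided derivative. -/
def IsRiccatiSolution (T : ℝ) (X : ℝ → Matrix n n ℝ) : Prop :=
  (∀ t ∈ Icc 0 T, (X t).IsSymm) ∧
  X T = 0 ∧
  (∀ i j, ContinuousOn (fun t => X t i j) (Icc 0 T)) ∧
  ∀ t ∈ Ico 0 T, ∀ i j,
    HasDerivWithinAt (fun s => X s i j) (riccatiRHS Ψ M t (X t) i j) (Ici t) t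

/-- `U` is a finite horizon factor of `Ψ^∼ M Ψ`: for the solution `X` of the Riccati equation and
some square piecewise continuous `W` with `Dᵀ M D = Wᵀ W`, `U` is the system
`(A, B, W^{-T} (Bᵀ X + Sᵀ), W)`. -/
def IsFactor (T : ℝ) (U : LTV n m m) : Prop :=
  ∃ (X : ℝ → Matrix n n ℝ) (W : ℝ → Matrix m m ℝ),
    IsRiccatiSolution Ψ M T X ∧
    PiecewiseContinuous T W ∧
    (∀ t ∈ Icc 0 T, (Ψ.D t)ᵀ * M t * Ψ.D t = (W t)ᵀ * W t) ∧
    ∀ t ∈ Icc 0 T, U.A t = Ψ.A t ∧ U.B t = Ψ.B t ∧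
      U.C t = ((W t)ᵀ)⁻¹ * ((Ψ.B t)ᵀ * X t + ((Ψ.C t)ᵀ * M t * Ψ.D t)ᵀ) ∧
      U.D t = W t

end Factor

/-- The scaled system `N_scl`: the cascade in which the input `(w̃, d̃)` is passed through
`w = U_w⁻¹ w̃`, `d = γ⁻¹ d̃` into `N`, and the output `v` of `N` through `ṽ = U_v v`. Its state is
`(x_N, (x_v, x_w))`, with `x_v`, `x_w` the states of `U_v` and `U_w⁻¹`; its outputs are
`(ṽ, e_I)` (in `L₂`) and `e_E` (at the final time). -/
def scaledSystem {nN nv nw nd nI nE n1 n2 : Type*}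
    [Fintype nv] [Fintype nw] [DecidableEq nw]
    (N : UncertainLTV nN nv nw nd nI nE) (Uv : LTV n1 nv nv) (Uw : LTV n2 nw nw) (γ : ℝ) :
    PerfLTV (nN ⊕ (n1 ⊕ n2)) (nw ⊕ nd) (nv ⊕ nI) nE where
  A t := fromBlocks
    (N.A t) (fromCols 0 (N.Bw t * Uw.inv.C t))
    (fromRows (Uv.B t * N.Cv t) 0)
    (fromBlocks (Uv.A t) (Uv.B t * N.Dvw t * Uw.inv.C t) 0 (Uw.inv.A t))
  B t := fromBlocks
    (N.Bw t * Uw.inv.D t) (γ⁻¹ • N.Bd t)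
    (fromRows (Uv.B t * N.Dvw t * Uw.inv.D t) (Uw.inv.B t))
    (fromRows (γ⁻¹ • (Uv.B t * N.Dvd t)) 0)
  CI t := fromBlocks
    (Uv.D t * N.Cv t) (fromCols (Uv.C t) (Uv.D t * N.Dvw t * Uw.inv.C t))
    (N.CI t) (fromCols 0 (N.DIw t * Uw.inv.C t))
  DI t := fromBlocks
    (Uv.D t * N.Dvw t * Uw.inv.D t) (γ⁻¹ • (Uv.D t * N.Dvd t))
    (N.DIw t * Uw.inv.D t) (γ⁻¹ • N.DId t)
  CE t := fromCols (N.CE t) 0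

end FiniteHorizon

end

noncomputable section

namespace FiniteHorizon

attribute [local instance] Matrix.linftyOpNormedAddCommGroup Matrix.linftyOpNormedSpace

set_option linter.unusedSectionVars false

/-! ### Piecewise continuous functions -/

namespace PiecewiseContinuous

variable {E F G : Type*} {T : ℝ}

/-! Both conditions say that one quadratic functional of the trajectories is uniformly negative. For
an input `(w, d)` and zero initial state let `J = |e_E(T)|² + ∫ (|e_I|² + zᵀ M z - γ² |d|²)`; the
intermediate condition is `J ≤ -ε ‖(w, d)‖²` for some `ε > 0`.

The DLMI, tested on `(x, (w, d))`, bounds the derivative of `xᵀ P x` plus the supply rate;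
integration together with `P(T) ≥ F` gives the bound on `J` (`cost_le_of_dissipation`). Since `P` is
merely differentiable, integrability of `Ṗ` has to be earned: the DLMI bounds it from above, and
this one-sided bound suffices (`isPrimitive_of_derivative_le`).

The converse is a strict bounded real lemma (`exists_dissipation_of_cost_le`). A small `η I` is
added to the state and input weights. Short pulses show that the input weight is uniformly negative
(`feedthrough_le_of_cost_le`), so it stays invertible after the perturbation. The Riccati equation
with `Y(T) = F` is solved by `Y = Λ X⁻¹`, where `(X, Λ)` solves the linear Hamiltonian system; `X`
cannot become singular, because a null vector of `X(t₀)` would produce a trajectory of zero cost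
that does not end at the origin (`exists_riccati_solution`). Completing the square turns `η` into
strict slack. As `Y` may have kinks at the break points, it is replaced by a differentiable `P`
uniformly close to it with `Ṗ` below the Riccati field (`exists_differentiable_approximation`), at
the price of half the slack.

The same Riccati theorem with `F = 0` yields the factors: zero cost forces `z = 0`, hence a zero
state because `D` has a left inverse (`exists_isFactor`). Completing the square from `x(0) = 0` to
`X(T) = 0` shows that a factor preserves the energy `∫ zᵀ M z` (`IsFactor.properties`). Therefore `J
= |e_E(T)|² + ‖(ṽ, e_I)‖² - ‖(w̃, d̃)‖²` on the same state trajectory (`robust_cost_eq`). The change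
of inputs `(w, d) ↔ (w̃, d̃)` is bounded in `L₂` in both directions, so uniform negativity in terms
of one pair is uniform negativity in terms of the other, and the latter says that the gain is
strictly below one. -/

theorem map_of_continuousOn [TopologicalSpace E] [TopologicalSpace F] {f : ℝ → E} {C : Set E}
    {φ : E → F} (hf : PiecewiseContinuous T f) (hT : 0 < T) (hC : IsClosed C)
    (hfC : ∀ t ∈ Icc 0 T, f t ∈ C) (hφ : ContinuousOn φ C) :
    PiecewiseContinuous T (fun t => φ (f t)) := by
  obtain ⟨⟨s, hs⟩, hr, hl, hTl⟩ := hf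
  have key : ∀ (t : ℝ) (l : Filter ℝ), t ∈ Icc 0 T → (∀ᶠ r in l, r ∈ Icc 0 T) →
      Tendsto f l (𝓝 (f t)) → Tendsto (fun r => φ (f r)) l (𝓝 (φ (f t))) := by
    intro t l ht hl' hft
    have h1 := hφ (f t) (hfC t ht)
    exact h1.tendsto.comp (tendsto_nhdsWithin_iff.2 ⟨hft, hl'.mono fun r hr => hfC r hr⟩)
  refine ⟨⟨s, fun t ht hts => key t _ ht self_mem_nhdsWithin (hs t ht hts)⟩, ?_, ?_, ?_⟩
  · intro t ht
    refine key t _ ⟨ht.1, ht.2.le⟩ ?_ (hr t ht)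
    filter_upwards [self_mem_nhdsWithin, mem_nhdsWithin_of_mem_nhds (Iio_mem_nhds ht.2)]
      with r h1 h2
    exact ⟨ht.1.trans h1, le_of_lt h2⟩
  · intro t ht
    obtain ⟨l, hl⟩ := hl t ht
    have hev : ∀ᶠ r in 𝓝[<] t, r ∈ Icc 0 T := by
      filter_upwards [self_mem_nhdsWithin, mem_nhdsWithin_of_mem_nhds (Ioi_mem_nhds ht.1)]
        with r h1 h2
      exact ⟨le_of_lt h2, (le_of_lt h1).trans ht.2⟩
    -- Closedness of `C` is needed only here: a left limit need not be a value of `f`, yet `φ` must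
    -- be continuous there.
    have hlC : l ∈ C := hC.mem_of_tendsto hl (hev.mono fun r hr => hfC r hr)
    exact ⟨φ l, (hφ l hlC).tendsto.comp
      (tendsto_nhdsWithin_iff.2 ⟨hl, hev.mono fun r hr => hfC r hr⟩)⟩
  · refine key T _ ⟨hT.le, le_rfl⟩ ?_ hTl
    filter_upwards [self_mem_nhdsWithin, mem_nhdsWithin_of_mem_nhds (Ioi_mem_nhds hT)] with r h1 h2
    exact ⟨le_of_lt h2, h1⟩

theorem map [TopologicalSpace E] [TopologicalSpace F] {f : ℝ → E} {φ : E → F}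
    (hf : PiecewiseContinuous T f) (hφ : Continuous φ) :
    PiecewiseContinuous T (fun t => φ (f t)) := by
  obtain ⟨⟨s, hs⟩, hr, hl, hTl⟩ := hf
  refine ⟨⟨s, fun t ht hts => hφ.continuousAt.comp_continuousWithinAt (hs t ht hts)⟩,
    fun t ht => hφ.continuousAt.comp_continuousWithinAt (hr t ht), fun t ht => ?_,
    hφ.continuousAt.comp_continuousWithinAt hTl⟩
  obtain ⟨l, hl⟩ := hl t ht
  exact ⟨φ l, (hφ.tendsto l).comp hl⟩

theorem prodMk [TopologicalSpace E] [TopologicalSpace F] {f : ℝ → E} {g : ℝ → F}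
    (hf : PiecewiseContinuous T f) (hg : PiecewiseContinuous T g) :
    PiecewiseContinuous T (fun t => (f t, g t)) := by
  classical
  obtain ⟨⟨s, hs⟩, hr, hl, hTl⟩ := hf
  obtain ⟨⟨s', hs'⟩, hr', hl', hTl'⟩ := hg
  refine ⟨⟨s ∪ s', fun t ht hts => ?_⟩, fun t ht => (hr t ht).prodMk (hr' t ht), fun t ht => ?_,
    hTl.prodMk hTl'⟩
  · rw [Finset.mem_union, not_or] at hts
    exact (hs t ht hts.1).prodMk (hs' t ht hts.2)
  · obtain ⟨l, hl⟩ := hl t ht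
    obtain ⟨l', hl'⟩ := hl' t ht
    exact ⟨(l, l'), hl.prodMk_nhds hl'⟩

theorem map₂ [TopologicalSpace E] [TopologicalSpace F] [TopologicalSpace G] {f : ℝ → E}
    {g : ℝ → F} {φ : E → F → G} (hf : PiecewiseContinuous T f) (hg : PiecewiseContinuous T g)
    (hφ : Continuous fun p : E × F => φ p.1 p.2) :
    PiecewiseContinuous T (fun t => φ (f t) (g t)) :=
  (hf.prodMk hg).map hφ

theorem of_continuousOn [TopologicalSpace E] {f : ℝ → E} (hT : 0 < T)
    (hf : ContinuousOn f (Icc 0 T)) : PiecewiseContinuous T f := by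
  refine ⟨⟨∅, fun t ht _ => hf t ht⟩, fun t ht => ?_, fun t ht => ⟨f t, ?_⟩, ?_⟩
  · refine (hf t ⟨ht.1, ht.2.le⟩).mono_of_mem_nhdsWithin ?_
    filter_upwards [self_mem_nhdsWithin, mem_nhdsWithin_of_mem_nhds (Iio_mem_nhds ht.2)]
      with r h1 h2
    exact ⟨ht.1.trans h1, le_of_lt h2⟩
  · refine (hf t ⟨ht.1.le, ht.2⟩).mono_left ?_
    refine nhdsWithin_le_of_mem ?_
    filter_upwards [self_mem_nhdsWithin, mem_nhdsWithin_of_mem_nhds (Ioi_mem_nhds ht.1)]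
      with r h1 h2
    exact ⟨le_of_lt h2, (le_of_lt h1).trans ht.2⟩
  · refine (hf T ⟨hT.le, le_rfl⟩).mono_of_mem_nhdsWithin ?_
    filter_upwards [self_mem_nhdsWithin, mem_nhdsWithin_of_mem_nhds (Ioi_mem_nhds hT)] with r h1 h2
    exact ⟨le_of_lt h2, h1⟩

theorem const [TopologicalSpace E] (c : E) : PiecewiseContinuous T (fun _ => c) :=
  ⟨⟨∅, fun _ _ _ => continuousWithinAt_const⟩, fun _ _ => continuousWithinAt_const,
    fun _ _ => ⟨c, tendsto_const_nhds⟩, continuousWithinAt_const⟩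

/-- One-sided limits bound `f` near each point, separately to the left and to the right; compactness
of the interval makes the bound global. -/
theorem exists_bound [SeminormedAddCommGroup E] {f : ℝ → E} (hf : PiecewiseContinuous T f) :
    ∃ K : ℝ, 0 ≤ K ∧ ∀ t ∈ Icc 0 T, ‖f t‖ ≤ K := by
  obtain ⟨-, hr, hl, hTl⟩ := hf
  suffices h : ∃ K : ℝ, ∀ t ∈ Icc 0 T, ‖f t‖ ≤ K by
    obtain ⟨K, hK⟩ := h
    exact ⟨max K 0, le_max_right _ _, fun t ht => (hK t ht).trans (le_max_left _ _)⟩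
  have hloc : ∀ (l : Filter ℝ) (a : E), Tendsto f l (𝓝 a) → ∀ᶠ r in l, ‖f r‖ ≤ ‖a‖ + 1 :=
    fun l a h => (h.norm.eventually_lt_const (lt_add_one _)).mono fun r hr => hr.le
  refine isCompact_Icc.induction_on (p := fun s => ∃ K : ℝ, ∀ t ∈ s, ‖f t‖ ≤ K)
    ⟨0, by simp⟩ ?_ ?_ ?_
  · rintro s t hst ⟨K, hK⟩
    exact ⟨K, fun r hr => hK r (hst hr)⟩
  · rintro s t ⟨K, hK⟩ ⟨K', hK'⟩
    refine ⟨max K K', ?_⟩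
    rintro r (hr | hr)
    · exact (hK r hr).trans (le_max_left _ _)
    · exact (hK' r hr).trans (le_max_right _ _)
  · intro t ht
    have h1 : ∃ K : ℝ, ∀ᶠ r in 𝓝[Icc 0 T ∩ Iio t] t, ‖f r‖ ≤ K := by
      rcases ht.1.eq_or_lt with h0 | h0
      · refine ⟨0, ?_⟩
        have : Icc 0 T ∩ Iio t = ∅ := by
          ext r; simp only [mem_inter_iff, mem_Icc, mem_Iio, mem_empty_iff_false, iff_false]
          rintro ⟨h, h'⟩; linarith [h.1]
        rw [this]; simp
      · obtain ⟨l, hl⟩ := hl t ⟨h0, ht.2⟩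
        exact ⟨_, (hloc _ _ hl).filter_mono (nhdsWithin_mono _ inter_subset_right)⟩
    have h2 : ∃ K : ℝ, ∀ᶠ r in 𝓝[Icc 0 T ∩ Ici t] t, ‖f r‖ ≤ K := by
      rcases ht.2.eq_or_lt with h0 | h0
      · subst h0
        exact ⟨_, (hloc _ _ hTl).filter_mono (nhdsWithin_mono _ fun r hr => hr.1.2)⟩
      · exact ⟨_, (hloc _ _ (hr t ⟨ht.1, h0⟩)).filter_mono
          (nhdsWithin_mono _ inter_subset_right)⟩
    obtain ⟨K1, h1⟩ := h1
    obtain ⟨K2, h2⟩ := h2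
    have hset : Icc 0 T = (Icc 0 T ∩ Iio t) ∪ (Icc 0 T ∩ Ici t) := by
      rw [← inter_union_distrib_left, Iio_union_Ici, inter_univ]
    refine ⟨{r | ‖f r‖ ≤ max K1 K2}, ?_, ⟨max K1 K2, fun r hr => hr⟩⟩
    rw [hset, nhdsWithin_union]
    exact ⟨h1.mono fun r hr => hr.trans (le_max_left _ _),
      h2.mono fun r hr => hr.trans (le_max_right _ _)⟩

theorem aestronglyMeasurable [TopologicalSpace E] [TopologicalSpace.PseudoMetrizableSpace E]
    [SecondCountableTopology E] {f : ℝ → E}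
    (hf : PiecewiseContinuous T f) : AEStronglyMeasurable f (volume.restrict (Icc 0 T)) := by
  obtain ⟨⟨s, hs⟩, -⟩ := hf
  have h1 : ContinuousOn f (Icc 0 T \ s) := fun t ht =>
    (hs t ht.1 ht.2).mono sdiff_subset
  have h2 := h1.aestronglyMeasurable (μ := volume)
    (measurableSet_Icc.diff s.finite_toSet.measurableSet)
  rwa [Measure.restrict_congr_set] at h2
  exact sdiff_null_ae_eq_self (s.finite_toSet.measure_zero volume)

theorem aestronglyMeasurable_matrix {m n : Type*} [Fintype m] [Fintype n]
    {f : ℝ → Matrix m n ℝ} (hf : PiecewiseContinuous T f) :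
    AEStronglyMeasurable f (volume.restrict (Icc 0 T)) :=
  aestronglyMeasurable (E := m → n → ℝ) hf

theorem matrix_mul {l m n : Type*} [Fintype m] {f : ℝ → Matrix l m ℝ} {g : ℝ → Matrix m n ℝ}
    (hf : PiecewiseContinuous T f)
    (hg : PiecewiseContinuous T g) : PiecewiseContinuous T (fun t => f t * g t) :=
  hf.map₂ hg (continuous_fst.matrix_mul continuous_snd)

theorem transpose {m n : Type*} {f : ℝ → Matrix m n ℝ} (hf : PiecewiseContinuous T f) :
    PiecewiseContinuous T (fun t => (f t)ᵀ) :=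
  hf.map (continuous_id.matrix_transpose)

theorem add [TopologicalSpace E] [Add E] [ContinuousAdd E] {f g : ℝ → E}
    (hf : PiecewiseContinuous T f) (hg : PiecewiseContinuous T g) :
    PiecewiseContinuous T (fun t => f t + g t) :=
  hf.map₂ hg continuous_add

theorem sub [TopologicalSpace E] [AddGroup E] [IsTopologicalAddGroup E] {f g : ℝ → E}
    (hf : PiecewiseContinuous T f) (hg : PiecewiseContinuous T g) :
    PiecewiseContinuous T (fun t => f t - g t) :=
  hf.map₂ hg continuous_sub

theorem neg [TopologicalSpace E] [AddGroup E] [IsTopologicalAddGroup E] {f : ℝ → E}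
    (hf : PiecewiseContinuous T f) : PiecewiseContinuous T (fun t => -f t) :=
  hf.map continuous_neg

theorem const_smul [TopologicalSpace E] [AddCommGroup E] [Module ℝ E] [ContinuousSMul ℝ E]
    {f : ℝ → E} (c : ℝ) (hf : PiecewiseContinuous T f) :
    PiecewiseContinuous T (fun t => c • f t) :=
  hf.map (continuous_const_smul c)

/-- The inverse of a piecewise continuous matrix function which is uniformly coercive. -/
theorem matrix_inv {n : Type*} [Fintype n] [DecidableEq n] {f : ℝ → Matrix n n ℝ} (hT : 0 < T)
    (hf : PiecewiseContinuous T f) {c : ℝ} (hc : 0 < c)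
    (hpos : ∀ t ∈ Icc 0 T, ∀ v : n → ℝ, c * (v ⬝ᵥ v) ≤ v ⬝ᵥ (f t *ᵥ v)) :
    PiecewiseContinuous T (fun t => (f t)⁻¹) := by
  -- Coercivity with a fixed constant is a closed condition, so it passes to the left limits and
  -- keeps them invertible. Pointwise invertibility would not.
  have hcl : IsClosed {R : Matrix n n ℝ | ∀ v : n → ℝ, c * (v ⬝ᵥ v) ≤ v ⬝ᵥ (R *ᵥ v)} := by
    simp only [ofPred_forall]
    refine isClosed_iInter fun v => isClosed_le continuous_const ?_
    exact continuous_const.dotProduct (continuous_id.matrix_mulVec continuous_const)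
  refine hf.map_of_continuousOn hT hcl hpos fun R hR => ContinuousAt.continuousWithinAt ?_
  refine continuousAt_matrix_inv R ?_
  rw [Ring.inverse_eq_inv']
  refine continuousAt_inv₀ fun hdet => ?_
  obtain ⟨v, hv, hRv⟩ := exists_mulVec_eq_zero_iff.2 hdet
  have := hR v
  rw [hRv, dotProduct_zero] at this
  have hpos : 0 < v ⬝ᵥ v := by
    have := dotProduct_star_self_pos_iff.2 hv
    simpa using this
  nlinarith

end PiecewiseContinuous

theorem isUnit_det_of_coercive {n : Type*} [Fintype n] [DecidableEq n] {R : Matrix n n ℝ} {c : ℝ}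
    (hc : 0 < c) (hR : ∀ v : n → ℝ, c * (v ⬝ᵥ v) ≤ v ⬝ᵥ (R *ᵥ v)) : IsUnit R.det := by
  rw [isUnit_iff_ne_zero]
  intro hdet
  obtain ⟨v, hv, hRv⟩ := exists_mulVec_eq_zero_iff.2 hdet
  have := hR v
  rw [hRv, dotProduct_zero] at this
  have hpos : 0 < v ⬝ᵥ v := by
    have := dotProduct_star_self_pos_iff.2 hv
    simpa using this
  nlinarith

/-! ### Square roots of positive semidefinite matrices -/

section sqrt
open scoped Matrix.Norms.L2Operator MatrixOrder

theorem continuousOn_matrix_sqrt {n : Type*} [Fintype n] [DecidableEq n] :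
    ContinuousOn (CFC.sqrt : Matrix n n ℝ → Matrix n n ℝ) {a | a.PosSemidef} := by
  have h := CFC.continuousOn_sqrt (A := Matrix n n ℝ)
  simpa only [Matrix.nonneg_iff_posSemidef] using h

theorem sqrt_transpose_mul_sqrt {n : Type*} [Fintype n] [DecidableEq n] {R : Matrix n n ℝ}
    (hR : R.PosSemidef) : (CFC.sqrt R)ᵀ * CFC.sqrt R = R := by
  have h1 : (CFC.sqrt R)ᵀ = CFC.sqrt R := by
    have := (CFC.sqrt_nonneg R).posSemidef.1
    rwa [IsHermitian, conjTranspose_eq_transpose_of_trivial] at this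
  rw [h1, CFC.sqrt_mul_sqrt_self R hR.nonneg]

end sqrt

/-- A piecewise continuous positive semidefinite matrix function has a piecewise continuous
square root. -/
theorem PiecewiseContinuous.exists_sqrt {n : Type*} [Fintype n] [DecidableEq n] {T : ℝ}
    (hT : 0 < T) {f : ℝ → Matrix n n ℝ} (hf : PiecewiseContinuous T f)
    (hpos : ∀ t ∈ Icc 0 T, (f t).PosSemidef) :
    ∃ W : ℝ → Matrix n n ℝ, PiecewiseContinuous T W ∧
      ∀ t ∈ Icc 0 T, f t = (W t)ᵀ * W t := by
  have hcl : IsClosed {R : Matrix n n ℝ | R.PosSemidef} := by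
    have : {R : Matrix n n ℝ | R.PosSemidef} =
        {R | Rᴴ = R} ∩ ⋂ v : n → ℝ, {R | 0 ≤ star v ⬝ᵥ (R *ᵥ v)} := by
      ext R
      simp [posSemidef_iff_dotProduct_mulVec, IsHermitian]
    rw [this]
    refine (isClosed_eq continuous_id.matrix_conjTranspose continuous_id).inter
      (isClosed_iInter fun v => isClosed_le continuous_const ?_)
    exact continuous_const.dotProduct (continuous_id.matrix_mulVec continuous_const)
  exact ⟨_, hf.map_of_continuousOn hT hcl hpos continuousOn_matrix_sqrt,
    fun t ht => (sqrt_transpose_mul_sqrt (hpos t ht)).symm⟩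

/-! ### Signals in `L₂[0,T]` -/

namespace IsL2

variable {m n p : Type*} [Fintype m] [Fintype n] [Fintype p] {T : ℝ}

theorem integrable {u : ℝ → m → ℝ} (hu : IsL2 T u) : Integrable u (volume.restrict (Icc 0 T)) :=
  MemLp.integrable (by norm_num) hu

theorem intervalIntegrable {u : ℝ → m → ℝ} (hT : 0 ≤ T) (hu : IsL2 T u) :
    IntervalIntegrable u volume 0 T :=
  (intervalIntegrable_iff_integrableOn_Icc_of_le hT).2 hu.integrable

theorem mulVec {A : ℝ → Matrix n m ℝ} {u : ℝ → m → ℝ} (hA : PiecewiseContinuous T A)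
    (hu : IsL2 T u) : IsL2 T (fun t => A t *ᵥ u t) := by
  obtain ⟨K, -, hK⟩ := hA.exists_bound
  refine MemLp.of_le_mul (c := K) hu ?_ ?_
  · exact (continuous_fst.matrix_mulVec continuous_snd).comp_aestronglyMeasurable₂
      hA.aestronglyMeasurable_matrix hu.1
  · filter_upwards [ae_restrict_mem measurableSet_Icc] with t ht
    exact (linfty_opNorm_mulVec _ _).trans (by gcongr; exact hK t ht)

theorem of_continuousOn {u : ℝ → m → ℝ} (hu : ContinuousOn u (Icc 0 T)) : IsL2 T u :=
  have ⟨K, hK⟩ := isCompact_Icc.exists_bound_of_continuousOn hu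
  MemLp.of_bound (hu.aestronglyMeasurable measurableSet_Icc) K (by
    filter_upwards [ae_restrict_mem measurableSet_Icc] with t ht using hK t ht)

theorem add {u v : ℝ → m → ℝ} (hu : IsL2 T u) (hv : IsL2 T v) : IsL2 T (fun t => u t + v t) :=
  MemLp.add hu hv

theorem const_smul {u : ℝ → m → ℝ} (c : ℝ) (hu : IsL2 T u) : IsL2 T (fun t => c • u t) :=
  MemLp.const_smul hu c

theorem mono {T' : ℝ} {u : ℝ → m → ℝ} (hu : IsL2 T u) (h : T' ≤ T) : IsL2 T' u :=
  MemLp.mono_measure (Measure.restrict_mono (Icc_subset_Icc_right h) le_rfl) hu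

theorem eval {u : ℝ → m → ℝ} (hu : IsL2 T u) (i : m) :
    MemLp (fun t => u t i) 2 (volume.restrict (Icc 0 T)) := by
  refine MemLp.of_le hu ?_ (Eventually.of_forall fun t => norm_le_pi_norm _ i)
  exact (continuous_apply i).comp_aestronglyMeasurable hu.1

theorem of_eval {u : ℝ → m → ℝ} (hu : ∀ i, MemLp (fun t => u t i) 2 (volume.restrict (Icc 0 T))) :
    IsL2 T u :=
  memLp_pi_iff.2 hu

theorem inl {u : ℝ → m ⊕ n → ℝ} (hu : IsL2 T u) : IsL2 T (fun t i => u t (Sum.inl i)) :=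
  of_eval fun _ => hu.eval _

theorem inr {u : ℝ → m ⊕ n → ℝ} (hu : IsL2 T u) : IsL2 T (fun t i => u t (Sum.inr i)) :=
  of_eval fun _ => hu.eval _

theorem integrable_dotProduct {u v : ℝ → m → ℝ} (hu : IsL2 T u) (hv : IsL2 T v) :
    Integrable (fun t => u t ⬝ᵥ v t) (volume.restrict (Icc 0 T)) := by
  simp only [dotProduct]
  exact integrable_finsetSum _ fun i _ => (hu.eval i).integrable_mul (hv.eval i)

theorem intervalIntegrable_dotProduct {u v : ℝ → m → ℝ} (hT : 0 ≤ T) (hu : IsL2 T u)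
    (hv : IsL2 T v) : IntervalIntegrable (fun t => u t ⬝ᵥ v t) volume 0 T :=
  (intervalIntegrable_iff_integrableOn_Icc_of_le hT).2 (hu.integrable_dotProduct hv)

end IsL2

/-! ### The sup norm compared with the Euclidean square -/

section dotProduct

variable {m n : Type*} [Fintype m] [Fintype n]

theorem dotProduct_self_nonneg' (v : m → ℝ) : 0 ≤ v ⬝ᵥ v :=
  Finset.sum_nonneg fun i _ => mul_self_nonneg (v i)

theorem norm_sq_le_dotProduct (v : m → ℝ) : ‖v‖ ^ 2 ≤ v ⬝ᵥ v := by
  rw [← Real.le_sqrt (norm_nonneg _) (dotProduct_self_nonneg' v)]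
  refine (pi_norm_le_iff_of_nonneg (Real.sqrt_nonneg _)).2 fun i => ?_
  refine Real.le_sqrt_of_sq_le ?_
  rw [Real.norm_eq_abs, sq_abs, sq]
  exact Finset.single_le_sum (f := fun i => v i * v i) (fun i _ => mul_self_nonneg (v i))
    (Finset.mem_univ i)

theorem abs_dotProduct_le (v w : m → ℝ) : |v ⬝ᵥ w| ≤ Fintype.card m * (‖v‖ * ‖w‖) := by
  refine (Finset.abs_sum_le_sum_abs _ _).trans ?_
  refine (Finset.sum_le_card_nsmul _ _ (‖v‖ * ‖w‖) fun i _ => ?_).trans ?_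
  · rw [abs_mul]
    exact mul_le_mul (norm_le_pi_norm v i) (norm_le_pi_norm w i) (abs_nonneg _) (norm_nonneg _)
  · rw [nsmul_eq_mul, Finset.card_univ]

theorem dotProduct_self_le (v : m → ℝ) : v ⬝ᵥ v ≤ Fintype.card m * ‖v‖ ^ 2 :=
  (le_abs_self _).trans ((abs_dotProduct_le v v).trans (by rw [sq]))

end dotProduct

/-! ### Linear integral equations -/

section Volterra

variable {E : Type*} [NormedAddCommGroup E] [NormedSpace ℝ E]

theorem intervalIntegral_exp_le {L t : ℝ} (hL : 0 < L) :
    ∫ s in (0 : ℝ)..t, Real.exp (L * s) ≤ Real.exp (L * t) / L := by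
  have : ∫ s in (0 : ℝ)..t, Real.exp (L * s) = (Real.exp (L * t) - 1) / L := by
    rw [intervalIntegral.integral_comp_mul_left (fun s => Real.exp s) hL.ne', integral_exp]
    simp [div_eq_inv_mul]
  rw [this]
  gcongr
  linarith

/-- Existence for integral equations with a right-hand side which is Lipschitz in the state. -/
theorem exists_integral_solution [CompleteSpace E] {T K : ℝ} (hT : 0 ≤ T) (hK : 0 ≤ K)
    {F : ℝ → E → E} (hLip : ∀ t ∈ Icc 0 T, ∀ x y, ‖F t x - F t y‖ ≤ K * ‖x - y‖)
    (hint : ∀ y : ℝ → E, Continuous y → IntervalIntegrable (fun t => F t (y t)) volume 0 T)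
    (x₀ : E) :
    ∃ x : ℝ → E, ContinuousOn x (Icc 0 T) ∧
      ∀ t ∈ Icc 0 T, x t = x₀ + ∫ s in (0 : ℝ)..t, F s (x s) := by
  -- Picard iteration for `y(t) = exp(-L t) x(t)`. In this weighted norm the integral operator has
  -- Lipschitz constant at most `K / L ≤ 1 / 2` on the whole interval at once; the `+ 1` keeps `L`
  -- positive when `K = 0`.
  set L : ℝ := 2 * K + 1 with hL
  have hL0 : 0 < L := by positivity
  let ext : C(Icc 0 T, E) → ℝ → E := fun y s => Real.exp (L * s) • y (projIcc 0 T hT s)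
  have hext : ∀ y, Continuous (ext y) := fun y => by
    have := y.continuous.comp (continuous_projIcc (h := hT))
    exact (Real.continuous_exp.comp (continuous_const.mul continuous_id)).smul this
  have hprim : ∀ y, ContinuousOn (fun t => ∫ s in (0 : ℝ)..t, F s (ext y s)) (Icc 0 T) :=
      fun y => by
    have := intervalIntegral.continuousOn_primitive_interval' (hint _ (hext y)) left_mem_uIcc
    rwa [uIcc_of_le hT] at this
  let Φ : C(Icc 0 T, E) → C(Icc 0 T, E) := fun y =>
    ⟨fun t => Real.exp (-(L * t)) • (x₀ + ∫ s in (0 : ℝ)..t, F s (ext y s)), by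
      have h1 : Continuous fun t : Icc 0 T => ∫ s in (0 : ℝ)..t, F s (ext y s) :=
        (hprim y).comp_continuous continuous_subtype_val fun t => t.2
      fun_prop⟩
  have hsub : ∀ y (t : ℝ), t ∈ Icc 0 T →
      IntervalIntegrable (fun s => F s (ext y s)) volume 0 t := fun y t ht =>
    (hint _ (hext y)).mono_set (by
      rw [uIcc_of_le ht.1, uIcc_of_le hT]; exact Icc_subset_Icc_right ht.2)
  have hcontr : ContractingWith (1 / 2) Φ := by
    refine ⟨by norm_num, LipschitzWith.of_dist_le_mul fun y z => ?_⟩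
    rw [ContinuousMap.dist_le (by positivity)]
    intro t
    rw [dist_eq_norm]
    change ‖Real.exp (-(L * t)) • (x₀ + ∫ s in (0 : ℝ)..t, F s (ext y s))
      - Real.exp (-(L * t)) • (x₀ + ∫ s in (0 : ℝ)..t, F s (ext z s))‖ ≤ _
    rw [← smul_sub, add_sub_add_left_eq_sub, ← intervalIntegral.integral_sub (hsub y t t.2)
      (hsub z t t.2), norm_smul, Real.norm_eq_abs, abs_of_pos (Real.exp_pos _)]
    have h1 : ‖∫ s in (0 : ℝ)..t, F s (ext y s) - F s (ext z s)‖ ≤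
        ∫ s in (0 : ℝ)..t, K * dist y z * Real.exp (L * s) := by
      refine intervalIntegral.norm_integral_le_of_norm_le t.2.1 ?_
        (Continuous.intervalIntegrable (by fun_prop) _ _)
      refine Eventually.of_forall fun s hs => ?_
      have hs' : s ∈ Icc 0 T := ⟨hs.1.le, hs.2.trans t.2.2⟩
      refine (hLip s hs' _ _).trans ?_
      simp only [ext]
      rw [← smul_sub, norm_smul, Real.norm_eq_abs, abs_of_pos (Real.exp_pos _), ← dist_eq_norm]
      have := ContinuousMap.dist_apply_le_dist (f := y) (g := z) (projIcc 0 T hT s)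
      have h2 := Real.exp_pos (L * s)
      calc K * (Real.exp (L * s) * dist (y (projIcc 0 T hT s)) (z (projIcc 0 T hT s)))
          ≤ K * (Real.exp (L * s) * dist y z) := by gcongr
        _ = _ := by ring
    rw [intervalIntegral.integral_const_mul] at h1
    calc Real.exp (-(L * t)) * ‖∫ s in (0 : ℝ)..t, F s (ext y s) - F s (ext z s)‖
        ≤ Real.exp (-(L * t)) * (K * dist y z * (Real.exp (L * t) / L)) := by
          gcongr
          exact h1.trans (by gcongr; exact intervalIntegral_exp_le hL0)
      _ = K / L * dist y z := by
          rw [Real.exp_neg]; field_simp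
      _ ≤ _ := by
          gcongr
          rw [NNReal.coe_div, NNReal.coe_one, NNReal.coe_ofNat, div_le_div_iff₀ hL0 two_pos]
          linarith
  obtain ⟨y, hy⟩ : ∃ y, Φ y = y := ⟨_, hcontr.fixedPoint_isFixedPt⟩
  refine ⟨ext y, (hext y).continuousOn, fun t ht => ?_⟩
  have h1 : y ⟨t, ht⟩ = Real.exp (-(L * t)) • (x₀ + ∫ s in (0 : ℝ)..t, F s (ext y s)) :=
    (congrArg (fun z : C(Icc 0 T, E) => z ⟨t, ht⟩) hy).symm
  change Real.exp (L * t) • y (projIcc 0 T hT t) = _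
  rw [projIcc_of_mem hT ht, h1, smul_smul, ← Real.exp_add, add_neg_cancel, Real.exp_zero, one_smul]

/-- A Grönwall bound for solutions of linear integral inequalities. -/
theorem norm_le_of_integral_eq {T a : ℝ} (hT : 0 ≤ T) (ha : 0 ≤ a) {x f : ℝ → E} {g : ℝ → ℝ}
    (hx : ContinuousOn x (Icc 0 T)) (hxf : ∀ t ∈ Icc 0 T, x t = ∫ s in (0 : ℝ)..t, f s)
    (hg : IntervalIntegrable g volume 0 T) (hg0 : ∀ t ∈ Icc 0 T, 0 ≤ g t)
    (hf : ∀ t ∈ Icc 0 T, ‖f t‖ ≤ a * ‖x t‖ + g t) {t : ℝ} (ht : t ∈ Icc 0 T) :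
    ‖x t‖ ≤ 2 * Real.exp ((2 * a + 1) * T) * ∫ s in (0 : ℝ)..T, g s := by
  set L : ℝ := 2 * a + 1 with hL
  have hL0 : 0 < L := by positivity
  have hcont : ContinuousOn (fun t => Real.exp (-(L * t)) * ‖x t‖) (Icc 0 T) :=
    (Continuous.continuousOn (by fun_prop)).mul hx.norm
  -- The maximum `m` of the weighted norm replaces the usual Grönwall iteration: evaluating the
  -- integral equation at the maximizer gives `m ≤ (a / L) m + ∫ g` with `a / L ≤ 1 / 2`, and the
  -- first term is absorbed.
  obtain ⟨r, hr, hmax⟩ := isCompact_Icc.exists_isMaxOn ⟨0, le_rfl, hT⟩ hcont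
  set m := Real.exp (-(L * r)) * ‖x r‖ with hm
  have hm' : ∀ s ∈ Icc 0 T, ‖x s‖ ≤ m * Real.exp (L * s) := fun s hs => by
    have h := hmax hs
    simp only [mem_ofPred_eq] at h
    rw [← div_le_iff₀ (Real.exp_pos _), div_eq_inv_mul, ← Real.exp_neg]
    exact h
  have hgr : IntervalIntegrable g volume 0 r :=
    hg.mono_set (by rw [uIcc_of_le hr.1, uIcc_of_le hT]; exact Icc_subset_Icc_right hr.2)
  have hgrT : ∫ s in (0 : ℝ)..r, g s ≤ ∫ s in (0 : ℝ)..T, g s := by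
    refine intervalIntegral.integral_mono_interval le_rfl hr.1 hr.2 ?_ hg
    filter_upwards [ae_restrict_mem measurableSet_Ioc] with s hs using hg0 s ⟨hs.1.le, hs.2⟩
  have hI0 : 0 ≤ ∫ s in (0 : ℝ)..T, g s := intervalIntegral.integral_nonneg hT hg0
  have hm0 : 0 ≤ m := by positivity
  have hcexp : IntervalIntegrable (fun s => a * m * Real.exp (L * s)) volume 0 r :=
    Continuous.intervalIntegrable (by fun_prop) _ _
  have h1 : ‖x r‖ ≤ a * m * (Real.exp (L * r) / L) + ∫ s in (0 : ℝ)..T, g s := by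
    calc ‖x r‖ = ‖∫ s in (0 : ℝ)..r, f s‖ := by rw [hxf r hr]
      _ ≤ ∫ s in (0 : ℝ)..r, (a * m * Real.exp (L * s) + g s) := by
        refine intervalIntegral.norm_integral_le_of_norm_le hr.1 ?_ (hcexp.add hgr)
        refine Eventually.of_forall fun s hs => ?_
        have hs' : s ∈ Icc 0 T := ⟨hs.1.le, hs.2.trans hr.2⟩
        refine (hf s hs').trans ?_
        rw [mul_assoc]
        gcongr
        exact hm' s hs'
      _ = a * m * (∫ s in (0 : ℝ)..r, Real.exp (L * s)) + ∫ s in (0 : ℝ)..r, g s := by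
        rw [intervalIntegral.integral_add hcexp hgr, intervalIntegral.integral_const_mul]
      _ ≤ _ := by
        gcongr
        exact intervalIntegral_exp_le hL0
  have h2 : m ≤ m / 2 + ∫ s in (0 : ℝ)..T, g s := by
    calc m ≤ Real.exp (-(L * r)) * (a * m * (Real.exp (L * r) / L) + ∫ s in (0 : ℝ)..T, g s) := by
          rw [hm]; gcongr
      _ = a / L * m + Real.exp (-(L * r)) * ∫ s in (0 : ℝ)..T, g s := by
          rw [Real.exp_neg]; field_simp
      _ ≤ 1 / 2 * m + 1 * ∫ s in (0 : ℝ)..T, g s := by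
          gcongr ?_ * m + ?_ * _
          · rw [div_le_div_iff₀ hL0 two_pos]; linarith
          · rw [Real.exp_le_one_iff]; have := mul_nonneg hL0.le hr.1; linarith
      _ = _ := by ring
  have h3 : m ≤ 2 * ∫ s in (0 : ℝ)..T, g s := by linarith
  calc ‖x t‖ ≤ m * Real.exp (L * t) := hm' t ht
    _ ≤ (2 * ∫ s in (0 : ℝ)..T, g s) * Real.exp (L * T) := by
        gcongr
        exact ht.2
    _ = _ := by ring

end Volterra

/-- `x` solves `ẋ = A x + B u`, `x(0) = 0` on `[0,T]`, in integrated form. -/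
def IsTrajectory {n m : Type*} [Fintype n] [Fintype m] (A : ℝ → Matrix n n ℝ)
    (B : ℝ → Matrix n m ℝ) (T : ℝ) (u : ℝ → m → ℝ) (x : ℝ → n → ℝ) : Prop :=
  ContinuousOn x (Icc 0 T) ∧
  ∀ t ∈ Icc 0 T, x t = ∫ s in (0 : ℝ)..t, (A s *ᵥ x s + B s *ᵥ u s)

/-! ### Existence of trajectories and their bounds in terms of the input -/

section Trajectory

variable {n m : Type*} [Fintype n] [Fintype m] {A : ℝ → Matrix n n ℝ} {B : ℝ → Matrix n m ℝ}
  {T : ℝ}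

theorem exists_trajectory (hT : 0 ≤ T) (hA : PiecewiseContinuous T A)
    (hB : PiecewiseContinuous T B) {u : ℝ → m → ℝ} (hu : IsL2 T u) :
    ∃ x, IsTrajectory A B T u x := by
  obtain ⟨K, hK0, hK⟩ := hA.exists_bound
  obtain ⟨x, hx, hx'⟩ := exists_integral_solution (F := fun t x => A t *ᵥ x + B t *ᵥ u t) hT hK0
    (fun t ht x y => by
      rw [add_sub_add_right_eq_sub, ← mulVec_sub]
      exact (linfty_opNorm_mulVec _ _).trans (by gcongr; exact hK t ht))
    (fun y hy => (((IsL2.of_continuousOn hy.continuousOn).mulVec hA).add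
      (hu.mulVec hB)).intervalIntegrable hT) 0
  exact ⟨x, hx, by simpa using hx'⟩

/-- The bound is by the `L₁` norm of the input on purpose: a pulse of length `h` then moves the
state by `O(h)`, whereas the `L₂` norm would only give `O(√h)`, too weak for
`feedthrough_le_of_cost_le`. -/
theorem IsTrajectory.exists_norm_le (hT : 0 ≤ T) (hA : PiecewiseContinuous T A)
    (hB : PiecewiseContinuous T B) :
    ∃ c : ℝ, 0 ≤ c ∧ ∀ u x, IsL2 T u → IsTrajectory A B T u x →
      ∀ t ∈ Icc 0 T, ‖x t‖ ≤ c * ∫ s in (0 : ℝ)..T, ‖u s‖ := by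
  obtain ⟨K, hK0, hK⟩ := hA.exists_bound
  obtain ⟨b, hb0, hb⟩ := hB.exists_bound
  refine ⟨2 * Real.exp ((2 * K + 1) * T) * b, by positivity, fun u x hu hx t ht => ?_⟩
  have := norm_le_of_integral_eq (g := fun s => b * ‖u s‖) hT hK0 hx.1 hx.2
    ((hu.intervalIntegrable hT).norm.const_mul b) (fun t _ => by positivity)
    (fun t ht => (norm_add_le _ _).trans (add_le_add
      ((linfty_opNorm_mulVec _ _).trans (by gcongr; exact hK t ht))
      ((linfty_opNorm_mulVec _ _).trans (by gcongr; exact hb t ht)))) ht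
  rwa [intervalIntegral.integral_const_mul, ← mul_assoc] at this

/-- Cauchy–Schwarz, obtained by integrating the square of `‖u‖` minus its mean `I / T`. -/
theorem sq_integral_norm_le (hT : 0 < T) {u : ℝ → m → ℝ} (hu : IsL2 T u) :
    (∫ s in (0 : ℝ)..T, ‖u s‖) ^ 2 ≤ T * energy T u := by
  set I := ∫ s in (0 : ℝ)..T, ‖u s‖ with hI
  have h1 : 0 ≤ ∫ s in (0 : ℝ)..T, (u s ⬝ᵥ u s - (2 * (I / T)) * ‖u s‖ + (I / T) ^ 2) := by
    refine intervalIntegral.integral_nonneg hT.le fun s _ => ?_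
    have := norm_sq_le_dotProduct (u s)
    nlinarith [sq_nonneg (‖u s‖ - I / T)]
  have hi1 := hu.intervalIntegrable_dotProduct hT.le hu
  have hi2 := (hu.intervalIntegrable hT.le).norm.const_mul (2 * (I / T))
  rw [intervalIntegral.integral_add (hi1.sub hi2) (by simp), intervalIntegral.integral_sub hi1 hi2,
    intervalIntegral.integral_const_mul, ← hI, intervalIntegral.integral_const, sub_zero,
    smul_eq_mul] at h1
  have h2 : T * (2 * (I / T) * I - T * (I / T) ^ 2) = I ^ 2 := by field_simp; ring
  have h3 : energy T u = ∫ s in (0 : ℝ)..T, u s ⬝ᵥ u s := rfl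
  rw [← h3] at h1
  nlinarith

/-- The state is bounded in terms of the `L₂` norm of the input. -/
theorem IsTrajectory.exists_dotProduct_le (hT : 0 < T) (hA : PiecewiseContinuous T A)
    (hB : PiecewiseContinuous T B) :
    ∃ c : ℝ, 0 ≤ c ∧ ∀ u x, IsL2 T u → IsTrajectory A B T u x →
      ∀ t ∈ Icc 0 T, x t ⬝ᵥ x t ≤ c * energy T u := by
  obtain ⟨c, hc0, hc⟩ := IsTrajectory.exists_norm_le hT.le hA hB
  refine ⟨Fintype.card n * (c ^ 2 * T), by positivity, fun u x hu hx t ht => ?_⟩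
  refine (dotProduct_self_le _).trans ?_
  rw [mul_assoc]
  gcongr
  calc ‖x t‖ ^ 2 ≤ (c * ∫ s in (0 : ℝ)..T, ‖u s‖) ^ 2 := by gcongr; exact hc u x hu hx t ht
    _ = c ^ 2 * (∫ s in (0 : ℝ)..T, ‖u s‖) ^ 2 := by ring
    _ ≤ c ^ 2 * (T * energy T u) := by gcongr; exact sq_integral_norm_le hT hu
    _ = _ := by ring

theorem energy_nonneg (hT : 0 ≤ T) (u : ℝ → m → ℝ) : 0 ≤ energy T u :=
  intervalIntegral.integral_nonneg hT fun _ _ => dotProduct_self_nonneg' _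

theorem IsTrajectory.exists_energy_le (hT : 0 < T) (hA : PiecewiseContinuous T A)
    (hB : PiecewiseContinuous T B) :
    ∃ c : ℝ, 0 ≤ c ∧ ∀ u x, IsL2 T u → IsTrajectory A B T u x → energy T x ≤ c * energy T u := by
  obtain ⟨c, hc0, hc⟩ := IsTrajectory.exists_dotProduct_le hT hA hB
  refine ⟨T * c, by positivity, fun u x hu hx => ?_⟩
  have hxL := IsL2.of_continuousOn hx.1
  calc energy T x ≤ ∫ _ in (0 : ℝ)..T, c * energy T u :=
        intervalIntegral.integral_mono_on hT.le (hxL.intervalIntegrable_dotProduct hT.le hxL)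
          (by simp) (hc u x hu hx)
    _ = _ := by simp; ring

theorem IsTrajectory.isL2 {u : ℝ → m → ℝ} {x : ℝ → n → ℝ} (hx : IsTrajectory A B T u x) :
    IsL2 T x :=
  IsL2.of_continuousOn hx.1

/-- The energy of the image of an `L₂` signal under a piecewise continuous matrix function. -/
theorem PiecewiseContinuous.exists_energy_mulVec_le (hT : 0 ≤ T) (hB : PiecewiseContinuous T B) :
    ∃ c : ℝ, 0 ≤ c ∧ ∀ u, IsL2 T u → energy T (fun t => B t *ᵥ u t) ≤ c * energy T u := by
  obtain ⟨b, hb0, hb⟩ := hB.exists_bound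
  refine ⟨Fintype.card n * b ^ 2, by positivity, fun u hu => ?_⟩
  have hBu := hu.mulVec hB
  rw [energy, energy, ← intervalIntegral.integral_const_mul]
  refine intervalIntegral.integral_mono_on hT (hBu.intervalIntegrable_dotProduct hT hBu)
    ((hu.intervalIntegrable_dotProduct hT hu).const_mul _) fun t ht => ?_
  refine (dotProduct_self_le _).trans ?_
  rw [mul_assoc]
  gcongr
  calc ‖B t *ᵥ u t‖ ^ 2 ≤ (b * ‖u t‖) ^ 2 := by
        gcongr; exact (linfty_opNorm_mulVec _ _).trans (by gcongr; exact hb t ht)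
    _ = b ^ 2 * ‖u t‖ ^ 2 := by ring
    _ ≤ _ := by gcongr; exact norm_sq_le_dotProduct _

theorem energy_add_le (hT : 0 ≤ T) {u v : ℝ → m → ℝ} (hu : IsL2 T u) (hv : IsL2 T v) :
    energy T (fun t => u t + v t) ≤ 2 * energy T u + 2 * energy T v := by
  have h1 := hu.intervalIntegrable_dotProduct hT hu
  have h2 := hv.intervalIntegrable_dotProduct hT hv
  rw [energy, energy, energy, ← intervalIntegral.integral_const_mul,
    ← intervalIntegral.integral_const_mul, ← intervalIntegral.integral_add (h1.const_mul _)
    (h2.const_mul _)]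
  refine intervalIntegral.integral_mono_on hT
    ((hu.add hv).intervalIntegrable_dotProduct hT (hu.add hv))
    ((h1.const_mul _).add (h2.const_mul _)) fun t _ => ?_
  have := dotProduct_self_nonneg' (u t - v t)
  simp only [sub_dotProduct, dotProduct_sub, add_dotProduct, dotProduct_add] at this ⊢
  linarith

end Trajectory

/-! ### Primitives of integrable functions and the product rule -/

/-- `F` is on `[0,T]` a primitive of the integrable function `f`. -/
def IsPrimitive (T : ℝ) (F f : ℝ → ℝ) : Prop :=
  IntervalIntegrable f volume 0 T ∧ ∀ t ∈ Icc 0 T, F t = F 0 + ∫ s in (0 : ℝ)..t, f s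

namespace IsPrimitive

variable {T : ℝ} {F f G g : ℝ → ℝ}

theorem integral_eq (hT : 0 ≤ T) (h : IsPrimitive T F f) :
    ∫ s in (0 : ℝ)..T, f s = F T - F 0 := by
  rw [h.2 T ⟨hT, le_rfl⟩]; ring

theorem congr (hT : 0 ≤ T) (h : IsPrimitive T F f) (hfg : ∀ t ∈ Icc 0 T, f t = g t) :
    IsPrimitive T F g := by
  refine ⟨h.1.congr fun t ht => hfg t ?_, fun t ht => ?_⟩
  · rw [uIoc_of_le hT] at ht; exact ⟨ht.1.le, ht.2⟩
  · rw [h.2 t ht]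
    congr 1
    refine intervalIntegral.integral_congr fun s hs => hfg s ?_
    rw [uIcc_of_le ht.1] at hs
    exact ⟨hs.1, hs.2.trans ht.2⟩

theorem absolutelyContinuousOnInterval (hT : 0 ≤ T) (h : IsPrimitive T F f) :
    AbsolutelyContinuousOnInterval F 0 T := by
  have h1 := h.1.absolutelyContinuousOnInterval_intervalIntegral (c := 0) left_mem_uIcc
  rw [absolutelyContinuousOnInterval_iff] at h1 ⊢
  intro ε hε
  obtain ⟨δ, hδ, H⟩ := h1 ε hε
  refine ⟨δ, hδ, fun E hE hEδ => lt_of_eq_of_lt ?_ (H E hE hEδ)⟩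
  refine Finset.sum_congr rfl fun i hi => ?_
  have h2 := hE.1 i hi
  rw [uIcc_of_le hT] at h2
  rw [h.2 _ h2.1, h.2 _ h2.2, dist_add_left]

theorem ae_hasDerivAt (hT : 0 ≤ T) (h : IsPrimitive T F f) :
    ∀ᵐ t, t ∈ Ioo 0 T → HasDerivAt F (f t) t := by
  filter_upwards [h.1.ae_hasDerivAt_integral] with t ht htT
  have h1 := ht (by rw [uIcc_of_le hT]; exact Ioo_subset_Icc_self htT) 0 left_mem_uIcc
  refine (h1.const_add (F 0)).congr_of_eventuallyEq ?_
  filter_upwards [Ioo_mem_nhds htT.1 htT.2] with s hs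
  exact h.2 s (Ioo_subset_Icc_self hs)

theorem of_absolutelyContinuous (hT : 0 ≤ T) (hF : AbsolutelyContinuousOnInterval F 0 T)
    (hf : ∀ᵐ t, t ∈ Ioo 0 T → HasDerivAt F (f t) t) : IsPrimitive T F f := by
  have hae : ∀ᵐ t, t ∈ Ioc 0 T → deriv F t = f t := by
    have : ∀ᵐ t : ℝ, t ≠ T := by simp [ae_iff, measure_singleton]
    filter_upwards [hf, this] with t ht htT h
    exact (ht ⟨h.1, lt_of_le_of_ne h.2 htT⟩).deriv
  refine ⟨hF.intervalIntegrable_deriv.congr_ae ?_, fun t ht => ?_⟩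
  · rw [uIoc_of_le hT, EventuallyEq, ae_restrict_iff' measurableSet_Ioc]
    exact hae
  · have h1 := (hF.mono (c := 0) (d := t) (by
      rw [uIcc_of_le hT, uIcc_of_le ht.1]; exact Icc_subset_Icc_right ht.2)).integral_deriv_eq_sub
    rw [← sub_eq_iff_eq_add', ← h1]
    refine intervalIntegral.integral_congr_ae ?_
    filter_upwards [hae] with s hs hs'
    rw [uIoc_of_le ht.1] at hs'
    exact hs ⟨hs'.1, hs'.2.trans ht.2⟩

/-- A product of absolutely continuous functions is absolutely continuous, hence the integral of its
almost everywhere derivative. This is how `xᵀ P x` is differentiated although the input is only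
square integrable. -/
theorem mul (hT : 0 ≤ T) (hF : IsPrimitive T F f) (hG : IsPrimitive T G g) :
    IsPrimitive T (fun t => F t * G t) (fun t => f t * G t + F t * g t) := by
  refine of_absolutelyContinuous hT ((hF.absolutelyContinuousOnInterval hT).fun_mul
    (hG.absolutelyContinuousOnInterval hT)) ?_
  filter_upwards [hF.ae_hasDerivAt hT, hG.ae_hasDerivAt hT] with t h1 h2 ht
  exact (h1 ht).mul (h2 ht)

theorem add (hF : IsPrimitive T F f) (hG : IsPrimitive T G g) :
    IsPrimitive T (fun t => F t + G t) (fun t => f t + g t) := by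
  refine ⟨hF.1.add hG.1, fun t ht => ?_⟩
  have hsub : uIcc 0 t ⊆ uIcc 0 T := by
    rw [uIcc_of_le ht.1, uIcc_of_le (ht.1.trans ht.2)]; exact Icc_subset_Icc_right ht.2
  rw [intervalIntegral.integral_add (hF.1.mono_set hsub) (hG.1.mono_set hsub)]
  simp only [hF.2 t ht, hG.2 t ht]
  ring

theorem sum {ι : Type*} {s : Finset ι} {F f : ι → ℝ → ℝ} (h : ∀ i ∈ s, IsPrimitive T (F i) (f i)) :
    IsPrimitive T (fun t => ∑ i ∈ s, F i t) (fun t => ∑ i ∈ s, f i t) := by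
  classical
  induction s using Finset.induction_on with
  | empty => simp [IsPrimitive]
  | insert a s ha ih =>
    simp only [Finset.sum_insert ha]
    exact (h a (Finset.mem_insert_self _ _)).add
      (ih fun i hi => h i (Finset.mem_insert_of_mem hi))

/-- Right derivatives suffice, so solutions of Riccati equations with jumping coefficients are
covered. -/
theorem of_hasDerivWithinAt (hF : ContinuousOn F (Icc 0 T))
    (hf : ∀ t ∈ Ioo 0 T, HasDerivWithinAt F (f t) (Ioi t) t)
    (hint : IntervalIntegrable f volume 0 T) : IsPrimitive T F f := by
  refine ⟨hint, fun t ht => ?_⟩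
  have hT := ht.1.trans ht.2
  rw [intervalIntegral.integral_eq_sub_of_hasDeriv_right_of_le ht.1
    (hF.mono (Icc_subset_Icc_right ht.2)) (fun s hs => hf s ⟨hs.1, hs.2.trans_le ht.2⟩)
    (hint.mono_set (by rw [uIcc_of_le ht.1, uIcc_of_le hT]; exact Icc_subset_Icc_right ht.2))]
  ring

end IsPrimitive

theorem isPrimitive_dotProduct_mulVec {n : Type*} [Fintype n] {T : ℝ} (hT : 0 ≤ T)
    {x f : ℝ → n → ℝ} {P P' : ℝ → Matrix n n ℝ} (hx : ∀ i, IsPrimitive T (x · i) (f · i))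
    (hP : ∀ i j, IsPrimitive T (P · i j) (P' · i j)) :
    IsPrimitive T (fun t => x t ⬝ᵥ (P t *ᵥ x t))
      (fun t => f t ⬝ᵥ (P t *ᵥ x t) + x t ⬝ᵥ (P' t *ᵥ x t) + x t ⬝ᵥ (P t *ᵥ f t)) := by
  have h := IsPrimitive.sum (s := Finset.univ) fun (i : n) _ =>
    (hx i).mul hT (IsPrimitive.sum (s := Finset.univ) fun (j : n) _ => (hP i j).mul hT (hx j))
  refine h.congr hT fun t _ => ?_
  simp only [dotProduct, Matrix.mulVec, ← Finset.sum_add_distrib]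
  refine Finset.sum_congr rfl fun i _ => ?_
  rw [add_assoc, ← mul_add, ← Finset.sum_add_distrib]

theorem IsTrajectory.isPrimitive {n m : Type*} [Fintype n] [Fintype m] {A : ℝ → Matrix n n ℝ}
    {B : ℝ → Matrix n m ℝ} {T : ℝ} (hT : 0 ≤ T) (hA : PiecewiseContinuous T A)
    (hB : PiecewiseContinuous T B) {u : ℝ → m → ℝ} {x : ℝ → n → ℝ} (hu : IsL2 T u)
    (hx : IsTrajectory A B T u x) (i : n) :
    IsPrimitive T (x · i) (fun t => (A t *ᵥ x t + B t *ᵥ u t) i) := by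
  have hL : IsL2 T fun t => A t *ᵥ x t + B t *ᵥ u t := (hx.isL2.mulVec hA).add (hu.mulVec hB)
  have hint := hL.intervalIntegrable hT
  refine ⟨(intervalIntegrable_iff_integrableOn_Icc_of_le hT).2
    ((hL.eval i).integrable (by norm_num)), fun t ht => ?_⟩
  have hint' := hint.mono_set (show uIcc 0 t ⊆ uIcc 0 T by
    rw [uIcc_of_le ht.1, uIcc_of_le hT]; exact Icc_subset_Icc_right ht.2)
  have h := (ContinuousLinearMap.proj (R := ℝ) (φ := fun _ : n => ℝ) i).intervalIntegral_comp_comm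
    hint'
  simp only [ContinuousLinearMap.proj_apply] at h
  rw [h, ← hx.2 t ht]
  have h0 := hx.2 0 ⟨le_rfl, hT⟩
  rw [intervalIntegral.integral_same] at h0
  simp [h0]

/-! ### The Riccati equation -/

theorem PiecewiseContinuous.mulVec {m n : Type*} [Fintype n] {T : ℝ} {A : ℝ → Matrix m n ℝ}
    {x : ℝ → n → ℝ} (hA : PiecewiseContinuous T A) (hx : PiecewiseContinuous T x) :
    PiecewiseContinuous T (fun t => A t *ᵥ x t) :=
  hA.map₂ hx (continuous_fst.matrix_mulVec continuous_snd)

theorem PiecewiseContinuous.intervalIntegrable {E : Type*} [NormedAddCommGroup E]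
    [SecondCountableTopology E] {T : ℝ} (hT : 0 ≤ T) {f : ℝ → E} (hf : PiecewiseContinuous T f) :
    IntervalIntegrable f volume 0 T := by
  obtain ⟨K, -, hK⟩ := hf.exists_bound
  rw [intervalIntegrable_iff_integrableOn_Icc_of_le hT]
  refine Integrable.of_bound hf.aestronglyMeasurable K ?_
  filter_upwards [ae_restrict_mem measurableSet_Icc] with t ht using hK t ht

/-- Right continuity of the integrand gives the right derivative at every point, break points
included. -/
theorem PiecewiseContinuous.hasDerivWithinAt_integral {E : Type*} [NormedAddCommGroup E]
    [NormedSpace ℝ E] [CompleteSpace E] [SecondCountableTopology E] {T : ℝ} {f : ℝ → E}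
    (hf : PiecewiseContinuous T f) {t : ℝ} (ht : t ∈ Ico 0 T) :
    HasDerivWithinAt (fun r => ∫ s in r..T, f s) (-f t) (Ici t) t := by
  refine intervalIntegral.integral_hasDerivWithinAt_left (t := Ioi t) ?_ ?_ ?_
  · refine (hf.intervalIntegrable (ht.1.trans ht.2.le)).mono_set ?_
    rw [uIcc_of_le ht.2.le, uIcc_of_le (ht.1.trans ht.2.le)]
    exact Icc_subset_Icc_left ht.1
  · refine ⟨Icc 0 T, ?_, hf.aestronglyMeasurable⟩
    filter_upwards [self_mem_nhdsWithin, mem_nhdsWithin_of_mem_nhds (Iio_mem_nhds ht.2)]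
      with r h1 h2
    exact ⟨ht.1.trans (le_of_lt h1), le_of_lt h2⟩
  · exact (hf.2.1 t ht).mono Ioi_subset_Ici_self

/-- Linear differential equations with a terminal condition. -/
theorem exists_terminal_solution {k : Type*} [Fintype k] {T : ℝ} (hT : 0 < T)
    {H : ℝ → Matrix k k ℝ} (hH : PiecewiseContinuous T H) (zT : k → ℝ) :
    ∃ z : ℝ → k → ℝ, ContinuousOn z (Icc 0 T) ∧ z T = zT ∧
      ∀ t ∈ Ico 0 T, HasDerivWithinAt z (H t *ᵥ z t) (Ici t) t := by
  obtain ⟨K, hK0, hK⟩ := hH.exists_bound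
  have hrefl : ∀ t ∈ Icc 0 T, T - t ∈ Icc 0 T := fun t ht =>
    ⟨by linarith [ht.2], by linarith [ht.1]⟩
  -- Time reversal: `y(s) = z(T - s)` turns the terminal condition into an initial one.
  obtain ⟨y, hy, hy'⟩ := exists_integral_solution (F := fun t x => -(H (T - t) *ᵥ x)) hT.le hK0
    (fun t ht x y => by
      rw [neg_sub_neg, ← mulVec_sub, norm_sub_rev]
      exact (linfty_opNorm_mulVec _ _).trans (by gcongr; exact hK _ (hrefl t ht)))
    (fun y hy => by
      have h1 : IntervalIntegrable (fun t => H t *ᵥ y (T - t)) volume 0 T :=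
        ((IsL2.of_continuousOn (u := fun t => y (T - t)) (by fun_prop)).mulVec
          hH).intervalIntegrable hT.le
      have h2 := (h1.comp_sub_left T).neg.symm
      simp only [sub_sub_cancel, sub_self, sub_zero] at h2
      exact h2) zT
  have hzc : ContinuousOn (fun t => y (T - t)) (Icc 0 T) :=
    hy.comp (by fun_prop) hrefl
  have hpc : PiecewiseContinuous T (fun t => H t *ᵥ y (T - t)) :=
    hH.mulVec (.of_continuousOn hT hzc)
  have hz : ∀ t ∈ Icc 0 T, y (T - t) = zT - ∫ s in t..T, H s *ᵥ y (T - s) := by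
    intro t ht
    rw [hy' _ (hrefl t ht), intervalIntegral.integral_neg, ← sub_eq_add_neg]
    have := intervalIntegral.integral_comp_sub_left (a := 0) (b := T - t)
      (fun s => H s *ᵥ y (T - s)) T
    simp only [sub_sub_cancel, sub_zero] at this
    rw [this]
  refine ⟨fun t => y (T - t), hzc, by simpa using hz T ⟨hT.le, le_rfl⟩, fun t ht => ?_⟩
  have h1 := ((hpc.hasDerivWithinAt_integral ht).const_sub zT)
  rw [neg_neg] at h1
  refine h1.congr_of_eventuallyEq ?_ (hz t ⟨ht.1, ht.2.le⟩)
  filter_upwards [self_mem_nhdsWithin, mem_nhdsWithin_of_mem_nhds (Iio_mem_nhds ht.2)]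
      with r h1 h2
  exact hz r ⟨ht.1.trans h1, le_of_lt h2⟩

theorem hasDerivWithinAt_matrix_mul {l m n : Type*} [Fintype m] {s : Set ℝ} {t : ℝ}
    {A : ℝ → Matrix l m ℝ} {B : ℝ → Matrix m n ℝ} {A' : Matrix l m ℝ} {B' : Matrix m n ℝ}
    (hA : ∀ i j, HasDerivWithinAt (A · i j) (A' i j) s t)
    (hB : ∀ i j, HasDerivWithinAt (B · i j) (B' i j) s t) (i : l) (j : n) :
    HasDerivWithinAt (fun r => (A r * B r) i j) ((A' * B t + A t * B') i j) s t := by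
  have := HasDerivWithinAt.fun_sum (u := Finset.univ) fun (k : m) _ => (hA i k).mul (hB k j)
  simp only [Finset.sum_add_distrib] at this
  exact this

/-- At a zero of `d` the slope of `d * e` is the slope of `d` times `e`, so `e` need only be
continuous. It spares differentiating `X⁻¹` in the Riccati argument. -/
theorem hasDerivWithinAt_mul_of_eq_zero {s : Set ℝ} {t d' : ℝ} {d e : ℝ → ℝ}
    (hd : HasDerivWithinAt d d' s t) (hd0 : d t = 0) (he : ContinuousWithinAt e s t) :
    HasDerivWithinAt (fun r => d r * e r) (d' * e t) s t := by
  rw [hasDerivWithinAt_iff_tendsto_slope] at hd ⊢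
  refine (hd.mul (he.mono sdiff_subset)).congr fun r => ?_
  simp [slope_def_field, hd0]
  ring

/-- The quadratic supply rate `[x; u]ᵀ [Q S; Sᵀ R] [x; u]`. -/
def quadCost {n m : Type*} [Fintype n] [Fintype m] (Q : Matrix n n ℝ) (S : Matrix n m ℝ)
    (R : Matrix m m ℝ) (x : n → ℝ) (u : m → ℝ) : ℝ :=
  x ⬝ᵥ (Q *ᵥ x) + 2 * (x ⬝ᵥ (S *ᵥ u)) + u ⬝ᵥ (R *ᵥ u)

/-- The right-hand side of the Riccati equation. -/
def riccatiField {n m : Type*} [Fintype n] [Fintype m] [DecidableEq m] (A : Matrix n n ℝ)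
    (B : Matrix n m ℝ) (Q : Matrix n n ℝ) (S : Matrix n m ℝ) (R : Matrix m m ℝ)
    (Y : Matrix n n ℝ) : Matrix n n ℝ :=
  -(Aᵀ * Y + Y * A + Q - (Y * B + S) * R⁻¹ * (Y * B + S)ᵀ)

/-- Describes a motion that rests at `f t₀` until `t₀` and then follows `f`; with right derivatives
the junction needs no compatibility. -/
theorem hasDerivWithinAt_comp_max {E : Type*} [NormedAddCommGroup E] [NormedSpace ℝ E]
    {f f' : ℝ → E} {t₀ T : ℝ} (hf : ∀ t ∈ Ico t₀ T, HasDerivWithinAt f (f' t) (Ici t) t) {t : ℝ}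
    (ht : t < T) :
    HasDerivWithinAt (fun s => f (max s t₀)) (if t < t₀ then 0 else f' t) (Ici t) t := by
  split_ifs with h
  · refine (hasDerivWithinAt_const t (Ici t) (f t₀)).congr_of_eventuallyEq ?_
      (by rw [max_eq_right h.le])
    filter_upwards [mem_nhdsWithin_of_mem_nhds (Iio_mem_nhds h)] with s hs
    rw [max_eq_right (le_of_lt hs)]
  · rw [not_lt] at h
    refine (hf t ⟨h, ht⟩).congr (fun s hs => ?_) (by rw [max_eq_left h])
    rw [max_eq_left (h.trans hs)]

section Hamiltonian

variable {n m : Type*} [Fintype n] [Fintype m] [DecidableEq n] [DecidableEq m] {T : ℝ}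
  {A Q : ℝ → Matrix n n ℝ} {B S : ℝ → Matrix n m ℝ} {R : ℝ → Matrix m m ℝ} {F : Matrix n n ℝ}

/-- Solutions `(X, Λ)` of the Hamiltonian system, together with the optimal input `U`. -/
theorem exists_hamiltonian_solution (hT : 0 < T) (hA : PiecewiseContinuous T A)
    (hB : PiecewiseContinuous T B) (hQ : PiecewiseContinuous T Q) (hS : PiecewiseContinuous T S)
    (hRi : PiecewiseContinuous T (fun t => (R t)⁻¹)) (F : Matrix n n ℝ) :
    ∃ (X Λ : ℝ → Matrix n n ℝ), ContinuousOn X (Icc 0 T) ∧ ContinuousOn Λ (Icc 0 T) ∧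
      X T = 1 ∧ Λ T = F ∧ ∀ t ∈ Ico 0 T,
      (∀ i j, HasDerivWithinAt (X · i j)
        ((A t * X t - B t * ((R t)⁻¹ * ((S t)ᵀ * X t + (B t)ᵀ * Λ t))) i j) (Ici t) t) ∧
      (∀ i j, HasDerivWithinAt (Λ · i j)
        ((-(Q t * X t - S t * ((R t)⁻¹ * ((S t)ᵀ * X t + (B t)ᵀ * Λ t)) + (A t)ᵀ * Λ t)) i j)
        (Ici t) t) := by
  -- The Hamiltonian matrix, from substituting the stationary input `-R⁻¹ (Sᵀ X + Bᵀ Λ)` into the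
  -- state and costate equations. Its solutions are built one column at a time.
  have hH : PiecewiseContinuous T fun t => fromBlocks
      (A t - B t * (R t)⁻¹ * (S t)ᵀ) (-(B t * (R t)⁻¹ * (B t)ᵀ))
      (S t * (R t)⁻¹ * (S t)ᵀ - Q t) (S t * (R t)⁻¹ * (B t)ᵀ - (A t)ᵀ) := by
    have h1 := hA.sub ((hB.matrix_mul hRi).matrix_mul hS.transpose)
    have h2 := ((hB.matrix_mul hRi).matrix_mul hB.transpose).neg
    have h3 := ((hS.matrix_mul hRi).matrix_mul hS.transpose).sub hQ
    have h4 := ((hS.matrix_mul hRi).matrix_mul hB.transpose).sub hA.transpose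
    exact ((h1.prodMk h2).prodMk (h3.prodMk h4)).map
      (φ := fun p => fromBlocks p.1.1 p.1.2 p.2.1 p.2.2)
      ((continuous_fst.comp continuous_fst).matrix_fromBlocks
        (continuous_snd.comp continuous_fst) (continuous_fst.comp continuous_snd)
        (continuous_snd.comp continuous_snd))
  choose z hzc hzT hz using fun j : n => exists_terminal_solution hT hH
    (Sum.elim ((1 : Matrix n n ℝ).col j) (F.col j))
  refine ⟨fun t => .of fun i j => z j t (Sum.inl i), fun t => .of fun i j => z j t (Sum.inr i),
    ?_, ?_, ?_, ?_, fun t ht => ⟨fun i j => ?_, fun i j => ?_⟩⟩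
  · exact continuousOn_pi.2 fun i => continuousOn_pi.2 fun j =>
      continuousOn_pi.1 (hzc j) _
  · exact continuousOn_pi.2 fun i => continuousOn_pi.2 fun j =>
      continuousOn_pi.1 (hzc j) _
  · ext i j; simp [hzT]
  · ext i j; simp [hzT]
  · have := hasDerivWithinAt_pi.1 (hz j t ht) (Sum.inl i)
    convert! this using 1
    rw [fromBlocks_mulVec, Sum.elim_inl]
    have e : ∀ X Λ : Matrix n n ℝ, A t * X - B t * ((R t)⁻¹ * ((S t)ᵀ * X + (B t)ᵀ * Λ))
        = (A t - B t * (R t)⁻¹ * (S t)ᵀ) * X + (-(B t * (R t)⁻¹ * (B t)ᵀ)) * Λ := fun X Λ => by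
      simp only [Matrix.sub_mul, Matrix.mul_add, Matrix.neg_mul, Matrix.mul_assoc]; abel
    rw [e]; rfl
  · have := hasDerivWithinAt_pi.1 (hz j t ht) (Sum.inr i)
    convert! this using 1
    rw [fromBlocks_mulVec, Sum.elim_inr]
    have e : ∀ X Λ : Matrix n n ℝ,
        -(Q t * X - S t * ((R t)⁻¹ * ((S t)ᵀ * X + (B t)ᵀ * Λ)) + (A t)ᵀ * Λ)
        = (S t * (R t)⁻¹ * (S t)ᵀ - Q t) * X + (S t * (R t)⁻¹ * (B t)ᵀ - (A t)ᵀ) * Λ :=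
      fun X Λ => by
      simp only [Matrix.sub_mul, Matrix.mul_add, Matrix.mul_assoc]; abel
    rw [e]; rfl

end Hamiltonian

theorem IsL2.intervalIntegrable_quadCost {n m : Type*} [Fintype n] [Fintype m] {T : ℝ}
    (hT : 0 ≤ T) {Q : ℝ → Matrix n n ℝ} {S : ℝ → Matrix n m ℝ} {R : ℝ → Matrix m m ℝ}
    (hQ : PiecewiseContinuous T Q) (hS : PiecewiseContinuous T S) (hR : PiecewiseContinuous T R)
    {x : ℝ → n → ℝ} {u : ℝ → m → ℝ} (hx : IsL2 T x) (hu : IsL2 T u) :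
    IntervalIntegrable (fun t => quadCost (Q t) (S t) (R t) (x t) (u t)) volume 0 T :=
  ((hx.intervalIntegrable_dotProduct hT (hx.mulVec hQ)).add
    ((hx.intervalIntegrable_dotProduct hT (hu.mulVec hS)).const_mul 2)).add
    (hu.intervalIntegrable_dotProduct hT (hu.mulVec hR))

theorem hasDerivWithinAt_mulVec {m n : Type*} [Fintype m] [Fintype n] {s : Set ℝ} {t : ℝ}
    {M : ℝ → Matrix m n ℝ} {M' : Matrix m n ℝ}
    (hM : ∀ i j, HasDerivWithinAt (M · i j) (M' i j) s t) (ξ : n → ℝ) :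
    HasDerivWithinAt (fun r => M r *ᵥ ξ) (M' *ᵥ ξ) s t :=
  hasDerivWithinAt_pi.2 fun i =>
    HasDerivWithinAt.fun_sum (u := Finset.univ) fun j _ => (hM i j).mul_const (ξ j)

theorem HasDerivWithinAt.const_dotProduct {n : Type*} [Fintype n] {s : Set ℝ} {t : ℝ}
    {f : ℝ → n → ℝ} {f' : n → ℝ} (hf : HasDerivWithinAt f f' s t) (ξ : n → ℝ) :
    HasDerivWithinAt (fun r => ξ ⬝ᵥ f r) (ξ ⬝ᵥ f') s t :=
  HasDerivWithinAt.fun_sum (u := Finset.univ) fun i _ =>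
    (hasDerivWithinAt_pi.1 hf i).const_mul (ξ i)

theorem dotProduct_transpose_mul_mulVec {l m n : Type*} [Fintype l] [Fintype m] [Fintype n]
    (X : Matrix l m ℝ) (Y : Matrix l n ℝ) (v : m → ℝ) (w : n → ℝ) :
    v ⬝ᵥ ((Xᵀ * Y) *ᵥ w) = (X *ᵥ v) ⬝ᵥ (Y *ᵥ w) := by
  rw [← mulVec_mulVec, dotProduct_mulVec, vecMul_transpose]

/-- If the quadratic cost is only zero for trajectories which end in the origin, then the
Riccati equation is solvable on the whole horizon. -/
theorem exists_riccati_solution {n m : Type*} [Fintype n] [Fintype m] [DecidableEq n]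
    [DecidableEq m] {T : ℝ} {A Q : ℝ → Matrix n n ℝ} {B S : ℝ → Matrix n m ℝ}
    {R : ℝ → Matrix m m ℝ} {F : Matrix n n ℝ} (hT : 0 < T) (hA : PiecewiseContinuous T A)
    (hB : PiecewiseContinuous T B) (hQ : PiecewiseContinuous T Q) (hS : PiecewiseContinuous T S)
    (hR : PiecewiseContinuous T R) (hRi : PiecewiseContinuous T (fun t => (R t)⁻¹))
    (hRu : ∀ t ∈ Icc 0 T, IsUnit (R t).det) (hQs : ∀ t ∈ Icc 0 T, (Q t)ᵀ = Q t)
    (hRs : ∀ t ∈ Icc 0 T, (R t)ᵀ = R t) (hF : Fᵀ = F)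
    (hJ : ∀ u x, IsL2 T u → IsTrajectory A B T u x →
      x T ⬝ᵥ (F *ᵥ x T) + ∫ t in (0 : ℝ)..T, quadCost (Q t) (S t) (R t) (x t) (u t) = 0 →
      x T = 0) :
    ∃ Y : ℝ → Matrix n n ℝ, (∀ t ∈ Icc 0 T, (Y t)ᵀ = Y t) ∧ Y T = F ∧
      ContinuousOn Y (Icc 0 T) ∧ ∀ t ∈ Ico 0 T, ∀ i j, HasDerivWithinAt (Y · i j)
        (riccatiField (A t) (B t) (Q t) (S t) (R t) (Y t) i j) (Ici t) t := by
  obtain ⟨X, Λ, hXc, hΛc, hXT, hΛT, hH⟩ := exists_hamiltonian_solution (R := R) hT hA hB hQ hS hRi F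
  have hTT : T ∈ Icc 0 T := ⟨hT.le, le_rfl⟩
  set U : ℝ → Matrix m n ℝ := fun t => -((R t)⁻¹ * ((S t)ᵀ * X t + (B t)ᵀ * Λ t)) with hU
  have hXp : PiecewiseContinuous T X := .of_continuousOn hT hXc
  have hΛp : PiecewiseContinuous T Λ := .of_continuousOn hT hΛc
  have hUp : PiecewiseContinuous T U :=
    (hRi.matrix_mul ((hS.transpose.matrix_mul hXp).add (hB.transpose.matrix_mul hΛp))).neg
  have hX : ∀ t ∈ Ico 0 T, ∀ i j,
      HasDerivWithinAt (X · i j) ((A t * X t + B t * U t) i j) (Ici t) t := fun t ht i j => by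
    simp only [hU, Matrix.mul_neg, ← sub_eq_add_neg]
    exact (hH t ht).1 i j
  have hΛ : ∀ t ∈ Ico 0 T, ∀ i j, HasDerivWithinAt (Λ · i j)
      ((-(Q t * X t + S t * U t + (A t)ᵀ * Λ t)) i j) (Ici t) t := fun t ht i j => by
    simp only [hU, Matrix.mul_neg, ← sub_eq_add_neg]
    exact (hH t ht).2 i j
  have hRU : ∀ t ∈ Icc 0 T, (B t)ᵀ * Λ t = -(R t * U t) - (S t)ᵀ * X t := fun t ht => by
    simp only [hU, Matrix.mul_neg, neg_neg, mul_nonsing_inv_cancel_left _ _ (hRu t ht)]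
    abel
  -- `ξᵀ E ξ` is the supply rate along the state `X ξ` and input `U ξ`. Hence `ξᵀ Xᵀ Λ ξ`, whose
  -- right derivative is `-ξᵀ E ξ`, acts as a cost-to-go.
  set E : ℝ → Matrix n n ℝ := fun t =>
    (U t)ᵀ * (R t * U t) + (U t)ᵀ * ((S t)ᵀ * X t) + (X t)ᵀ * (Q t * X t) + (X t)ᵀ * (S t * U t)
    with hE
  have hEs : ∀ t ∈ Icc 0 T, (E t)ᵀ = E t := fun t ht => by
    simp only [hE, transpose_add, transpose_mul, transpose_transpose, hQs t ht, hRs t ht,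
      Matrix.mul_assoc]
    abel
  have hG : ∀ t ∈ Ico 0 T, ∀ i j,
      HasDerivWithinAt (fun r => ((X r)ᵀ * Λ r) i j) ((-E t) i j) (Ici t) t := fun t ht i j => by
    have h := hasDerivWithinAt_matrix_mul (A := fun r => (X r)ᵀ)
      (A' := (A t * X t + B t * U t)ᵀ) (fun i j => hX t ht j i) (hΛ t ht) i j
    have h1 : (U t)ᵀ * (B t)ᵀ * Λ t = -((U t)ᵀ * (R t * U t)) - (U t)ᵀ * ((S t)ᵀ * X t) := by
      rw [Matrix.mul_assoc, hRU t ⟨ht.1, ht.2.le⟩, Matrix.mul_sub, Matrix.mul_neg]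
    have h2 : (A t * X t + B t * U t)ᵀ * Λ t + (X t)ᵀ * -(Q t * X t + S t * U t + (A t)ᵀ * Λ t)
        = -E t := by
      simp only [hE, transpose_add, transpose_mul, Matrix.add_mul, h1, Matrix.mul_neg,
        Matrix.mul_add, Matrix.mul_assoc]
      abel
    rw [h2] at h
    exact h
  have hGc : ContinuousOn (fun r => (X r)ᵀ * Λ r) (Icc 0 T) :=
    (continuous_fst.matrix_transpose.matrix_mul continuous_snd).comp_continuousOn
      (hXc.prodMk hΛc)
  have hentry : ∀ i j : n, Continuous fun M : Matrix n n ℝ => M i j := fun i j =>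
    continuous_id.matrix_elem i j
  -- `E` is symmetric, so the antisymmetric part of `Xᵀ Λ` is constant; at `T` it vanishes since `Xᵀ
  -- Λ = F` there.
  have hGs : ∀ t ∈ Icc 0 T, ((X t)ᵀ * Λ t)ᵀ = (X t)ᵀ * Λ t := by
    have key : ∀ i j : n, ∀ t ∈ Icc 0 T, ((X t)ᵀ * Λ t) i j - ((X t)ᵀ * Λ t) j i
        = ((X 0)ᵀ * Λ 0) i j - ((X 0)ᵀ * Λ 0) j i := fun i j => by
      refine constant_of_has_deriv_right_zero
        (((hentry i j).comp_continuousOn hGc).sub ((hentry j i).comp_continuousOn hGc))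
        fun t ht => ?_
      convert! (hG t ht i j).sub (hG t ht j i) using 1
      rw [Matrix.neg_apply, Matrix.neg_apply, ← transpose_apply (E t) i j,
        hEs t ⟨ht.1, ht.2.le⟩, sub_self]
    intro t ht
    ext i j
    rw [transpose_apply]
    have h1 := key i j t ht
    have h2 := key i j T hTT
    simp only [hXT, hΛT, transpose_one, Matrix.one_mul] at h2
    have h3 : F i j = F j i := by rw [← transpose_apply F i j, hF]
    linarith
  have hcost : ∀ t, ∀ ξ : n → ℝ, ξ ⬝ᵥ (E t *ᵥ ξ) =
      quadCost (Q t) (S t) (R t) (X t *ᵥ ξ) (U t *ᵥ ξ) := fun t ξ => by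
    have h1 : ξ ⬝ᵥ (((U t)ᵀ * ((S t)ᵀ * X t)) *ᵥ ξ) = (X t *ᵥ ξ) ⬝ᵥ (S t *ᵥ (U t *ᵥ ξ)) := by
      rw [dotProduct_transpose_mul_mulVec, dotProduct_comm, ← mulVec_mulVec, mulVec_transpose,
        ← dotProduct_mulVec]
    simp only [hE, quadCost, add_mulVec, dotProduct_add, h1, dotProduct_transpose_mul_mulVec,
      mulVec_mulVec]
    ring
  -- If `X(t₀) ξ = 0` with `ξ ≠ 0`, rest at the origin until `t₀` and then follow `X ξ` with input
  -- `U ξ`. This admissible trajectory ends at `ξ`. Its running cost is `g t₀ - g T = -ξᵀ F ξ`, so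
  -- its total cost is zero, and `hJ` forces `ξ = 0`.
  have hdet : ∀ t ∈ Icc 0 T, IsUnit (X t).det := by
    intro t₀ ht₀
    rw [isUnit_iff_ne_zero]
    intro hd
    obtain ⟨ξ, hξ, hXξ⟩ := exists_mulVec_eq_zero_iff.2 hd
    set u : ℝ → m → ℝ := fun s => if s < t₀ then 0 else U s *ᵥ ξ with hu
    set x : ℝ → n → ℝ := fun s => X (max s t₀) *ᵥ ξ with hx
    have hmaps : MapsTo (fun s => max s t₀) (Icc 0 T) (Icc 0 T) := fun s hs =>
      ⟨hs.1.trans (le_max_left _ _), max_le hs.2 ht₀.2⟩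
    have hxc : ContinuousOn x (Icc 0 T) := by
      have h1 : ContinuousOn (fun s => X s *ᵥ ξ) (Icc 0 T) :=
        (continuous_id.matrix_mulVec continuous_const).comp_continuousOn hXc
      exact h1.comp (by fun_prop) hmaps
    have huL : IsL2 T u := by
      have h1 : IsL2 T fun s => U s *ᵥ ξ :=
        (IsL2.of_continuousOn (u := fun _ => ξ) continuousOn_const).mulVec hUp
      refine (MemLp.indicator (measurableSet_Ici (a := t₀)) h1).ae_eq (Eventually.of_forall ?_)
      intro s
      by_cases hs : s < t₀
      · simp [hu, hs]
      · simp [hu, hs, not_lt.1 hs]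
    have hx0 : ∀ s < t₀, x s = 0 := fun s hs => by simp [hx, max_eq_right hs.le, hXξ]
    have hx1 : ∀ s, ¬ s < t₀ → x s = X s *ᵥ ξ := fun s hs => by
      simp [hx, max_eq_left (not_lt.1 hs)]
    have hxT : x T = ξ := by rw [hx1 T (not_lt.2 ht₀.2), hXT, one_mulVec]
    have hx00 : x 0 = 0 := by simp [hx, max_eq_right ht₀.1, hXξ]
    have hxL : IsL2 T x := IsL2.of_continuousOn hxc
    have hder : ∀ s ∈ Ico 0 T, HasDerivWithinAt x (A s *ᵥ x s + B s *ᵥ u s) (Ici s) s := by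
      intro s hs
      have h := hasDerivWithinAt_comp_max (f := fun s => X s *ᵥ ξ)
        (f' := fun s => (A s * X s + B s * U s) *ᵥ ξ) (t₀ := t₀) (T := T)
        (fun r hr => hasDerivWithinAt_mulVec (hX r ⟨ht₀.1.trans hr.1, hr.2⟩) ξ) hs.2
      convert! h using 1
      by_cases hs' : s < t₀
      · simp [hs', hx0 s hs', hu]
      · simp [hs', hx1 s hs', hu, add_mulVec, mulVec_mulVec]
    have htraj : IsTrajectory A B T u x := by
      refine ⟨hxc, fun t ht => ?_⟩
      have hint : IntervalIntegrable (fun s => A s *ᵥ x s + B s *ᵥ u s) volume 0 T :=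
        ((hxL.mulVec hA).add (huL.mulVec hB)).intervalIntegrable hT.le
      rw [intervalIntegral.integral_eq_sub_of_hasDeriv_right_of_le ht.1
        (hxc.mono (Icc_subset_Icc_right ht.2))
        (fun s hs => (hder s ⟨hs.1.le, hs.2.trans_le ht.2⟩).mono Ioi_subset_Ici_self)
        (hint.mono_set (by
          rw [uIcc_of_le ht.1, uIcc_of_le hT.le]; exact Icc_subset_Icc_right ht.2)), hx00, sub_zero]
    set g : ℝ → ℝ := fun s => ξ ⬝ᵥ (((X s)ᵀ * Λ s) *ᵥ ξ) with hg
    have hgc : ContinuousOn (fun s => g (max s t₀)) (Icc 0 T) := by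
      have h1 : ContinuousOn g (Icc 0 T) :=
        (continuous_const.dotProduct
          (continuous_id.matrix_mulVec continuous_const)).comp_continuousOn hGc
      exact h1.comp (by fun_prop) hmaps
    have hgd : ∀ s ∈ Ico 0 T, HasDerivWithinAt (fun s => g (max s t₀))
        (-quadCost (Q s) (S s) (R s) (x s) (u s)) (Ici s) s := by
      intro s hs
      have h := hasDerivWithinAt_comp_max (f := g)
        (f' := fun s => ξ ⬝ᵥ ((-E s) *ᵥ ξ)) (t₀ := t₀) (T := T)
        (fun r hr => HasDerivWithinAt.const_dotProduct
          (hasDerivWithinAt_mulVec (hG r ⟨ht₀.1.trans hr.1, hr.2⟩) ξ) ξ) hs.2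
      convert! h using 1
      by_cases hs' : s < t₀
      · simp [hs', hx0 s hs', hu, quadCost]
      · simp only [hs', hx1 s hs', hu, if_false, neg_mulVec, dotProduct_neg, hcost]
    have hcint := hxL.intervalIntegrable_quadCost hT.le hQ hS hR huL
    have hI := intervalIntegral.integral_eq_sub_of_hasDeriv_right_of_le hT.le hgc
      (fun s hs => (hgd s ⟨hs.1.le, hs.2⟩).mono Ioi_subset_Ici_self) hcint.neg
    rw [intervalIntegral.integral_neg, max_eq_left ht₀.2, max_eq_right ht₀.1] at hI
    have hg0 : g t₀ = 0 := by
      simp only [hg, dotProduct_transpose_mul_mulVec, hXξ, zero_dotProduct]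
    have hgT : g T = ξ ⬝ᵥ (F *ᵥ ξ) := by simp [hg, hXT, hΛT]
    refine hξ ?_
    rw [← hxT]
    refine hJ u x huL htraj ?_
    rw [hxT]
    linarith
  have hcanc : ∀ t ∈ Icc 0 T, X t * (X t)⁻¹ = 1 := fun t ht => mul_nonsing_inv _ (hdet t ht)
  have hXic : ContinuousOn (fun t => (X t)⁻¹) (Icc 0 T) := fun t ht =>
    (continuousAt_matrix_inv (X t) (by
      rw [Ring.inverse_eq_inv']
      exact continuousAt_inv₀ (hdet t ht).ne_zero)).comp_continuousWithinAt (hXc t ht)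
  have hYs : ∀ t ∈ Icc 0 T, (Λ t * (X t)⁻¹)ᵀ = Λ t * (X t)⁻¹ := fun t ht => by
    have h1 := hGs t ht
    rw [transpose_mul, transpose_transpose] at h1
    have h2 : (X t)ᵀ⁻¹ * (X t)ᵀ = 1 := nonsing_inv_mul _ (by rw [det_transpose]; exact hdet t ht)
    calc (Λ t * (X t)⁻¹)ᵀ = (X t)ᵀ⁻¹ * (Λ t)ᵀ * (X t * (X t)⁻¹) := by
          rw [hcanc t ht, Matrix.mul_one, transpose_mul, transpose_nonsing_inv]
      _ = (X t)ᵀ⁻¹ * ((Λ t)ᵀ * X t) * (X t)⁻¹ := by simp only [Matrix.mul_assoc]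
      _ = ((X t)ᵀ⁻¹ * (X t)ᵀ) * (Λ t * (X t)⁻¹) := by rw [h1]; simp only [Matrix.mul_assoc]
      _ = _ := by rw [h2, Matrix.one_mul]
  refine ⟨fun t => Λ t * (X t)⁻¹, hYs, by simp [hXT, hΛT],
    (continuous_fst.matrix_mul continuous_snd).comp_continuousOn (hΛc.prodMk hXic), ?_⟩
  intro t ht i j
  have ht' : t ∈ Icc 0 T := ⟨ht.1, ht.2.le⟩
  set Y := Λ t * (X t)⁻¹ with hY
  have hYX : Y * X t = Λ t := by
    rw [hY, Matrix.mul_assoc, nonsing_inv_mul _ (hdet t ht'), Matrix.mul_one]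
  -- With `Y` frozen at its value at `t`, one has `Λ X⁻¹ = Y + (Λ - Y X) X⁻¹` nearby, and `Λ - Y X`
  -- vanishes at `t`. The derivative of `Λ X⁻¹` is thus `D' X⁻¹`.
  set D' : Matrix n n ℝ := -(Q t * X t + S t * U t + (A t)ᵀ * Λ t) - Y * (A t * X t + B t * U t)
    with hD'
  have hD : ∀ i j, HasDerivWithinAt (fun r => (Λ r - Y * X r) i j) (D' i j) (Ici t) t := by
    intro i j
    have h1 := hasDerivWithinAt_matrix_mul (A := fun _ => Y) (A' := 0)
      (fun i j => hasDerivWithinAt_const t (Ici t) (Y i j)) (hX t ht) i j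
    rw [Matrix.zero_mul, zero_add] at h1
    exact (hΛ t ht i j).sub h1
  have hterm : ∀ k, HasDerivWithinAt (fun r => (Λ r - Y * X r) i k * (X r)⁻¹ k j)
      (D' i k * (X t)⁻¹ k j) (Ici t) t := fun k => by
    refine hasDerivWithinAt_mul_of_eq_zero (hD i k) (by simp [hYX]) ?_
    refine ((hentry k j).comp_continuousOn hXic t ht').mono_of_mem_nhdsWithin ?_
    filter_upwards [self_mem_nhdsWithin, mem_nhdsWithin_of_mem_nhds (Iio_mem_nhds ht.2)]
      with r h1 h2
    exact ⟨ht.1.trans h1, le_of_lt h2⟩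
  have hsum := (HasDerivWithinAt.fun_sum (u := Finset.univ) fun k _ => hterm k).const_add (Y i j)
  have hval : riccatiField (A t) (B t) (Q t) (S t) (R t) Y = D' * (X t)⁻¹ := by
    have hc := hcanc t ht'
    have hAX : A t * X t * (X t)⁻¹ = A t := by rw [Matrix.mul_assoc, hc, Matrix.mul_one]
    have hQX : Q t * X t * (X t)⁻¹ = Q t := by rw [Matrix.mul_assoc, hc, Matrix.mul_one]
    have hK : U t * (X t)⁻¹ = -((R t)⁻¹ * (Y * B t + S t)ᵀ) := by
      have h3 : (Y * B t + S t)ᵀ = (B t)ᵀ * Y + (S t)ᵀ := by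
        rw [transpose_add, transpose_mul, hYs t ht']
      have h4 : (S t)ᵀ * X t * (X t)⁻¹ = (S t)ᵀ := by rw [Matrix.mul_assoc, hc, Matrix.mul_one]
      rw [h3, hU]
      simp only [Matrix.neg_mul, Matrix.mul_assoc, Matrix.add_mul, hc, Matrix.mul_one, hY]
      rw [add_comm]
    rw [hD', riccatiField]
    simp only [Matrix.sub_mul, Matrix.neg_mul, Matrix.add_mul, Matrix.mul_add, hQX]
    simp only [Matrix.mul_assoc, hK, hc, Matrix.mul_one, ← hY]
    simp only [Matrix.mul_neg]
    abel
  rw [hval]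
  refine hsum.congr_of_eventuallyEq ?_ ?_
  · filter_upwards [self_mem_nhdsWithin, mem_nhdsWithin_of_mem_nhds (Iio_mem_nhds ht.2)]
      with r h1 h2
    have hr : r ∈ Icc 0 T := ⟨ht.1.trans h1, le_of_lt h2⟩
    have : Λ r * (X r)⁻¹ = Y + (Λ r - Y * X r) * (X r)⁻¹ := by
      rw [Matrix.sub_mul, Matrix.mul_assoc, hcanc r hr, Matrix.mul_one]; abel
    rw [this]; rfl
  · simp [hYX]; rfl

/-! ### Dissipation inequalities -/

theorem PiecewiseContinuous.exists_abs_dotProduct_mulVec_le {m n : Type*} [Fintype m] [Fintype n]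
    {T : ℝ} {M : ℝ → Matrix m n ℝ} (hM : PiecewiseContinuous T M) :
    ∃ K : ℝ, 0 ≤ K ∧ ∀ t ∈ Icc 0 T, ∀ v w, |v ⬝ᵥ (M t *ᵥ w)| ≤ K * (‖v‖ * ‖w‖) := by
  obtain ⟨K, hK0, hK⟩ := hM.exists_bound
  refine ⟨Fintype.card m * K, by positivity, fun t ht v w => ?_⟩
  calc |v ⬝ᵥ (M t *ᵥ w)| ≤ Fintype.card m * (‖v‖ * ‖M t *ᵥ w‖) := abs_dotProduct_le _ _
    _ ≤ Fintype.card m * (‖v‖ * (K * ‖w‖)) := by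
        gcongr
        exact (linfty_opNorm_mulVec _ _).trans (by gcongr; exact hK t ht)
    _ = _ := by ring

theorem dotProduct_mulVec_comm_of_symm {n : Type*} [Fintype n] {P : Matrix n n ℝ} (hP : Pᵀ = P)
    (v w : n → ℝ) : v ⬝ᵥ (P *ᵥ w) = w ⬝ᵥ (P *ᵥ v) := by
  rw [dotProduct_comm, ← vecMul_transpose, hP, ← dotProduct_mulVec]

section

variable {n m : Type*} [Fintype n] [Fintype m] {T : ℝ}
  {A Q : ℝ → Matrix n n ℝ} {B S : ℝ → Matrix n m ℝ} {R : ℝ → Matrix m m ℝ}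

/-- A differentiable symmetric matrix function whose derivative is bounded above is the integral of
its derivative. -/
theorem isPrimitive_of_derivative_le [DecidableEq n] (hT : 0 < T) {P P' : ℝ → Matrix n n ℝ}
    (hPs : ∀ t ∈ Icc 0 T, (P t)ᵀ = P t)
    (hPd : ∀ t ∈ Icc 0 T, ∀ i j, HasDerivWithinAt (P · i j) (P' t i j) (Icc 0 T) t)
    (hle : ∀ v : n → ℝ, ∃ K : ℝ, ∀ t ∈ Icc 0 T, v ⬝ᵥ (P' t *ᵥ v) ≤ K) (i j : n) :
    IsPrimitive T (P · i j) (P' · i j) := by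
  have hnhds : ∀ t ∈ Ioo 0 T, Icc 0 T ∈ 𝓝 t := fun t ht => Icc_mem_nhds ht.1 ht.2
  -- A derivative existing everywhere need not be integrable, but a nonnegative one is. Here `K t -
  -- vᵀ P v` has a nonnegative derivative.
  have hq : ∀ v : n → ℝ, IntervalIntegrable (fun t => v ⬝ᵥ (P' t *ᵥ v)) volume 0 T := by
    intro v
    obtain ⟨K, hK⟩ := hle v
    have hd : ∀ t ∈ Icc 0 T, HasDerivWithinAt (fun t => K * t - v ⬝ᵥ (P t *ᵥ v))
        (K * 1 - v ⬝ᵥ (P' t *ᵥ v)) (Icc 0 T) t := fun t ht =>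
      ((hasDerivWithinAt_id t _).const_mul K).sub
        (HasDerivWithinAt.const_dotProduct (hasDerivWithinAt_mulVec (hPd t ht) v) v)
    have h1 : IntervalIntegrable (fun t => K * 1 - v ⬝ᵥ (P' t *ᵥ v)) volume 0 T := by
      refine intervalIntegral.intervalIntegrable_deriv_of_nonneg
        (g := fun t => K * t - v ⬝ᵥ (P t *ᵥ v)) ?_ ?_ ?_
      · rw [uIcc_of_le hT.le]
        exact fun t ht => (hd t ht).continuousWithinAt
      · rw [min_eq_left hT.le, max_eq_right hT.le]
        exact fun t ht => (hd t (Ioo_subset_Icc_self ht)).hasDerivAt (hnhds t ht)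
      · rw [min_eq_left hT.le, max_eq_right hT.le]
        intro t ht
        have := hK t (Ioo_subset_Icc_self ht)
        linarith
    have h2 := (intervalIntegrable_const (c := K) (μ := volume) (a := 0) (b := T)).sub h1
    exact h2.congr fun t _ => by simp
  refine IsPrimitive.of_hasDerivWithinAt (fun t ht => (hPd t ht i j).continuousWithinAt)
    (fun t ht => ((hPd t (Ioo_subset_Icc_self ht) i j).hasDerivAt
      (hnhds t ht)).hasDerivWithinAt) ?_
  have hP's : ∀ t ∈ Icc 0 T, P' t i j = P' t j i := fun t ht =>
    ((uniqueDiffOn_Icc hT) t ht).eq_deriv _ (hPd t ht i j)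
      ((hPd t ht j i).congr (fun s hs => by rw [← transpose_apply (P s), hPs s hs])
        (by rw [← transpose_apply (P t), hPs t ht]))
  -- Polarization recovers the entry `(i, j)` from the quadratic forms, using symmetry of `P'`.
  have h := (((hq (Pi.single i 1 + Pi.single j 1)).sub (hq (Pi.single i 1))).sub
    (hq (Pi.single j 1))).const_mul (1 / 2)
  refine h.congr fun t ht => ?_
  rw [uIoc_of_le hT.le] at ht
  have := hP's t ⟨ht.1.le, ht.2⟩
  simp [mulVec_add, add_dotProduct, dotProduct_add, this]
  ring

/-- The differential dissipation inequality implies the integrated one. -/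
theorem cost_le_of_dissipation [DecidableEq n] (hT : 0 < T) (hA : PiecewiseContinuous T A)
    (hB : PiecewiseContinuous T B) (hQ : PiecewiseContinuous T Q) (hS : PiecewiseContinuous T S)
    (hR : PiecewiseContinuous T R) {P P' : ℝ → Matrix n n ℝ} (hPs : ∀ t ∈ Icc 0 T, (P t)ᵀ = P t)
    (hPd : ∀ t ∈ Icc 0 T, ∀ i j, HasDerivWithinAt (P · i j) (P' t i j) (Icc 0 T) t) {ε : ℝ}
    (hε : 0 ≤ ε)
    (h : ∀ t ∈ Icc 0 T, ∀ x u, x ⬝ᵥ (P' t *ᵥ x) + 2 * (x ⬝ᵥ (P t *ᵥ (A t *ᵥ x + B t *ᵥ u)))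
      + quadCost (Q t) (S t) (R t) x u ≤ -ε * (x ⬝ᵥ x + u ⬝ᵥ u))
    {u : ℝ → m → ℝ} {x : ℝ → n → ℝ} (hu : IsL2 T u) (hx : IsTrajectory A B T u x) :
    x T ⬝ᵥ (P T *ᵥ x T) + ∫ t in (0 : ℝ)..T, quadCost (Q t) (S t) (R t) (x t) (u t)
      ≤ -ε * energy T u := by
  have hPc : ContinuousOn P (Icc 0 T) := continuousOn_pi.2 fun i => continuousOn_pi.2 fun j =>
    fun t ht => (hPd t ht i j).continuousWithinAt
  -- The dissipation inequality with zero input bounds `vᵀ P' v` above by a piecewise continuous,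
  -- hence bounded, function.
  have hP : ∀ i j, IsPrimitive T (P · i j) (P' · i j) := by
    refine isPrimitive_of_derivative_le hT hPs hPd fun v => ?_
    have hv : PiecewiseContinuous T fun t =>
        -ε * (v ⬝ᵥ v) - 2 * (v ⬝ᵥ ((P t * A t) *ᵥ v)) - v ⬝ᵥ (Q t *ᵥ v) := by
      have h1 : Continuous fun M : Matrix n n ℝ => v ⬝ᵥ (M *ᵥ v) :=
        continuous_const.dotProduct (continuous_id.matrix_mulVec continuous_const)
      have hPp : PiecewiseContinuous T P := .of_continuousOn hT hPc
      exact ((PiecewiseContinuous.const _).sub (((hPp.matrix_mul hA).map h1).map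
        (continuous_const_mul 2))).sub (hQ.map h1)
    obtain ⟨K, -, hK⟩ := hv.exists_bound
    refine ⟨K, fun t ht => le_trans ?_ ((le_abs_self _).trans (hK t ht))⟩
    have := h t ht v 0
    simp only [quadCost, mulVec_zero, add_zero, dotProduct_zero, mul_zero, mulVec_mulVec] at this
    linarith
  have hV := isPrimitive_dotProduct_mulVec hT.le (hx.isPrimitive hT.le hA hB hu) hP
  have hint := hV.integral_eq hT.le
  have hx0 : x 0 = 0 := by rw [hx.2 0 ⟨le_rfl, hT.le⟩, intervalIntegral.integral_same]
  rw [hx0, zero_dotProduct, sub_zero] at hint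
  have hcint := hx.isL2.intervalIntegrable_quadCost hT.le hQ hS hR hu
  rw [← hint, ← intervalIntegral.integral_add hV.1 hcint, energy,
    ← intervalIntegral.integral_const_mul]
  refine intervalIntegral.integral_mono_on hT.le (hV.1.add hcint)
    ((hu.intervalIntegrable_dotProduct hT.le hu).const_mul _) fun t ht => ?_
  have h1 := h t ht (x t) (u t)
  have h2 := dotProduct_mulVec_comm_of_symm (hPs t ht) (A t *ᵥ x t + B t *ᵥ u t) (x t)
  have h3 := mul_nonneg hε (dotProduct_self_nonneg' (x t))
  rw [h2]
  linarith

theorem integral_indicator_Ioc {t h : ℝ} (ht : 0 ≤ t) (hh : 0 ≤ h) (hth : t + h ≤ T) :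
    ∫ s in (0 : ℝ)..T, (Ioc t (t + h)).indicator (fun _ => (1 : ℝ)) s = h := by
  rw [intervalIntegral.integral_of_le (by linarith), setIntegral_indicator measurableSet_Ioc,
    inter_eq_self_of_subset_right (Ioc_subset_Ioc ht hth)]
  simp [hh]

/-- If the cost is uniformly negative, then so is the feedthrough part of the supply rate. -/
theorem feedthrough_le_of_cost_le (hT : 0 < T) (hA : PiecewiseContinuous T A)
    (hB : PiecewiseContinuous T B) (hQ : PiecewiseContinuous T Q) (hS : PiecewiseContinuous T S)
    (hR : PiecewiseContinuous T R) {F : Matrix n n ℝ} {ε : ℝ}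
    (hJ : ∀ u x, IsL2 T u → IsTrajectory A B T u x →
      x T ⬝ᵥ (F *ᵥ x T) + ∫ t in (0 : ℝ)..T, quadCost (Q t) (S t) (R t) (x t) (u t)
        ≤ -ε * energy T u) :
    ∀ t ∈ Icc 0 T, ∀ v, v ⬝ᵥ (R t *ᵥ v) ≤ -ε * (v ⬝ᵥ v) := by
  have hcont : ∀ v : m → ℝ, Continuous fun M : Matrix m m ℝ => v ⬝ᵥ (M *ᵥ v) := fun v =>
    continuous_const.dotProduct (continuous_id.matrix_mulVec continuous_const)
  -- Suppose the bound fails at `t` in the direction `v`. By right continuity it fails by at least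
  -- `κ` just after `t`. A pulse `v` on `(t, t + h]` gains at least `κ h` from the input term, while
  -- the state is `O(h)` and all terms containing it are at most `C h²`. Small `h` gives a
  -- contradiction.
  have key : ∀ t ∈ Ico 0 T, ∀ v, v ⬝ᵥ (R t *ᵥ v) ≤ -ε * (v ⬝ᵥ v) := by
    intro t ht v
    by_contra! hlt
    obtain ⟨c, hc0, hc⟩ := IsTrajectory.exists_norm_le hT.le hA hB
    obtain ⟨KQ, hKQ0, hKQ⟩ := hQ.exists_abs_dotProduct_mulVec_le
    obtain ⟨KS, hKS0, hKS⟩ := hS.exists_abs_dotProduct_mulVec_le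
    obtain ⟨KF, hKF0, hKF⟩ :=
      (PiecewiseContinuous.const (T := T) F).exists_abs_dotProduct_mulVec_le
    set κ := (v ⬝ᵥ (R t *ᵥ v) + ε * (v ⬝ᵥ v)) / 2 with hκ
    have hκ0 : 0 < κ := by rw [hκ]; linarith
    have hnear : ∀ᶠ s in 𝓝[≥] t, κ ≤ v ⬝ᵥ (R s *ᵥ v) + ε * (v ⬝ᵥ v) := by
      have h1 : Tendsto (fun s => v ⬝ᵥ (R s *ᵥ v) + ε * (v ⬝ᵥ v)) (𝓝[≥] t) (𝓝 (2 * κ)) := by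
        have h2 := ((hcont v).continuousAt.comp_continuousWithinAt (hR.2.1 t ht)).add_const
          (ε * (v ⬝ᵥ v))
        convert! h2.tendsto using 2
        rw [hκ]; simp only [Function.comp]; ring
      exact (h1.eventually_const_lt (by linarith)).mono fun s hs => hs.le
    obtain ⟨b, hb, hbs⟩ := (mem_nhdsGE_iff_exists_Icc_subset).1 hnear
    -- The state is bounded by `c ‖v‖ h` on all of `[0,T]`, also after the pulse, hence the factor
    -- `T` in the `Q` term. The cross term lives on the pulse only and gets its second `h` from its
    -- length.
    set C : ℝ := KF * (c * ‖v‖) ^ 2 + T * (KQ * (c * ‖v‖) ^ 2) + 2 * (KS * (c * ‖v‖ * ‖v‖)) with hC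
    have hC0 : 0 ≤ C := by positivity
    have hsmall : ∀ h, 0 < h → h ≤ b - t → h ≤ T - t → κ ≤ C * h := by
      intro h hh hhb hhT
      set ι : ℝ → ℝ := (Ioc t (t + h)).indicator fun _ => 1 with hι
      have hιint : ∫ s in (0 : ℝ)..T, ι s = h := integral_indicator_Ioc ht.1 hh.le (by linarith)
      have hι01 : ∀ s, 0 ≤ ι s := fun s => indicator_nonneg (fun _ _ => zero_le_one) s
      have hιsq : ∀ s, ι s * ι s = ι s := fun s => by
        by_cases hs : s ∈ Ioc t (t + h) <;> simp [hι, hs]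
      have huL : IsL2 T fun s => ι s • v := by
        refine (MemLp.indicator (measurableSet_Ioc (a := t) (b := t + h))
          (IsL2.of_continuousOn (u := fun _ => v) (T := T) continuousOn_const)).ae_eq
          (Eventually.of_forall fun s => ?_)
        by_cases hs : s ∈ Ioc t (t + h) <;> simp [hι, hs]
      have hιi : IntervalIntegrable ι volume 0 T := by
        rw [intervalIntegrable_iff_integrableOn_Icc_of_le hT.le]
        exact (integrable_const (1 : ℝ)).indicator measurableSet_Ioc
      obtain ⟨x, hx⟩ := exists_trajectory hT.le hA hB huL
      have hxle : ∀ s ∈ Icc 0 T, ‖x s‖ ≤ c * ‖v‖ * h := by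
        intro s hs
        have h1 := hc _ x huL hx s hs
        simp only [norm_smul, Real.norm_eq_abs, abs_of_nonneg (hι01 _)] at h1
        rw [intervalIntegral.integral_mul_const, hιint] at h1
        linarith
      have h1 := hJ _ x huL hx
      have hcint := hx.isL2.intervalIntegrable_quadCost hT.le hQ hS hR huL
      have heint := (huL.intervalIntegrable_dotProduct hT.le huL).const_mul ε
      have h2 : ∫ s in (0 : ℝ)..T, (-(KQ * (c * ‖v‖ * h) ^ 2)
          + (κ - 2 * (KS * (c * ‖v‖ * h * ‖v‖))) * ι s) ≤
          ∫ s in (0 : ℝ)..T, (quadCost (Q s) (S s) (R s) (x s) (ι s • v)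
            + ε * ((ι s • v) ⬝ᵥ (ι s • v))) := by
        refine intervalIntegral.integral_mono_on hT.le
          (intervalIntegrable_const.add (hιi.const_mul _)) (hcint.add heint) fun s hs => ?_
        have hxs := hxle s hs
        have e1 : -(KQ * (c * ‖v‖ * h) ^ 2) ≤ x s ⬝ᵥ (Q s *ᵥ x s) := by
          have := neg_le_of_abs_le (hKQ s hs (x s) (x s))
          refine le_trans (neg_le_neg ?_) this
          rw [← sq]
          gcongr
        have e2 : -(KS * (c * ‖v‖ * h * ‖v‖)) ≤ x s ⬝ᵥ (S s *ᵥ v) := by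
          have := neg_le_of_abs_le (hKS s hs (x s) v)
          refine le_trans (neg_le_neg ?_) this
          gcongr
        have e3 : κ * ι s ≤ (v ⬝ᵥ (R s *ᵥ v) + ε * (v ⬝ᵥ v)) * ι s := by
          by_cases hsm : s ∈ Ioc t (t + h)
          · have : κ ≤ v ⬝ᵥ (R s *ᵥ v) + ε * (v ⬝ᵥ v) :=
              hbs ⟨hsm.1.le, hsm.2.trans (by linarith)⟩
            exact mul_le_mul_of_nonneg_right this (hι01 s)
          · simp [hι, hsm]
        have e4 := mul_le_mul_of_nonneg_right e2 (hι01 s)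
        simp only [quadCost, mulVec_smul, dotProduct_smul, smul_dotProduct, smul_eq_mul]
        have e5 : ι s * (ι s * (v ⬝ᵥ (R s *ᵥ v))) = ι s * (v ⬝ᵥ (R s *ᵥ v)) := by
          rw [← mul_assoc, hιsq]
        have e6 : ι s * (ι s * (v ⬝ᵥ v)) = ι s * (v ⬝ᵥ v) := by rw [← mul_assoc, hιsq]
        rw [e5, e6]
        nlinarith
      rw [intervalIntegral.integral_add hcint heint, intervalIntegral.integral_const_mul,
        intervalIntegral.integral_add intervalIntegrable_const (hιi.const_mul _),
        intervalIntegral.integral_const_mul, hιint, intervalIntegral.integral_const, sub_zero,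
        smul_eq_mul] at h2
      have h3 : -(KF * (c * ‖v‖ * h) ^ 2) ≤ x T ⬝ᵥ (F *ᵥ x T) := by
        have hTT : T ∈ Icc 0 T := ⟨hT.le, le_rfl⟩
        have := neg_le_of_abs_le (hKF T hTT (x T) (x T))
        refine le_trans (neg_le_neg ?_) this
        rw [← sq]
        gcongr
        exact hxle T hTT
      have h4 : energy T (fun s => ι s • v) = ∫ s in (0 : ℝ)..T, (ι s • v) ⬝ᵥ (ι s • v) := rfl
      rw [h4] at h1
      have h5 : κ * h ≤ C * h * h := by
        rw [hC]
        nlinarith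
      exact le_of_mul_le_mul_right h5 hh
    have hb' : 0 < b - t := sub_pos.2 hb
    have hT' : 0 < T - t := sub_pos.2 ht.2
    set h := min (min (b - t) (T - t)) (κ / (2 * (C + 1))) with hh
    have hpos : 0 < h := by positivity
    have h1 := hsmall h hpos ((min_le_left _ _).trans (min_le_left _ _))
      ((min_le_left _ _).trans (min_le_right _ _))
    have h2 : h ≤ κ / (2 * (C + 1)) := min_le_right _ _
    rw [le_div_iff₀ (by positivity)] at h2
    nlinarith
  intro t ht v
  -- No pulse fits after `T`; the end point follows by left continuity.
  rcases ht.2.eq_or_lt with rfl | hlt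
  · have h1 := ((hcont v).continuousAt.comp_continuousWithinAt hR.2.2.2).mono Iio_subset_Iic_self
    refine le_of_tendsto h1 ?_
    filter_upwards [self_mem_nhdsWithin, mem_nhdsWithin_of_mem_nhds (Ioi_mem_nhds hT)] with s h2 h3
    exact key s ⟨le_of_lt h3, h2⟩ v
  · exact key t ⟨ht.1, hlt⟩ v

end

/-! ### The strict bounded real lemma -/

theorem abs_dotProduct_mulVec_le_of_entry {m n : Type*} [Fintype m] [Fintype n]
    {M : Matrix m n ℝ} {κ : ℝ} (hκ : 0 ≤ κ) (hM : ∀ i j, |M i j| ≤ κ) (v : m → ℝ) (w : n → ℝ) :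
    |v ⬝ᵥ (M *ᵥ w)| ≤ κ * (Fintype.card m * Fintype.card n * (‖v‖ * ‖w‖)) := by
  have h : ‖M *ᵥ w‖ ≤ Fintype.card n * (κ * ‖w‖) := by
    refine (pi_norm_le_iff_of_nonneg (by positivity)).2 fun i => ?_
    rw [Real.norm_eq_abs]
    refine (Finset.abs_sum_le_sum_abs _ _).trans ?_
    refine (Finset.sum_le_card_nsmul _ _ (κ * ‖w‖) fun j _ => ?_).trans ?_
    · rw [abs_mul]
      exact mul_le_mul (hM i j) (norm_le_pi_norm w j) (abs_nonneg _) hκ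
    · rw [nsmul_eq_mul, Finset.card_univ]
  calc |v ⬝ᵥ (M *ᵥ w)| ≤ Fintype.card m * (‖v‖ * ‖M *ᵥ w‖) := abs_dotProduct_le _ _
    _ ≤ Fintype.card m * (‖v‖ * (Fintype.card n * (κ * ‖w‖))) := by gcongr
    _ = _ := by ring

/-- Continuous cutoff functions which vanish on a finite set and are close to one in `L₁[0,T]`. -/
theorem exists_cutoff (s : Finset ℝ) (T : ℝ) {κ : ℝ} (hκ : 0 < κ) :
    ∃ c : ℝ → ℝ, Continuous c ∧ (∀ t, 0 ≤ c t) ∧ (∀ t, c t ≤ 1) ∧ (∀ t ∈ s, c t = 0) ∧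
      ∫ t in (0 : ℝ)..T, (1 - c t) ≤ κ := by
  -- `q` vanishes exactly on `s`, so `1 - (1 + k q)⁻¹` vanishes there and tends to one elsewhere as
  -- `k → ∞`; dominated convergence gives the integral bound.
  set q : ℝ → ℝ := fun t => ∏ a ∈ s, |t - a| with hq
  have hqc : Continuous q := by fun_prop
  have hq0 : ∀ t, 0 ≤ q t := fun t => Finset.prod_nonneg fun _ _ => abs_nonneg _
  have hpos : ∀ (k : ℕ) t, 0 < 1 + k * q t := fun k t => by have := hq0 t; positivity
  have hlim : Tendsto (fun k : ℕ => ∫ t in (0 : ℝ)..T, (1 + k * q t)⁻¹) atTop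
      (𝓝 (∫ _ in (0 : ℝ)..T, (0 : ℝ))) := by
    refine intervalIntegral.tendsto_integral_filter_of_dominated_convergence (fun _ => 1) ?_ ?_
      intervalIntegrable_const ?_
    · refine Eventually.of_forall fun k => Continuous.aestronglyMeasurable ?_
      exact (by fun_prop : Continuous fun t => 1 + k * q t).inv₀ fun t => (hpos k t).ne'
    · refine Eventually.of_forall fun k => Eventually.of_forall fun t _ => ?_
      rw [Real.norm_eq_abs, abs_of_pos (inv_pos.2 (hpos k t))]
      refine inv_le_one_of_one_le₀ ?_
      have := hq0 t
      have : 0 ≤ (k : ℝ) * q t := by positivity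
      linarith
    · have : ∀ᵐ t : ℝ, t ∉ (s : Set ℝ) :=
        measure_eq_zero_iff_ae_notMem.1 (s.finite_toSet.measure_zero volume)
      filter_upwards [this] with t ht _
      have hqt : 0 < q t := Finset.prod_pos fun a ha => abs_pos.2 (sub_ne_zero.2 fun h =>
        ht (by rw [h]; exact ha))
      exact tendsto_inv_atTop_zero.comp
        (tendsto_atTop_add_const_left _ _ (tendsto_natCast_atTop_atTop.atTop_mul_const hqt))
  rw [intervalIntegral.integral_zero] at hlim
  obtain ⟨k, hk⟩ := (hlim.eventually_lt_const hκ).exists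
  refine ⟨fun t => 1 - (1 + k * q t)⁻¹, ?_, fun t => ?_, fun t => ?_, fun t ht => ?_, ?_⟩
  · exact continuous_const.sub
      ((by fun_prop : Continuous fun t => 1 + k * q t).inv₀ fun t => (hpos k t).ne')
  · have := hq0 t
    have h1 : 0 ≤ (k : ℝ) * q t := by positivity
    have := inv_le_one_of_one_le₀ (by linarith : 1 ≤ 1 + (k : ℝ) * q t)
    linarith
  · have := inv_pos.2 (hpos k t)
    linarith
  · have : q t = 0 := Finset.prod_eq_zero ht (by simp)
    simp [this]
  · simpa using hk.le

/-- A function with a piecewise continuous right derivative `g` is approximated uniformly by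
differentiable functions whose derivative is at most `g`. -/
theorem exists_differentiable_approximation {n : Type*} [Fintype n] [DecidableEq n] {T : ℝ}
    (hT : 0 < T) {Y g : ℝ → Matrix n n ℝ} (hYc : ContinuousOn Y (Icc 0 T))
    (hYs : ∀ t ∈ Icc 0 T, (Y t)ᵀ = Y t) (hg : PiecewiseContinuous T g)
    (hgs : ∀ t ∈ Icc 0 T, (g t)ᵀ = g t)
    (hYd : ∀ t ∈ Ico 0 T, ∀ i j, HasDerivWithinAt (Y · i j) (g t i j) (Ici t) t) {κ : ℝ}
    (hκ : 0 < κ) :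
    ∃ P P' : ℝ → Matrix n n ℝ, (∀ t ∈ Icc 0 T, (P t)ᵀ = P t) ∧
      (∀ t ∈ Icc 0 T, ∀ i j, HasDerivWithinAt (P · i j) (P' t i j) (Icc 0 T) t) ∧
      P T = Y T ∧ (∀ t ∈ Icc 0 T, ∀ v, v ⬝ᵥ (P' t *ᵥ v) ≤ v ⬝ᵥ (g t *ᵥ v)) ∧
      ∀ t ∈ Icc 0 T, ∀ i j, |P t i j - Y t i j| ≤ κ := by
  obtain ⟨K, hK0, hK⟩ := hg.exists_abs_dotProduct_mulVec_le
  have hgK : ∀ t ∈ Icc 0 T, ∀ i j, |g t i j| ≤ K := fun t ht i j => by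
    simpa [Pi.norm_single] using hK t ht (Pi.single i 1) (Pi.single j 1)
  obtain ⟨s, hs⟩ := hg.1
  -- The entries of `g - G` below are at most `2 K (1 - c)`, so this tolerance makes the total
  -- deviation at most `κ`; the `+ 1` avoids division by zero.
  obtain ⟨c, hcc, hc0, hc1, hcs, hcI⟩ :=
    exists_cutoff s T (show 0 < κ / (2 * K + 1) by positivity)
  -- `G` interpolates between `g` and `-K I`, which lies below `g`; so `G ≤ g` as quadratic forms.
  -- It is continuous because `c` vanishes at the break points and `g` is bounded.
  set G : ℝ → Matrix n n ℝ := fun t => c t • g t - ((1 - c t) * K) • 1 with hG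
  have hentry : ∀ i j : n, Continuous fun M : Matrix n n ℝ => M i j := fun i j =>
    continuous_id.matrix_elem i j
  have hGc : ∀ i j, ContinuousOn (fun t => G t i j) (Icc 0 T) := by
    intro i j t ht
    simp only [hG, Matrix.sub_apply, Matrix.smul_apply, smul_eq_mul]
    refine ContinuousWithinAt.sub ?_ (Continuous.continuousWithinAt (by fun_prop))
    by_cases hts : t ∈ s
    · rw [ContinuousWithinAt, hcs t hts, zero_mul]
      have h1 : Tendsto (fun r => c r * K) (𝓝[Icc 0 T] t) (𝓝 0) := by
        have := (hcc.continuousWithinAt (s := Icc 0 T) (x := t)).mul_const K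
        rwa [ContinuousWithinAt, hcs t hts, zero_mul] at this
      refine squeeze_zero_norm' ?_ h1
      filter_upwards [self_mem_nhdsWithin] with r hr
      rw [norm_mul, Real.norm_eq_abs, Real.norm_eq_abs, abs_of_nonneg (hc0 r)]
      exact mul_le_mul_of_nonneg_left (hgK r hr i j) (hc0 r)
    · exact hcc.continuousWithinAt.mul
        ((hentry i j).continuousAt.comp_continuousWithinAt (hs t ht hts))
  -- Extension by the end values makes the integrand continuous on the whole line, so its integral
  -- is differentiable at every point.
  set G' : ℝ → Matrix n n ℝ := fun t => G (projIcc 0 T hT.le t) with hG'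
  have hG'c : ∀ i j, Continuous fun t => G' t i j := fun i j =>
    (hGc i j).comp_continuous (continuous_subtype_val.comp continuous_projIcc)
      fun t => Subtype.coe_prop _
  have hG'G : ∀ t ∈ Icc 0 T, G' t = G t := fun t ht => by simp [hG', projIcc_of_mem hT.le ht]
  have hGs : ∀ t ∈ Icc 0 T, (G t)ᵀ = G t := fun t ht => by
    simp [hG, hgs t ht]
  refine ⟨fun t => .of fun i j => Y T i j - ∫ r in t..T, G' r i j, G', fun t ht => ?_,
    fun t ht i j => ?_, ?_, fun t ht v => ?_, fun t ht i j => ?_⟩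
  · ext i j
    simp only [transpose_apply, of_apply]
    rw [← transpose_apply (Y T), hYs T ⟨hT.le, le_rfl⟩]
    congr 1
    refine intervalIntegral.integral_congr fun r _ => ?_
    change G (projIcc 0 T hT.le r) j i = G (projIcc 0 T hT.le r) i j
    rw [← transpose_apply (G _), hGs _ (Subtype.coe_prop _)]
  · have h1 := (intervalIntegral.integral_hasDerivAt_left
      ((hG'c i j).intervalIntegrable (μ := volume) t T)
      ((hG'c i j).stronglyMeasurableAtFilter _ _) (hG'c i j).continuousAt).const_sub (Y T i j)
    rw [neg_neg] at h1
    exact h1.hasDerivWithinAt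
  · ext i j; simp
  · rw [hG'G t ht]
    simp only [hG, sub_mulVec, smul_mulVec, dotProduct_sub, dotProduct_smul, one_mulVec,
      smul_eq_mul]
    have h1 := neg_le_of_abs_le (hK t ht v v)
    have h2 := norm_sq_le_dotProduct v
    have h3 : 0 ≤ K * (v ⬝ᵥ v) + v ⬝ᵥ (g t *ᵥ v) := by nlinarith
    have h4 := mul_nonneg (sub_nonneg.2 (hc1 t)) h3
    linarith
  · have hsub : uIcc t T ⊆ uIcc 0 T := by
      rw [uIcc_of_le ht.2, uIcc_of_le hT.le]; exact Icc_subset_Icc_left ht.1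
    have hgi : IntervalIntegrable (fun r => g r i j) volume 0 T :=
      (hg.map (hentry i j)).intervalIntegrable hT.le
    have hFTC : ∫ r in t..T, g r i j = Y T i j - Y t i j := by
      refine intervalIntegral.integral_eq_sub_of_hasDeriv_right_of_le ht.2
        (((hentry i j).comp_continuousOn hYc).mono (Icc_subset_Icc_left ht.1)) (fun r hr => ?_)
        (hgi.mono_set hsub)
      exact (hYd r ⟨ht.1.trans hr.1.le, hr.2⟩ i j).mono Ioi_subset_Ici_self
    have h1 : (Y T i j - ∫ r in t..T, G' r i j) - Y t i j = ∫ r in t..T, (g r i j - G' r i j) := by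
      rw [intervalIntegral.integral_sub (hgi.mono_set hsub) ((hG'c i j).intervalIntegrable _ _),
        hFTC]
      ring
    have hci : IntervalIntegrable (fun r => (2 * K) * (1 - c r)) volume 0 T :=
      Continuous.intervalIntegrable (by fun_prop) _ _
    change |(Y T i j - ∫ r in t..T, G' r i j) - Y t i j| ≤ κ
    rw [h1, ← Real.norm_eq_abs]
    calc ‖∫ r in t..T, (g r i j - G' r i j)‖ ≤ ∫ r in t..T, (2 * K) * (1 - c r) := by
          refine intervalIntegral.norm_integral_le_of_norm_le ht.2 ?_ (hci.mono_set hsub)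
          refine Eventually.of_forall fun r hr => ?_
          have hr' : r ∈ Icc 0 T := ⟨ht.1.trans hr.1.le, hr.2⟩
          rw [hG'G r hr']
          have e : g r i j - G r i j = (1 - c r) * (g r i j + K * (1 : Matrix n n ℝ) i j) := by
            simp only [hG, Matrix.sub_apply, Matrix.smul_apply, smul_eq_mul]
            ring
          rw [e, norm_mul, Real.norm_eq_abs, Real.norm_eq_abs, abs_of_nonneg (sub_nonneg.2 (hc1 r)),
            mul_comm (2 * K)]
          refine mul_le_mul_of_nonneg_left ?_ (sub_nonneg.2 (hc1 r))
          refine (abs_add_le _ _).trans ?_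
          have h2 : |K * (1 : Matrix n n ℝ) i j| ≤ K := by
            rw [Matrix.one_apply]; split_ifs <;> simp [abs_of_nonneg hK0, hK0]
          linarith [hgK r hr' i j]
      _ ≤ ∫ r in (0 : ℝ)..T, (2 * K) * (1 - c r) := by
          refine intervalIntegral.integral_mono_interval ht.1 ht.2 le_rfl ?_ hci
          refine Eventually.of_forall fun r => ?_
          have := sub_nonneg.2 (hc1 r)
          simp only [Pi.zero_apply]
          positivity
      _ = (2 * K) * ∫ r in (0 : ℝ)..T, (1 - c r) := intervalIntegral.integral_const_mul _ _
      _ ≤ (2 * K) * (κ / (2 * K + 1)) := by gcongr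
      _ ≤ κ := by
          rw [mul_div_assoc', div_le_iff₀ (by positivity)]
          nlinarith

/-- The perturbation by which a Riccati equality becomes a strict inequality for the original
weights. -/
theorem quadCost_add_smul_one {n m : Type*} [Fintype n] [Fintype m] [DecidableEq n]
    [DecidableEq m] (Q : Matrix n n ℝ) (S : Matrix n m ℝ) (R : Matrix m m ℝ) (η : ℝ)
    (x : n → ℝ) (u : m → ℝ) :
    quadCost (Q + η • 1) S (R + η • 1) x u = quadCost Q S R x u + η * (x ⬝ᵥ x + u ⬝ᵥ u) := by
  simp only [quadCost, add_mulVec, smul_mulVec, one_mulVec, dotProduct_add, dotProduct_smul,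
    smul_eq_mul]
  ring

/-- Completion of squares for the Riccati equation. -/
theorem riccatiField_add_quadCost {n m : Type*} [Fintype n] [Fintype m] [DecidableEq m]
    {A Q Y : Matrix n n ℝ} {B S : Matrix n m ℝ} {R : Matrix m m ℝ} (hR : IsUnit R.det)
    (hRs : Rᵀ = R) (hY : Yᵀ = Y) (x : n → ℝ) (u : m → ℝ) :
    x ⬝ᵥ (riccatiField A B Q S R Y *ᵥ x) + 2 * (x ⬝ᵥ (Y *ᵥ (A *ᵥ x + B *ᵥ u)))
        + quadCost Q S R x u
      = (u + R⁻¹ *ᵥ ((Y * B + S)ᵀ *ᵥ x)) ⬝ᵥ (R *ᵥ (u + R⁻¹ *ᵥ ((Y * B + S)ᵀ *ᵥ x))) := by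
  set r := (Y * B + S)ᵀ *ᵥ x with hr
  set k := R⁻¹ *ᵥ r with hk
  have hRk : R *ᵥ k = r := by rw [hk, mulVec_mulVec, mul_nonsing_inv _ hR, one_mulVec]
  have h1 : x ⬝ᵥ (((Y * B + S) * R⁻¹ * (Y * B + S)ᵀ) *ᵥ x) = r ⬝ᵥ k := by
    rw [← mulVec_mulVec, ← mulVec_mulVec, ← hr, ← hk, dotProduct_mulVec, hr, mulVec_transpose]
  have h2 : r ⬝ᵥ u = x ⬝ᵥ (Y *ᵥ (B *ᵥ u)) + x ⬝ᵥ (S *ᵥ u) := by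
    rw [hr, mulVec_transpose, ← dotProduct_mulVec, add_mulVec, dotProduct_add, mulVec_mulVec]
  have h3 : x ⬝ᵥ ((Aᵀ * Y) *ᵥ x) = x ⬝ᵥ (Y *ᵥ (A *ᵥ x)) := by
    rw [dotProduct_transpose_mul_mulVec, dotProduct_mulVec_comm_of_symm hY]
  have h4 : k ⬝ᵥ (R *ᵥ u) = r ⬝ᵥ u := by
    rw [dotProduct_mulVec_comm_of_symm hRs, hRk, dotProduct_comm]
  have h5 : x ⬝ᵥ ((Y * A) *ᵥ x) = x ⬝ᵥ (Y *ᵥ (A *ᵥ x)) := by rw [mulVec_mulVec]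
  simp only [riccatiField, quadCost, neg_mulVec, sub_mulVec, add_mulVec, dotProduct_neg,
    dotProduct_sub, dotProduct_add, h1, h3, h5, mulVec_add, add_dotProduct, hRk, h4,
    dotProduct_comm u r, dotProduct_comm k r]
  rw [h2]
  ring

/-- If the cost is uniformly negative then the strict differential dissipation inequality has a
differentiable solution with the prescribed terminal value. -/
theorem exists_dissipation_of_cost_le {n m : Type*} [Fintype n] [Fintype m] [DecidableEq n]
    [DecidableEq m] {T : ℝ} {A Q : ℝ → Matrix n n ℝ} {B S : ℝ → Matrix n m ℝ}
    {R : ℝ → Matrix m m ℝ} {F : Matrix n n ℝ} (hT : 0 < T) (hA : PiecewiseContinuous T A)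
    (hB : PiecewiseContinuous T B) (hQ : PiecewiseContinuous T Q) (hS : PiecewiseContinuous T S)
    (hR : PiecewiseContinuous T R) (hQs : ∀ t ∈ Icc 0 T, (Q t)ᵀ = Q t)
    (hRs : ∀ t ∈ Icc 0 T, (R t)ᵀ = R t) (hF : Fᵀ = F) {ε : ℝ} (hε : 0 < ε)
    (hJ : ∀ u x, IsL2 T u → IsTrajectory A B T u x →
      x T ⬝ᵥ (F *ᵥ x T) + ∫ t in (0 : ℝ)..T, quadCost (Q t) (S t) (R t) (x t) (u t)
        ≤ -ε * energy T u) :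
    ∃ ε' > 0, ∃ P P' : ℝ → Matrix n n ℝ, (∀ t ∈ Icc 0 T, (P t)ᵀ = P t) ∧
      (∀ t ∈ Icc 0 T, ∀ i j, HasDerivWithinAt (P · i j) (P' t i j) (Icc 0 T) t) ∧ P T = F ∧
      ∀ t ∈ Icc 0 T, ∀ x u, x ⬝ᵥ (P' t *ᵥ x) + 2 * (x ⬝ᵥ (P t *ᵥ (A t *ᵥ x + B t *ᵥ u)))
        + quadCost (Q t) (S t) (R t) x u ≤ -ε' * (x ⬝ᵥ x + u ⬝ᵥ u) := by
  have hfeed := feedthrough_le_of_cost_le hT hA hB hQ hS hR hJ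
  obtain ⟨c, hc0, hc⟩ := IsTrajectory.exists_energy_le hT hA hB
  obtain ⟨c', hc'0, hc'⟩ := IsTrajectory.exists_dotProduct_le hT hA hB
  -- Since the state energy is at most `c` times the input energy, the perturbation raises the cost
  -- by at most `η (c + 1) = ε / 2` times the input energy. The perturbed cost stays strictly
  -- negative.
  set η : ℝ := ε / (2 * (c + 1)) with hη
  have hη0 : 0 < η := by positivity
  have hηc : η * (c + 1) = ε / 2 := by rw [hη]; field_simp
  have hηε : η ≤ ε / 2 := by nlinarith
  have hQη : PiecewiseContinuous T fun t => Q t + η • (1 : Matrix n n ℝ) := hQ.add (.const _)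
  have hRη : PiecewiseContinuous T fun t => R t + η • (1 : Matrix m m ℝ) := hR.add (.const _)
  have hcoer : ∀ t ∈ Icc 0 T, ∀ v,
      (ε / 2) * (v ⬝ᵥ v) ≤ v ⬝ᵥ ((-(R t + η • (1 : Matrix m m ℝ))) *ᵥ v) := by
    intro t ht v
    have h1 := hfeed t ht v
    have h2 := mul_le_mul_of_nonneg_right hηε (dotProduct_self_nonneg' v)
    simp only [neg_mulVec, add_mulVec, smul_mulVec, one_mulVec, dotProduct_neg, dotProduct_add,
      dotProduct_smul, smul_eq_mul]
    linarith
  have hunit : ∀ t ∈ Icc 0 T, IsUnit (R t + η • (1 : Matrix m m ℝ)).det := by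
    intro t ht
    have := isUnit_det_of_coercive (by positivity) (hcoer t ht)
    rw [← Matrix.isUnit_iff_isUnit_det] at this ⊢
    simpa using this.neg
  have hRi : PiecewiseContinuous T fun t => (R t + η • (1 : Matrix m m ℝ))⁻¹ := by
    have h1 := (hRη.neg.matrix_inv hT (by positivity) hcoer).neg
    -- True for singular `M` as well, both sides then being the default value zero, so it can be
    -- used for all `t`.
    have h2 : ∀ M : Matrix m m ℝ, -(-M)⁻¹ = M⁻¹ := fun M => by
      by_cases hM : IsUnit M.det
      · refine (inv_eq_left_inv ?_).symm
        have : IsUnit (-M).det := by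
          rw [← Matrix.isUnit_iff_isUnit_det] at hM ⊢
          exact hM.neg
        rw [Matrix.neg_mul, ← Matrix.mul_neg, nonsing_inv_mul _ this]
      · have : ¬ IsUnit (-M).det := fun h => hM (by
          rw [← Matrix.isUnit_iff_isUnit_det] at h ⊢
          simpa using h.neg)
        rw [nonsing_inv_apply_not_isUnit _ hM, nonsing_inv_apply_not_isUnit _ this, neg_zero]
    simpa only [h2] using h1
  have hRηs : ∀ t ∈ Icc 0 T, (R t + η • (1 : Matrix m m ℝ))ᵀ = R t + η • 1 := fun t ht => by
    simp [hRs t ht]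
  have hQηs : ∀ t ∈ Icc 0 T, (Q t + η • (1 : Matrix n n ℝ))ᵀ = Q t + η • 1 := fun t ht => by
    simp [hQs t ht]
  -- A zero perturbed cost leaves no input energy, hence a zero terminal state.
  obtain ⟨Y, hYs, hYT, hYc, hYd⟩ := exists_riccati_solution hT hA hB hQη hS hRη hRi hunit hQηs
    hRηs hF (by
      intro u x hu hx h0
      simp only [quadCost_add_smul_one] at h0
      have hxx := hx.isL2.intervalIntegrable_dotProduct hT.le hx.isL2
      have huu := hu.intervalIntegrable_dotProduct hT.le hu
      rw [intervalIntegral.integral_add (hx.isL2.intervalIntegrable_quadCost hT.le hQ hS hR hu)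
        ((hxx.add huu).const_mul η), intervalIntegral.integral_const_mul,
        intervalIntegral.integral_add hxx huu] at h0
      change _ + (_ + η * (energy T x + energy T u)) = 0 at h0
      have h1 := hJ u x hu hx
      have h2 := hc u x hu hx
      have h3 : energy T u ≤ 0 := by nlinarith [mul_le_mul_of_nonneg_left h2 hη0.le]
      have h4 := hc' u x hu hx T ⟨hT.le, le_rfl⟩
      have h5 : x T ⬝ᵥ x T ≤ 0 := h4.trans (mul_nonpos_of_nonneg_of_nonpos hc'0 h3)
      exact dotProduct_self_eq_zero.1 (le_antisymm h5 (dotProduct_self_nonneg' _)))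
  set g : ℝ → Matrix n n ℝ := fun t =>
    riccatiField (A t) (B t) (Q t + η • 1) (S t) (R t + η • 1) (Y t) with hg
  have hYp : PiecewiseContinuous T Y := .of_continuousOn hT hYc
  have hgp : PiecewiseContinuous T g := by
    have h1 := (hYp.matrix_mul hB).add hS
    exact ((((hA.transpose.matrix_mul hYp).add (hYp.matrix_mul hA)).add hQη).sub
      ((h1.matrix_mul hRi).matrix_mul h1.transpose)).neg
  have hgs : ∀ t ∈ Icc 0 T, (g t)ᵀ = g t := by
    intro t ht
    simp only [hg, riccatiField, transpose_neg, transpose_sub, transpose_add, transpose_mul,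
      transpose_transpose, hYs t ht, hQs t ht, transpose_nonsing_inv, hRs t ht, Matrix.mul_assoc,
      transpose_smul, transpose_one]
    rw [add_comm (Y t * A t)]
  -- For the perturbed weights the left-hand side is a square weighted by `R + η I`, which is
  -- negative; returning to the original weights leaves the slack `η`.
  have hslack : ∀ t ∈ Icc 0 T, ∀ x u, x ⬝ᵥ (g t *ᵥ x)
      + 2 * (x ⬝ᵥ (Y t *ᵥ (A t *ᵥ x + B t *ᵥ u))) + quadCost (Q t) (S t) (R t) x u
      ≤ -η * (x ⬝ᵥ x + u ⬝ᵥ u) := by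
    intro t ht x u
    have h1 := riccatiField_add_quadCost (A := A t) (B := B t) (Q := Q t + η • 1) (S := S t)
      (hunit t ht) (hRηs t ht) (hYs t ht) x u
    rw [quadCost_add_smul_one] at h1
    have h2 := hcoer t ht (u + (R t + η • 1)⁻¹ *ᵥ ((Y t * B t + S t)ᵀ *ᵥ x))
    rw [neg_mulVec, dotProduct_neg] at h2
    have h3 := dotProduct_self_nonneg' (u + (R t + η • 1)⁻¹ *ᵥ ((Y t * B t + S t)ᵀ *ᵥ x))
    have h4 : 0 ≤ ε / 2 * ((u + (R t + η • 1)⁻¹ *ᵥ ((Y t * B t + S t)ᵀ *ᵥ x)) ⬝ᵥ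
      (u + (R t + η • 1)⁻¹ *ᵥ ((Y t * B t + S t)ᵀ *ᵥ x))) := by positivity
    linarith
  obtain ⟨a, ha0, ha⟩ := hA.exists_bound
  obtain ⟨b, hb0, hb⟩ := hB.exists_bound
  -- Replacing `Y` by a `P` with entries within `κ` changes `2 xᵀ P (A x + B u)` by at most `κ C
  -- (|x|² + |u|²)`, and `κ` is chosen so that this uses up at most half of `η`. The change in the
  -- derivative has the favourable sign.
  set C : ℝ := Fintype.card n * Fintype.card n * (2 * (a + b)) with hC
  have hC0 : 0 ≤ C := by positivity
  set κ : ℝ := η / (2 * (C + 1)) with hκ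
  have hκ0 : 0 < κ := by positivity
  have hκC : κ * C ≤ η / 2 := by
    rw [hκ, div_mul_eq_mul_div, div_le_div_iff₀ (by positivity) two_pos]
    nlinarith
  obtain ⟨P, P', hPs, hPd, hPT, hPg, hPY⟩ :=
    exists_differentiable_approximation hT hYc hYs hgp hgs hYd hκ0
  refine ⟨η / 2, by positivity, P, P', hPs, hPd, hPT.trans hYT, fun t ht x u => ?_⟩
  have h1 := hslack t ht x u
  have h2 := hPg t ht x
  set w := A t *ᵥ x + B t *ᵥ u with hw
  have h3 : x ⬝ᵥ (P t *ᵥ w) = x ⬝ᵥ (Y t *ᵥ w) + x ⬝ᵥ ((P t - Y t) *ᵥ w) := by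
    rw [sub_mulVec, dotProduct_sub]; ring
  have h4 := (le_abs_self _).trans
    (abs_dotProduct_mulVec_le_of_entry (M := P t - Y t) hκ0.le (hPY t ht) x w)
  have h5 : ‖w‖ ≤ a * ‖x‖ + b * ‖u‖ := (norm_add_le _ _).trans (add_le_add
    ((linfty_opNorm_mulVec _ _).trans (by gcongr; exact ha t ht))
    ((linfty_opNorm_mulVec _ _).trans (by gcongr; exact hb t ht)))
  have h6 : 2 * (‖x‖ * ‖w‖) ≤ 2 * (a + b) * (x ⬝ᵥ x + u ⬝ᵥ u) := by
    have e1 := norm_sq_le_dotProduct x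
    have e2 := norm_sq_le_dotProduct u
    calc 2 * (‖x‖ * ‖w‖) ≤ 2 * (‖x‖ * (a * ‖x‖ + b * ‖u‖)) := by gcongr
      _ ≤ 2 * (a + b) * (‖x‖ ^ 2 + ‖u‖ ^ 2) := by
          nlinarith [mul_nonneg hb0 (sq_nonneg (‖x‖ - ‖u‖)), mul_nonneg ha0 (sq_nonneg ‖u‖),
            mul_nonneg hb0 (sq_nonneg ‖x‖), mul_nonneg hb0 (sq_nonneg ‖u‖),
            mul_nonneg ha0 (sq_nonneg ‖x‖)]
      _ ≤ _ := by gcongr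
  have h7 : 2 * (x ⬝ᵥ ((P t - Y t) *ᵥ w)) ≤ η / 2 * (x ⬝ᵥ x + u ⬝ᵥ u) := by
    have e0 : 0 ≤ x ⬝ᵥ x + u ⬝ᵥ u :=
      add_nonneg (dotProduct_self_nonneg' x) (dotProduct_self_nonneg' u)
    calc 2 * (x ⬝ᵥ ((P t - Y t) *ᵥ w))
        ≤ κ * (Fintype.card n * Fintype.card n * (2 * (‖x‖ * ‖w‖))) := by linarith
      _ ≤ κ * (Fintype.card n * Fintype.card n * (2 * (a + b) * (x ⬝ᵥ x + u ⬝ᵥ u))) := by gcongr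
      _ = κ * C * (x ⬝ᵥ x + u ⬝ᵥ u) := by rw [hC]; ring
      _ ≤ _ := by gcongr
  linarith

/-! ### Finite horizon factors -/

theorem PiecewiseContinuous.congr {E : Type*} [TopologicalSpace E] {T : ℝ} (hT : 0 < T)
    {f g : ℝ → E} (hf : PiecewiseContinuous T f) (h : ∀ t ∈ Icc 0 T, g t = f t) :
    PiecewiseContinuous T g := by
  obtain ⟨⟨s, hs⟩, hr, hl, hTl⟩ := hf
  refine ⟨⟨s, fun t ht hts => (hs t ht hts).congr h (h t ht)⟩, fun t ht => ?_, fun t ht => ?_, ?_⟩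
  · refine (hr t ht).congr_of_eventuallyEq ?_ (h t ⟨ht.1, ht.2.le⟩)
    filter_upwards [self_mem_nhdsWithin, mem_nhdsWithin_of_mem_nhds (Iio_mem_nhds ht.2)]
      with r h1 h2
    exact h r ⟨ht.1.trans h1, le_of_lt h2⟩
  · obtain ⟨l, hl⟩ := hl t ht
    refine ⟨l, hl.congr' ?_⟩
    filter_upwards [self_mem_nhdsWithin, mem_nhdsWithin_of_mem_nhds (Ioi_mem_nhds ht.1)]
      with r h1 h2
    exact (h r ⟨le_of_lt h2, (le_of_lt h1).trans ht.2⟩).symm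
  · refine hTl.congr_of_eventuallyEq ?_ (h T ⟨hT.le, le_rfl⟩)
    filter_upwards [self_mem_nhdsWithin, mem_nhdsWithin_of_mem_nhds (Ioi_mem_nhds hT)] with r h1 h2
    exact h r ⟨le_of_lt h2, h1⟩

theorem UniformlyPosDef.exists_coercive {n : Type*} [Fintype n] [DecidableEq n] {T : ℝ}
    {M : ℝ → Matrix n n ℝ} (hM : UniformlyPosDef T M) :
    (∀ t ∈ Icc 0 T, (M t)ᵀ = M t) ∧
    ∃ δ > 0, ∀ t ∈ Icc 0 T, ∀ v, δ * (v ⬝ᵥ v) ≤ v ⬝ᵥ (M t *ᵥ v) := by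
  obtain ⟨δ, hδ, h⟩ := hM
  refine ⟨fun t ht => ?_, δ, hδ, fun t ht v => ?_⟩
  · have := (h t ht).1
    rw [IsHermitian, conjTranspose_eq_transpose_of_trivial] at this
    simpa using this
  · have := (posSemidef_iff_dotProduct_mulVec.1 (h t ht)).2 v
    simp only [star_trivial, sub_mulVec, smul_mulVec, one_mulVec, dotProduct_sub, dotProduct_smul,
      smul_eq_mul] at this
    linarith

/-- Lets Riccati data be read as an output energy; it serves the filters, and with `M = 1` also the
output `e_I`. -/
theorem quadCost_output {n m p : Type*} [Fintype n] [Fintype m] [Fintype p] {M : Matrix p p ℝ}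
    (hM : Mᵀ = M) (C : Matrix p n ℝ) (D : Matrix p m ℝ) (x : n → ℝ) (u : m → ℝ) :
    quadCost (Cᵀ * M * C) (Cᵀ * M * D) (Dᵀ * M * D) x u
      = (C *ᵥ x + D *ᵥ u) ⬝ᵥ (M *ᵥ (C *ᵥ x + D *ᵥ u)) := by
  have h : (D *ᵥ u) ⬝ᵥ ((M * C) *ᵥ x) = (C *ᵥ x) ⬝ᵥ ((M * D) *ᵥ u) := by
    rw [← mulVec_mulVec, ← mulVec_mulVec, dotProduct_mulVec_comm_of_symm hM]
  simp only [quadCost, Matrix.mul_assoc, dotProduct_transpose_mul_mulVec, mulVec_add,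
    add_dotProduct, dotProduct_add, mulVec_mulVec, h]
  ring

/-- The two lower bounds multiply. The uniform constant makes the inverse of the input weight
piecewise continuous. -/
theorem exists_feedthrough_coercive {n m p : Type*} [Fintype m] [Fintype p] [DecidableEq m]
    [DecidableEq p] {Ψ : LTV n m p} {M : ℝ → Matrix p p ℝ} {T : ℝ} (hM : UniformlyPosDef T M)
    (hD : UniformlyPosDef T (fun t => (Ψ.D t)ᵀ * Ψ.D t)) :
    ∃ δ > 0, ∀ t ∈ Icc 0 T, ∀ v, δ * (v ⬝ᵥ v) ≤ v ⬝ᵥ (((Ψ.D t)ᵀ * M t * Ψ.D t) *ᵥ v) := by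
  obtain ⟨-, δ₁, hδ₁, h₁⟩ := hM.exists_coercive
  obtain ⟨-, δ₂, hδ₂, h₂⟩ := hD.exists_coercive
  refine ⟨δ₁ * δ₂, by positivity, fun t ht v => ?_⟩
  have h3 := h₁ t ht (Ψ.D t *ᵥ v)
  have h4 := h₂ t ht v
  rw [dotProduct_transpose_mul_mulVec] at h4
  rw [Matrix.mul_assoc, dotProduct_transpose_mul_mulVec, ← mulVec_mulVec]
  nlinarith

section Factor

variable {n m p : Type*} [Fintype n] [Fintype m] [Fintype p] [DecidableEq m]
  [DecidableEq p] {Ψ : LTV n m p} {M : ℝ → Matrix p p ℝ} {T : ℝ}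

/-- Finite horizon factors exist. -/
theorem exists_isFactor [DecidableEq n] (hT : 0 < T) (hΨ : Ψ.Regular T)
    (hMp : PiecewiseContinuous T M)
    (hM : UniformlyPosDef T M) (hD : UniformlyPosDef T (fun t => (Ψ.D t)ᵀ * Ψ.D t)) :
    ∃ U, IsFactor Ψ M T U := by
  obtain ⟨hAp, hBp, hCp, hDp⟩ := hΨ
  obtain ⟨hMs, δ, hδ, hMδ⟩ := hM.exists_coercive
  obtain ⟨δ', hδ', hR⟩ := exists_feedthrough_coercive hM hD
  have hQp := (hCp.transpose.matrix_mul hMp).matrix_mul hCp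
  have hSp := (hCp.transpose.matrix_mul hMp).matrix_mul hDp
  have hRp := (hDp.transpose.matrix_mul hMp).matrix_mul hDp
  have hRi := hRp.matrix_inv hT hδ' hR
  have hRu := fun t ht => isUnit_det_of_coercive hδ' (hR t ht)
  have hRs : ∀ t ∈ Icc 0 T, ((Ψ.D t)ᵀ * M t * Ψ.D t)ᵀ = (Ψ.D t)ᵀ * M t * Ψ.D t := fun t ht => by
    simp [transpose_mul, hMs t ht, Matrix.mul_assoc]
  have hQs : ∀ t ∈ Icc 0 T, ((Ψ.C t)ᵀ * M t * Ψ.C t)ᵀ = (Ψ.C t)ᵀ * M t * Ψ.C t := fun t ht => by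
    simp [transpose_mul, hMs t ht, Matrix.mul_assoc]
  -- With terminal weight zero the cost is `∫ zᵀ M z ≥ δ ‖z‖²`, so zero cost means zero output
  -- energy. The weighted left inverse `(Dᵀ M D)⁻¹ Dᵀ M` of `D` recovers the input from `z` and `x`;
  -- thus `x` is a trajectory of a system driven by `z` alone and vanishes at `T`.
  obtain ⟨X, hXs, hXT, hXc, hXd⟩ := exists_riccati_solution (F := 0) hT hAp hBp hQp hSp hRp hRi hRu
    hQs hRs transpose_zero (by
      intro u x hu hx h0
      set z : ℝ → p → ℝ := fun t => Ψ.C t *ᵥ x t + Ψ.D t *ᵥ u t with hz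
      have hzL : IsL2 T z := (hx.isL2.mulVec hCp).add (hu.mulVec hDp)
      have h1 : ∫ t in (0 : ℝ)..T, z t ⬝ᵥ (M t *ᵥ z t) = 0 := by
        refine Eq.trans ?_ h0
        rw [zero_mulVec, dotProduct_zero, zero_add]
        refine intervalIntegral.integral_congr fun t ht => ?_
        rw [uIcc_of_le hT.le] at ht
        exact (quadCost_output (hMs t ht) _ _ _ _).symm
      have h2 : δ * energy T z ≤ 0 := by
        rw [← h1, energy, ← intervalIntegral.integral_const_mul]
        exact intervalIntegral.integral_mono_on hT.le
          ((hzL.intervalIntegrable_dotProduct hT.le hzL).const_mul δ)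
          (hzL.intervalIntegrable_dotProduct hT.le (hzL.mulVec hMp))
          fun t ht => hMδ t ht (z t)
      have h3 : energy T z ≤ 0 := by
        by_contra! h
        exact absurd (mul_pos hδ h) (not_lt.2 h2)
      have hA' := hAp.sub ((hBp.matrix_mul hRi).matrix_mul hSp.transpose)
      have hB' := (hBp.matrix_mul hRi).matrix_mul (hDp.transpose.matrix_mul hMp)
      obtain ⟨c, hc0, hc⟩ := IsTrajectory.exists_dotProduct_le hT hA' hB'
      have h4 : x T ⬝ᵥ x T ≤ c * energy T z := by
        refine hc z x hzL ⟨hx.1, fun t ht => ?_⟩ T ⟨hT.le, le_rfl⟩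
        refine (hx.2 t ht).trans (intervalIntegral.integral_congr fun s hs => ?_)
        rw [uIcc_of_le ht.1] at hs
        have hs' : s ∈ Icc 0 T := ⟨hs.1, hs.2.trans ht.2⟩
        have e1 : ((Ψ.C s)ᵀ * M s * Ψ.D s)ᵀ = (Ψ.D s)ᵀ * M s * Ψ.C s := by
          simp [transpose_mul, hMs s hs', Matrix.mul_assoc]
        have e2 : Ψ.B s *ᵥ u s = (Ψ.B s * ((Ψ.D s)ᵀ * M s * Ψ.D s)⁻¹) *ᵥ
            (((Ψ.D s)ᵀ * M s * Ψ.D s) *ᵥ u s) := by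
          rw [mulVec_mulVec, Matrix.mul_assoc, nonsing_inv_mul _ (hRu s hs'), Matrix.mul_one]
        simp only [hz, e1, mulVec_add, sub_mulVec]
        rw [e2]
        simp only [mulVec_mulVec, Matrix.mul_assoc]
        abel
      have h5 : x T ⬝ᵥ x T ≤ 0 := h4.trans (mul_nonpos_of_nonneg_of_nonpos hc0 h3)
      exact dotProduct_self_eq_zero.1 (le_antisymm h5 (dotProduct_self_nonneg' _)))
  obtain ⟨W, hW, hWR⟩ := hRp.exists_sqrt hT fun t ht => by
    refine PosSemidef.of_dotProduct_mulVec_nonneg ?_ fun v => ?_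
    · rw [IsHermitian, conjTranspose_eq_transpose_of_trivial]
      exact hRs t ht
    · rw [star_trivial]
      exact (mul_nonneg hδ'.le (dotProduct_self_nonneg' v)).trans (hR t ht v)
  have hentry : ∀ i j : n, Continuous fun M : Matrix n n ℝ => M i j := fun i j =>
    continuous_id.matrix_elem i j
  exact ⟨⟨Ψ.A, Ψ.B, fun t => ((W t)ᵀ)⁻¹ * ((Ψ.B t)ᵀ * X t + ((Ψ.C t)ᵀ * M t * Ψ.D t)ᵀ), W⟩,
    X, W, ⟨hXs, hXT, fun i j => (hentry i j).comp_continuousOn hXc, hXd⟩, hW, hWR,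
    fun t _ => ⟨rfl, rfl, rfl, rfl⟩⟩

/-- A factor has the same input energy as the filter it factorizes. -/
theorem IsFactor.properties (hT : 0 < T) (hΨ : Ψ.Regular T) (hMp : PiecewiseContinuous T M)
    (hM : UniformlyPosDef T M) (hD : UniformlyPosDef T (fun t => (Ψ.D t)ᵀ * Ψ.D t))
    {U : LTV n m m} (hU : IsFactor Ψ M T U) :
    (∀ t ∈ Icc 0 T, U.A t = Ψ.A t ∧ U.B t = Ψ.B t ∧ IsUnit (U.D t).det) ∧
    PiecewiseContinuous T U.C ∧ PiecewiseContinuous T U.D ∧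
    PiecewiseContinuous T (fun t => (U.D t)⁻¹) ∧
    ∀ u x, IsL2 T u → IsTrajectory Ψ.A Ψ.B T u x →
      ∫ t in (0 : ℝ)..T, (Ψ.C t *ᵥ x t + Ψ.D t *ᵥ u t) ⬝ᵥ
          (M t *ᵥ (Ψ.C t *ᵥ x t + Ψ.D t *ᵥ u t))
        = energy T (fun t => U.C t *ᵥ x t + U.D t *ᵥ u t) := by
  obtain ⟨hAp, hBp, hCp, hDp⟩ := hΨ
  obtain ⟨hMs, -⟩ := hM.exists_coercive
  obtain ⟨δ, hδ, hR⟩ := exists_feedthrough_coercive hM hD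
  obtain ⟨X, W, ⟨hXs, hXT, hXc, hXd⟩, hWp, hWR, hUdef⟩ := hU
  have hQp := (hCp.transpose.matrix_mul hMp).matrix_mul hCp
  have hSp := (hCp.transpose.matrix_mul hMp).matrix_mul hDp
  have hRp := (hDp.transpose.matrix_mul hMp).matrix_mul hDp
  have hRi := hRp.matrix_inv hT hδ hR
  have hRu := fun t ht => isUnit_det_of_coercive hδ (hR t ht)
  have hRs : ∀ t ∈ Icc 0 T, ((Ψ.D t)ᵀ * M t * Ψ.D t)ᵀ = (Ψ.D t)ᵀ * M t * Ψ.D t := fun t ht => by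
    simp [transpose_mul, hMs t ht, Matrix.mul_assoc]
  have hWu : ∀ t ∈ Icc 0 T, IsUnit (W t).det := fun t ht => by
    have := hRu t ht
    rw [hWR t ht, det_mul] at this
    exact isUnit_of_mul_isUnit_right this
  -- `W` is an arbitrary square factor; this formula passes the piecewise continuity of the inverse
  -- of `Dᵀ M D` on to `W⁻¹`.
  have hWi : ∀ t ∈ Icc 0 T, (W t)⁻¹ = ((Ψ.D t)ᵀ * M t * Ψ.D t)⁻¹ * (W t)ᵀ := fun t ht => by
    rw [hWR t ht, Matrix.mul_inv_rev, Matrix.mul_assoc, nonsing_inv_mul _ (by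
      rw [det_transpose]; exact hWu t ht), Matrix.mul_one]
  have hWip : PiecewiseContinuous T fun t => (W t)⁻¹ :=
    (hRi.matrix_mul hWp.transpose).congr hT hWi
  have hXcont : ContinuousOn X (Icc 0 T) :=
    continuousOn_pi.2 fun i => continuousOn_pi.2 fun j => hXc i j
  have hXp : PiecewiseContinuous T X := .of_continuousOn hT hXcont
  have hUC : PiecewiseContinuous T U.C := by
    refine ((hWip.transpose.matrix_mul
      ((hBp.transpose.matrix_mul hXp).add hSp.transpose))).congr hT fun t ht => ?_
    rw [(hUdef t ht).2.2.1, transpose_nonsing_inv]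
  have hUD : PiecewiseContinuous T U.D := hWp.congr hT fun t ht => (hUdef t ht).2.2.2
  refine ⟨fun t ht => ⟨(hUdef t ht).1, (hUdef t ht).2.1, ?_⟩, hUC, hUD,
    hWip.congr hT fun t ht => ?_, fun u x hu hx => ?_⟩
  · rw [(hUdef t ht).2.2.2]; exact hWu t ht
  · rw [(hUdef t ht).2.2.2]
  set g : ℝ → Matrix n n ℝ := fun t => riccatiRHS Ψ M t (X t) with hg
  have hgp : PiecewiseContinuous T g := by
    have h1 := (hXp.matrix_mul hBp).add hSp
    exact ((((hAp.transpose.matrix_mul hXp).add (hXp.matrix_mul hAp)).add hQp).sub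
      ((h1.matrix_mul hRi).matrix_mul h1.transpose)).neg
  have hentry : ∀ i j : n, Continuous fun M : Matrix n n ℝ => M i j := fun i j =>
    continuous_id.matrix_elem i j
  have hXprim : ∀ i j, IsPrimitive T (X · i j) (g · i j) := fun i j =>
    IsPrimitive.of_hasDerivWithinAt (hXc i j)
      (fun t ht => (hXd t ⟨ht.1.le, ht.2⟩ i j).mono Ioi_subset_Ici_self)
      ((hgp.map (hentry i j)).intervalIntegrable hT.le)
  -- The derivative of `xᵀ X x` integrates to zero, since `x(0) = 0` and `X(T) = 0`. Adding it to
  -- `zᵀ M z` completes the square to `|W q|²`, the squared output of the factor.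
  have hV := isPrimitive_dotProduct_mulVec hT.le (hx.isPrimitive hT.le hAp hBp hu) hXprim
  have hint := hV.integral_eq hT.le
  have hx0 : x 0 = 0 := by rw [hx.2 0 ⟨le_rfl, hT.le⟩, intervalIntegral.integral_same]
  rw [hx0, zero_dotProduct, hXT, zero_mulVec, dotProduct_zero, sub_zero] at hint
  have hzL : IsL2 T fun t => Ψ.C t *ᵥ x t + Ψ.D t *ᵥ u t :=
    (hx.isL2.mulVec hCp).add (hu.mulVec hDp)
  have hzi := hzL.intervalIntegrable_dotProduct hT.le (hzL.mulVec hMp)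
  have hsum := intervalIntegral.integral_add hV.1 hzi
  rw [hint, zero_add] at hsum
  rw [← hsum, energy]
  refine intervalIntegral.integral_congr fun t ht => ?_
  rw [uIcc_of_le hT.le] at ht
  rw [← quadCost_output (hMs t ht), dotProduct_mulVec_comm_of_symm (hXs t ht) (Ψ.A t *ᵥ x t + _)]
  have hsq := riccatiField_add_quadCost (A := Ψ.A t) (B := Ψ.B t) (Q := (Ψ.C t)ᵀ * M t * Ψ.C t)
    (S := (Ψ.C t)ᵀ * M t * Ψ.D t) (hRu t ht) (hRs t ht) (hXs t ht) (x t) (u t)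
  set q := u t + ((Ψ.D t)ᵀ * M t * Ψ.D t)⁻¹ *ᵥ
    ((X t * Ψ.B t + (Ψ.C t)ᵀ * M t * Ψ.D t)ᵀ *ᵥ x t) with hq
  have hy : U.C t *ᵥ x t + U.D t *ᵥ u t = W t *ᵥ q := by
    have e1 : W t * ((Ψ.D t)ᵀ * M t * Ψ.D t)⁻¹ = ((W t)ᵀ)⁻¹ := by
      rw [hWR t ht, Matrix.mul_inv_rev, ← Matrix.mul_assoc, mul_nonsing_inv _ (hWu t ht),
        Matrix.one_mul]
    have e2 : (X t * Ψ.B t)ᵀ = (Ψ.B t)ᵀ * X t := by rw [transpose_mul, hXs t ht]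
    rw [(hUdef t ht).2.2.1, (hUdef t ht).2.2.2, hq, mulVec_add, mulVec_mulVec, e1,
      transpose_add, e2, mulVec_mulVec, add_comm]
  rw [hy, ← dotProduct_transpose_mul_mulVec, ← hWR t ht, ← hsq]
  change _ + x t ⬝ᵥ (riccatiField _ _ _ _ _ _ *ᵥ x t) + _ + _ = _
  ring

end Factor

/-! ### The extended system -/

section Blocks

variable {l m n o : Type*} {T : ℝ}

theorem PiecewiseContinuous.fromBlocks {A : ℝ → Matrix n l ℝ} {B : ℝ → Matrix n m ℝ}
    {C : ℝ → Matrix o l ℝ} {D : ℝ → Matrix o m ℝ} (hA : PiecewiseContinuous T A)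
    (hB : PiecewiseContinuous T B) (hC : PiecewiseContinuous T C) (hD : PiecewiseContinuous T D) :
    PiecewiseContinuous T fun t => Matrix.fromBlocks (A t) (B t) (C t) (D t) :=
  ((hA.prodMk hB).prodMk (hC.prodMk hD)).map
    (φ := fun p => Matrix.fromBlocks p.1.1 p.1.2 p.2.1 p.2.2)
    ((continuous_fst.comp continuous_fst).matrix_fromBlocks
      (continuous_snd.comp continuous_fst) (continuous_fst.comp continuous_snd)
      (continuous_snd.comp continuous_snd))

theorem PiecewiseContinuous.fromCols {A : ℝ → Matrix n l ℝ} {B : ℝ → Matrix n m ℝ}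
    (hA : PiecewiseContinuous T A) (hB : PiecewiseContinuous T B) :
    PiecewiseContinuous T fun t => Matrix.fromCols (A t) (B t) :=
  (hA.prodMk hB).map (φ := fun p => Matrix.fromCols p.1 p.2) (continuous_matrix fun i j => by
    rcases j with j | j
    · exact continuous_fst.matrix_elem i j
    · exact continuous_snd.matrix_elem i j)

theorem PiecewiseContinuous.fromRows {A : ℝ → Matrix n m ℝ} {B : ℝ → Matrix o m ℝ}
    (hA : PiecewiseContinuous T A) (hB : PiecewiseContinuous T B) :
    PiecewiseContinuous T fun t => Matrix.fromRows (A t) (B t) :=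
  (hA.prodMk hB).map (φ := fun p => Matrix.fromRows p.1 p.2) (continuous_matrix fun i j => by
    rcases i with i | i
    · exact continuous_fst.matrix_elem i j
    · exact continuous_snd.matrix_elem i j)

variable [Fintype l] [Fintype m] [Fintype n] [Fintype o]

/-- Components of a trajectory that satisfy a system of their own form a trajectory of it. -/
theorem IsTrajectory.reindex {A : ℝ → Matrix n n ℝ} {B : ℝ → Matrix n m ℝ}
    (hA : PiecewiseContinuous T A) (hB : PiecewiseContinuous T B) {u : ℝ → m → ℝ}
    {x : ℝ → n → ℝ} (hu : IsL2 T u) (hx : IsTrajectory A B T u x) (g : l → n)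
    {A' : ℝ → Matrix l l ℝ} {B' : ℝ → Matrix l o ℝ} {u' : ℝ → o → ℝ}
    (h : ∀ t ∈ Icc 0 T, (A t *ᵥ x t + B t *ᵥ u t) ∘ g = A' t *ᵥ (x t ∘ g) + B' t *ᵥ u' t) :
    IsTrajectory A' B' T u' (fun t => x t ∘ g) := by
  set L : (n → ℝ) →L[ℝ] (l → ℝ) :=
    ContinuousLinearMap.pi fun i => ContinuousLinearMap.proj (g i) with hL
  refine ⟨L.continuous.comp_continuousOn hx.1, fun t ht => ?_⟩
  have hint : IntervalIntegrable (fun s => A s *ᵥ x s + B s *ᵥ u s) volume 0 t :=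
    (((hx.isL2.mulVec hA).add (hu.mulVec hB)).mono ht.2).intervalIntegrable ht.1
  change L (x t) = _
  rw [hx.2 t ht, ← L.intervalIntegral_comp_comm hint]
  refine intervalIntegral.integral_congr fun s hs => ?_
  rw [uIcc_of_le ht.1] at hs
  exact h s ⟨hs.1, hs.2.trans ht.2⟩

/-- The outputs of a system are bounded in `L₂` in terms of its inputs. -/
theorem IsTrajectory.exists_energy_output_le {A : ℝ → Matrix n n ℝ} {B : ℝ → Matrix n m ℝ}
    {C : ℝ → Matrix o n ℝ} {D : ℝ → Matrix o m ℝ} (hT : 0 < T)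
    (hA : PiecewiseContinuous T A) (hB : PiecewiseContinuous T B)
    (hC : PiecewiseContinuous T C) (hD : PiecewiseContinuous T D) :
    ∃ c : ℝ, 0 ≤ c ∧ ∀ u x, IsL2 T u → IsTrajectory A B T u x →
      energy T (fun t => C t *ᵥ x t + D t *ᵥ u t) ≤ c * energy T u := by
  obtain ⟨c₁, hc₁, h₁⟩ := IsTrajectory.exists_energy_le hT hA hB
  obtain ⟨c₂, hc₂, h₂⟩ := hC.exists_energy_mulVec_le hT.le
  obtain ⟨c₃, hc₃, h₃⟩ := hD.exists_energy_mulVec_le hT.le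
  refine ⟨2 * (c₂ * c₁) + 2 * c₃, by positivity, fun u x hu hx => ?_⟩
  have e₁ := energy_add_le hT.le (hx.isL2.mulVec hC) (hu.mulVec hD)
  have e₂ := h₂ x hx.isL2
  have e₃ := mul_le_mul_of_nonneg_left (h₁ u x hu hx) hc₂
  have e₄ := h₃ u hu
  linarith

theorem energy_congr {u v : ℝ → m → ℝ} (hT : 0 ≤ T) (h : ∀ t ∈ Icc 0 T, u t = v t) :
    energy T u = energy T v :=
  intervalIntegral.integral_congr fun t ht => by
    rw [uIcc_of_le hT] at ht
    simp only [h t ht]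

end Blocks

/-! ### The robust performance cost as a quadratic form -/

namespace Ext

variable {nN nv nw nd nI nE nψ nz : Type*}
  [Fintype nN] [Fintype nv] [Fintype nw] [Fintype nd] [Fintype nI] [Fintype nψ]
  [Fintype nz] [DecidableEq nw] [DecidableEq nd]
  (N : UncertainLTV nN nv nw nd nI nE) (Ψ : IQCFilter nψ nv nw nz) (γ : ℝ)
  (M : ℝ → Matrix nz nz ℝ)

/-- State weight of the robust performance cost. -/
def costQ (t : ℝ) : Matrix (nN ⊕ nψ) (nN ⊕ nψ) ℝ :=
  Q N nψ t + (Cz N Ψ t)ᵀ * M t * Cz N Ψ t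

/-- Cross weight of the robust performance cost. -/
def costS (t : ℝ) : Matrix (nN ⊕ nψ) (nw ⊕ nd) ℝ :=
  S N nψ t + (Cz N Ψ t)ᵀ * M t * Dz N Ψ t

/-- Input weight of the robust performance cost. -/
def costR (t : ℝ) : Matrix (nw ⊕ nd) (nw ⊕ nd) ℝ :=
  R N γ t + (Dz N Ψ t)ᵀ * M t * Dz N Ψ t

variable {N Ψ γ M} {t : ℝ}

/-- Isolates the multiplier term, the only part that the factorization rewrites. -/
theorem quadCost_eq (hM : (M t)ᵀ = M t) (x : nN ⊕ nψ → ℝ) (u : nw ⊕ nd → ℝ) :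
    quadCost (costQ N Ψ M t) (costS N Ψ M t) (costR N Ψ γ M t) x u
      = (CI N nψ t *ᵥ x + DI N t *ᵥ u) ⬝ᵥ (CI N nψ t *ᵥ x + DI N t *ᵥ u)
        + (Cz N Ψ t *ᵥ x + Dz N Ψ t *ᵥ u) ⬝ᵥ (M t *ᵥ (Cz N Ψ t *ᵥ x + Dz N Ψ t *ᵥ u))
        - (γ • (u ∘ Sum.inr)) ⬝ᵥ (γ • (u ∘ Sum.inr)) := by
  classical
  have h1 := quadCost_output (M := (1 : Matrix nI nI ℝ)) transpose_one (CI N nψ t) (DI N t) x u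
  simp only [Matrix.mul_one, one_mulVec] at h1
  have h2 : u ⬝ᵥ ((γ ^ 2 • fromBlocks (0 : Matrix nw nw ℝ) 0 0 (1 : Matrix nd nd ℝ)) *ᵥ u)
      = (γ • (u ∘ Sum.inr)) ⬝ᵥ (γ • (u ∘ Sum.inr)) := by
    rw [smul_mulVec, fromBlocks_mulVec]
    simp [dotProduct, Fintype.sum_sum_type]
    exact Finset.sum_congr rfl fun i _ => by ring
  rw [← quadCost_output hM, ← h1, ← h2]
  simp only [quadCost, costQ, costS, costR, Q, S, R, add_mulVec, sub_mulVec, dotProduct_add,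
    dotProduct_sub]
  ring

theorem costQ_symm (hM : (M t)ᵀ = M t) : (costQ N Ψ M t)ᵀ = costQ N Ψ M t := by
  simp [costQ, Q, transpose_mul, hM, Matrix.mul_assoc]

theorem costR_symm (hM : (M t)ᵀ = M t) : (costR N Ψ γ M t)ᵀ = costR N Ψ γ M t := by
  simp [costR, R, transpose_mul, hM, Matrix.mul_assoc, fromBlocks_transpose]

theorem DLMI_eq {T : ℝ} (P : ℝ → Matrix (nN ⊕ nψ) (nN ⊕ nψ) ℝ) (hM : (M t)ᵀ = M t) :
    DLMI N Ψ T γ M P t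
      = fromBlocks (dotOn T P t + (A N Ψ t)ᵀ * P t + P t * A N Ψ t + costQ N Ψ M t)
        (P t * B N Ψ t + costS N Ψ M t) ((B N Ψ t)ᵀ * P t + (costS N Ψ M t)ᵀ)
        (costR N Ψ γ M t) := by
  have h : (fromCols (Cz N Ψ t) (Dz N Ψ t))ᵀ * M t * fromCols (Cz N Ψ t) (Dz N Ψ t)
      = fromBlocks ((Cz N Ψ t)ᵀ * M t * Cz N Ψ t) ((Cz N Ψ t)ᵀ * M t * Dz N Ψ t)
        (((Cz N Ψ t)ᵀ * M t * Dz N Ψ t)ᵀ) ((Dz N Ψ t)ᵀ * M t * Dz N Ψ t) := by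
    rw [transpose_fromCols, fromRows_mul, fromRows_mul_fromCols]
    simp [transpose_mul, hM, Matrix.mul_assoc]
  rw [DLMI, h, fromBlocks_add, fromBlocks_add]
  simp only [costQ, costS, costR, transpose_add, zero_add, add_assoc]

/-- Along a trajectory the right-hand side is the derivative of `xᵀ P x` plus the supply rate. -/
theorem dotProduct_DLMI {T : ℝ} {P : ℝ → Matrix (nN ⊕ nψ) (nN ⊕ nψ) ℝ} (hM : (M t)ᵀ = M t)
    (hP : (P t)ᵀ = P t) (x : nN ⊕ nψ → ℝ) (u : nw ⊕ nd → ℝ) :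
    Sum.elim x u ⬝ᵥ (DLMI N Ψ T γ M P t *ᵥ Sum.elim x u)
      = x ⬝ᵥ (dotOn T P t *ᵥ x) + 2 * (x ⬝ᵥ (P t *ᵥ (A N Ψ t *ᵥ x + B N Ψ t *ᵥ u)))
        + quadCost (costQ N Ψ M t) (costS N Ψ M t) (costR N Ψ γ M t) x u := by
  rw [DLMI_eq P hM, fromBlocks_mulVec, sumElim_dotProduct_sumElim, Sum.elim_comp_inl,
    Sum.elim_comp_inr]
  have h1 : x ⬝ᵥ ((A N Ψ t)ᵀ *ᵥ (P t *ᵥ x)) = x ⬝ᵥ (P t *ᵥ (A N Ψ t *ᵥ x)) := by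
    rw [mulVec_mulVec, dotProduct_transpose_mul_mulVec, dotProduct_mulVec_comm_of_symm hP]
  have h2 : u ⬝ᵥ ((B N Ψ t)ᵀ *ᵥ (P t *ᵥ x)) = x ⬝ᵥ (P t *ᵥ (B N Ψ t *ᵥ u)) := by
    rw [mulVec_mulVec, dotProduct_transpose_mul_mulVec, dotProduct_mulVec_comm_of_symm hP]
  have h3 : u ⬝ᵥ ((costS N Ψ M t)ᵀ *ᵥ x) = x ⬝ᵥ (costS N Ψ M t *ᵥ u) := by
    rw [mulVec_transpose, dotProduct_comm, ← dotProduct_mulVec]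
  simp only [add_mulVec, dotProduct_add, mulVec_add, quadCost, h1, h2, h3, ← mulVec_mulVec]
  ring

end Ext

section Scaling

variable {nN nv nw nd nI nE n1 n2 p1 p2 : Type*}
  [Fintype nN] [Fintype nv] [Fintype nw] [Fintype nd] [Fintype nI] [Fintype nE] [Fintype n1]
  [Fintype n2] [Fintype p1] [Fintype p2] [DecidableEq nw] [DecidableEq nd]

/-! ### Scaled and unscaled inputs -/

/-- State-to-`(w̃, d̃)` matrix of the change of inputs. -/
def inputScalingC (nN n1 nd : Type*) {n2 nw : Type*} (U : LTV n2 nw nw) (t : ℝ) :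
    Matrix (nw ⊕ nd) (nN ⊕ (n1 ⊕ n2)) ℝ :=
  fromRows (fromCols 0 (fromCols 0 (U.C t))) 0

/-- The matrix from `(w, d)` to `(w̃, d̃)` of the change of inputs. -/
def inputScalingD (nd : Type*) [DecidableEq nd] {n2 nw : Type*} (U : LTV n2 nw nw) (γ : ℝ) (t : ℝ) :
    Matrix (nw ⊕ nd) (nw ⊕ nd) ℝ :=
  fromBlocks (U.D t) 0 0 (γ • 1)

theorem PiecewiseContinuous.inputScalingC {T : ℝ} {U : LTV n2 nw nw}
    (h : PiecewiseContinuous T U.C) : PiecewiseContinuous T (inputScalingC nN n1 nd U) :=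
  ((PiecewiseContinuous.const _).fromCols ((PiecewiseContinuous.const _).fromCols h)).fromRows
    (.const _)

theorem PiecewiseContinuous.inputScalingD {T : ℝ} {U : LTV n2 nw nw} (γ : ℝ)
    (h : PiecewiseContinuous T U.D) : PiecewiseContinuous T (inputScalingD nd U γ) :=
  h.fromBlocks (.const _) (.const _) (.const _)

theorem inputScaling_apply (U : LTV n2 nw nw) (γ t : ℝ) (x : nN ⊕ (n1 ⊕ n2) → ℝ)
    (u : nw ⊕ nd → ℝ) :
    inputScalingC nN n1 nd U t *ᵥ x + inputScalingD nd U γ t *ᵥ u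
      = Sum.elim (U.C t *ᵥ ((x ∘ Sum.inr) ∘ Sum.inr) + U.D t *ᵥ (u ∘ Sum.inl))
        (γ • (u ∘ Sum.inr)) := by
  rw [inputScalingC, inputScalingD, fromRows_mulVec, fromBlocks_mulVec, fromCols_mulVec,
    fromCols_mulVec]
  ext (i | i) <;> simp [smul_mulVec]

/-- The changes of inputs for `U` and for its inverse are inverse to each other. -/
theorem inputScaling_eq_iff {U : LTV n2 nw nw} {γ t : ℝ} (hγ : γ ≠ 0) (hU : IsUnit (U.D t).det)
    (x : nN ⊕ (n1 ⊕ n2) → ℝ) (u v : nw ⊕ nd → ℝ) :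
    v = inputScalingC nN n1 nd U t *ᵥ x + inputScalingD nd U γ t *ᵥ u ↔
      u = inputScalingC nN n1 nd U.inv t *ᵥ x + inputScalingD nd U.inv γ⁻¹ t *ᵥ v := by
  rw [inputScaling_apply, inputScaling_apply]
  constructor
  · rintro rfl
    rw [Sum.elim_comp_inl, Sum.elim_comp_inr, smul_smul, inv_mul_cancel₀ hγ, one_smul]
    simp only [LTV.inv, mulVec_add, mulVec_mulVec, nonsing_inv_mul _ hU, one_mulVec, neg_mulVec,
      neg_add_cancel_left, Sum.elim_comp_inl_inr]
  · rintro rfl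
    rw [Sum.elim_comp_inl, Sum.elim_comp_inr, smul_smul, mul_inv_cancel₀ hγ, one_smul]
    simp only [LTV.inv, mulVec_add, mulVec_mulVec, mul_nonsing_inv _ hU, one_mulVec, neg_mulVec,
      mulVec_neg, ← Matrix.mul_assoc, Matrix.one_mul, add_neg_cancel_left, Sum.elim_comp_inl_inr]

variable {N : UncertainLTV nN nv nw nd nI nE} {Ψv : LTV n1 nv p1} {Ψw : LTV n2 nw p2}
  {Uv : LTV n1 nv nv} {Uw : LTV n2 nw nw} {γ T : ℝ}

/-- The signal `v`. -/
def UncertainLTV.outV (N : UncertainLTV nN nv nw nd nI nE) (t : ℝ) (x : nN → ℝ)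
    (u : nw ⊕ nd → ℝ) : nv → ℝ :=
  N.Cv t *ᵥ x + (N.Dvw t *ᵥ (u ∘ Sum.inl) + N.Dvd t *ᵥ (u ∘ Sum.inr))

/-- Written in the shape of `scaled_rate`: as factors keep the `A` and `B` of the filters, comparing
the two shows that both systems share their state trajectories. -/
theorem extended_rate (t : ℝ) (x : nN ⊕ (n1 ⊕ n2) → ℝ) (u : nw ⊕ nd → ℝ) :
    Ext.A N (diagFilter Ψv Ψw) t *ᵥ x + Ext.B N (diagFilter Ψv Ψw) t *ᵥ u
      = Sum.elim (N.A t *ᵥ (x ∘ Sum.inl) + (N.Bw t *ᵥ (u ∘ Sum.inl) + N.Bd t *ᵥ (u ∘ Sum.inr)))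
        (Sum.elim
          (Ψv.A t *ᵥ ((x ∘ Sum.inr) ∘ Sum.inl) + Ψv.B t *ᵥ N.outV t (x ∘ Sum.inl) u)
          (Ψw.A t *ᵥ ((x ∘ Sum.inr) ∘ Sum.inr) + Ψw.B t *ᵥ (u ∘ Sum.inl))) := by
  simp only [Ext.A, Ext.B, diagFilter, fromBlocks_mulVec, add_mulVec, ← mulVec_mulVec,
    fromRows_mulVec, UncertainLTV.outV, mulVec_add, zero_mulVec]
  ext (i | i | i) <;> simp
  ring

theorem extended_output_z (t : ℝ) (x : nN ⊕ (n1 ⊕ n2) → ℝ) (u : nw ⊕ nd → ℝ) :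
    Ext.Cz N (diagFilter Ψv Ψw) t *ᵥ x + Ext.Dz N (diagFilter Ψv Ψw) t *ᵥ u
      = Sum.elim
          (Ψv.C t *ᵥ ((x ∘ Sum.inr) ∘ Sum.inl) + Ψv.D t *ᵥ N.outV t (x ∘ Sum.inl) u)
          (Ψw.C t *ᵥ ((x ∘ Sum.inr) ∘ Sum.inr) + Ψw.D t *ᵥ (u ∘ Sum.inl)) := by
  simp only [Ext.Cz, Ext.Dz, diagFilter, fromBlocks_mulVec, fromCols_mulVec, add_mulVec,
    ← mulVec_mulVec, fromRows_mulVec, UncertainLTV.outV, mulVec_add, zero_mulVec]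
  ext (i | i) <;> simp
  ring

theorem extended_output_I (t : ℝ) (x : nN ⊕ (n1 ⊕ n2) → ℝ) (u : nw ⊕ nd → ℝ) :
    Ext.CI N (n1 ⊕ n2) t *ᵥ x + Ext.DI N t *ᵥ u
      = N.CI t *ᵥ (x ∘ Sum.inl) + (N.DIw t *ᵥ (u ∘ Sum.inl) + N.DId t *ᵥ (u ∘ Sum.inr)) := by
  simp only [Ext.CI, Ext.DI, fromCols_mulVec, zero_mulVec, add_zero]

/-- The scaled system in terms of the unscaled inputs. -/
theorem scaled_rate {t : ℝ} (x : nN ⊕ (n1 ⊕ n2) → ℝ) {u v : nw ⊕ nd → ℝ}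
    (hu : u = inputScalingC nN n1 nd Uw.inv t *ᵥ x + inputScalingD nd Uw.inv γ⁻¹ t *ᵥ v) :
    (scaledSystem N Uv Uw γ).A t *ᵥ x + (scaledSystem N Uv Uw γ).B t *ᵥ v
      = Sum.elim (N.A t *ᵥ (x ∘ Sum.inl) + (N.Bw t *ᵥ (u ∘ Sum.inl) + N.Bd t *ᵥ (u ∘ Sum.inr)))
        (Sum.elim
          (Uv.A t *ᵥ ((x ∘ Sum.inr) ∘ Sum.inl) + Uv.B t *ᵥ N.outV t (x ∘ Sum.inl) u)
          (Uw.A t *ᵥ ((x ∘ Sum.inr) ∘ Sum.inr) + Uw.B t *ᵥ (u ∘ Sum.inl))) := by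
  rw [inputScaling_apply] at hu
  subst hu
  rw [Sum.elim_comp_inl, Sum.elim_comp_inr]
  simp only [scaledSystem, LTV.inv, fromBlocks_mulVec, fromCols_mulVec, sub_mulVec,
    ← mulVec_mulVec, fromRows_mulVec, UncertainLTV.outV, mulVec_add, zero_mulVec, smul_mulVec,
    mulVec_smul, Sum.elim_comp_inl, Sum.elim_comp_inr, neg_mulVec, mulVec_neg]
  ext (i | i | i) <;> simp <;> ring

theorem scaled_output {t : ℝ} (x : nN ⊕ (n1 ⊕ n2) → ℝ) {u v : nw ⊕ nd → ℝ}
    (hu : u = inputScalingC nN n1 nd Uw.inv t *ᵥ x + inputScalingD nd Uw.inv γ⁻¹ t *ᵥ v) :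
    (scaledSystem N Uv Uw γ).CI t *ᵥ x + (scaledSystem N Uv Uw γ).DI t *ᵥ v
      = Sum.elim
          (Uv.C t *ᵥ ((x ∘ Sum.inr) ∘ Sum.inl) + Uv.D t *ᵥ N.outV t (x ∘ Sum.inl) u)
          (N.CI t *ᵥ (x ∘ Sum.inl)
            + (N.DIw t *ᵥ (u ∘ Sum.inl) + N.DId t *ᵥ (u ∘ Sum.inr))) := by
  rw [inputScaling_apply] at hu
  subst hu
  rw [Sum.elim_comp_inl, Sum.elim_comp_inr]
  simp only [scaledSystem, fromBlocks_mulVec, fromCols_mulVec,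
    ← mulVec_mulVec, UncertainLTV.outV, mulVec_add, zero_mulVec, smul_mulVec,
    mulVec_smul, Sum.elim_comp_inl, Sum.elim_comp_inr]
  ext (i | i) <;> simp <;> ring

end Scaling

/-- Only the rate along `x` matters, so one state can be a trajectory of two systems under different
inputs. -/
theorem IsTrajectory.congr {n m m' : Type*} [Fintype n] [Fintype m] [Fintype m'] {T : ℝ}
    {A A' : ℝ → Matrix n n ℝ} {B : ℝ → Matrix n m ℝ} {B' : ℝ → Matrix n m' ℝ} {u : ℝ → m → ℝ}
    {u' : ℝ → m' → ℝ} {x : ℝ → n → ℝ} (hx : IsTrajectory A B T u x)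
    (h : ∀ t ∈ Icc 0 T, A t *ᵥ x t + B t *ᵥ u t = A' t *ᵥ x t + B' t *ᵥ u' t) :
    IsTrajectory A' B' T u' x :=
  ⟨hx.1, fun t ht => (hx.2 t ht).trans (intervalIntegral.integral_congr fun s hs => by
    rw [uIcc_of_le ht.1] at hs
    exact h s ⟨hs.1, hs.2.trans ht.2⟩)⟩

/-! ### Piecewise continuity of the extended and the scaled system -/

section Regularity

variable {nN nv nw nd nI nE n1 n2 p1 p2 : Type*}
  [Fintype nN] [Fintype nv] [Fintype nw] [Fintype nd] [Fintype nI] [Fintype nE] [Fintype n1]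
  [Fintype n2] [Fintype p1] [Fintype p2] [DecidableEq nw] [DecidableEq nd]
  {N : UncertainLTV nN nv nw nd nI nE} {Ψv : LTV n1 nv p1} {Ψw : LTV n2 nw p2}
  {Uv : LTV n1 nv nv} {Uw : LTV n2 nw nw} {T : ℝ}

theorem UncertainLTV.Regular.extended (hN : N.Regular T) (hv : Ψv.Regular T) (hw : Ψw.Regular T) :
    PiecewiseContinuous T (Ext.A N (diagFilter Ψv Ψw)) ∧
    PiecewiseContinuous T (Ext.B N (diagFilter Ψv Ψw)) ∧
    PiecewiseContinuous T (Ext.Cz N (diagFilter Ψv Ψw)) ∧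
    PiecewiseContinuous T (Ext.Dz N (diagFilter Ψv Ψw)) ∧
    PiecewiseContinuous T (Ext.CI N (n1 ⊕ n2)) ∧ PiecewiseContinuous T (Ext.DI N) := by
  obtain ⟨hA, hBw, hBd, hCv, hDvw, hDvd, hCI, hDIw, hDId, hCE⟩ := hN
  obtain ⟨hA1, hB1, hC1, hD1⟩ := hv
  obtain ⟨hA2, hB2, hC2, hD2⟩ := hw
  have hΨA : PiecewiseContinuous T (diagFilter Ψv Ψw).A := hA1.fromBlocks (.const _) (.const _) hA2
  have hΨC : PiecewiseContinuous T (diagFilter Ψv Ψw).C := hC1.fromBlocks (.const _) (.const _) hC2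
  have hΨBv : PiecewiseContinuous T (diagFilter Ψv Ψw).Bv := hB1.fromRows (.const _)
  have hΨDv : PiecewiseContinuous T (diagFilter Ψv Ψw).Dv := hD1.fromRows (.const _)
  have hΨBw : PiecewiseContinuous T (diagFilter Ψv Ψw).Bw :=
    (PiecewiseContinuous.const _).fromRows hB2
  have hΨDw : PiecewiseContinuous T (diagFilter Ψv Ψw).Dw :=
    (PiecewiseContinuous.const _).fromRows hD2
  exact ⟨hA.fromBlocks (.const _) (hΨBv.matrix_mul hCv) hΨA,
    hBw.fromBlocks hBd ((hΨBv.matrix_mul hDvw).add hΨBw) (hΨBv.matrix_mul hDvd),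
    (hΨDv.matrix_mul hCv).fromCols hΨC,
    ((hΨDv.matrix_mul hDvw).add hΨDw).fromCols (hΨDv.matrix_mul hDvd),
    hCI.fromCols (.const _), hDIw.fromCols hDId⟩

theorem PiecewiseContinuous.cost (hN : N.Regular T) (hv : Ψv.Regular T) (hw : Ψw.Regular T)
    {M : ℝ → Matrix (p1 ⊕ p2) (p1 ⊕ p2) ℝ} (hM : PiecewiseContinuous T M) (γ : ℝ) :
    PiecewiseContinuous T (Ext.costQ N (diagFilter Ψv Ψw) M) ∧
    PiecewiseContinuous T (Ext.costS N (diagFilter Ψv Ψw) M) ∧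
    PiecewiseContinuous T (Ext.costR N (diagFilter Ψv Ψw) γ M) := by
  obtain ⟨-, -, hCz, hDz, hCI, hDI⟩ := hN.extended hv hw
  exact ⟨(hCI.transpose.matrix_mul hCI).add ((hCz.transpose.matrix_mul hM).matrix_mul hCz),
    (hCI.transpose.matrix_mul hDI).add ((hCz.transpose.matrix_mul hM).matrix_mul hDz),
    ((hDI.transpose.matrix_mul hDI).sub (.const _)).add
      ((hDz.transpose.matrix_mul hM).matrix_mul hDz)⟩

theorem LTV.Regular.inv (hU : Uw.Regular T) (hi : PiecewiseContinuous T (fun t => (Uw.D t)⁻¹)) :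
    Uw.inv.Regular T :=
  ⟨hU.1.sub ((hU.2.1.matrix_mul hi).matrix_mul hU.2.2.1), hU.2.1.matrix_mul hi,
    (hi.matrix_mul hU.2.2.1).neg, hi⟩

theorem UncertainLTV.Regular.scaled (hN : N.Regular T) (hv : Uv.Regular T)
    (hw : Uw.inv.Regular T) (γ : ℝ) :
    PiecewiseContinuous T (scaledSystem N Uv Uw γ).A ∧
    PiecewiseContinuous T (scaledSystem N Uv Uw γ).B ∧
    PiecewiseContinuous T (scaledSystem N Uv Uw γ).CI ∧
    PiecewiseContinuous T (scaledSystem N Uv Uw γ).DI := by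
  obtain ⟨hA, hBw, hBd, hCv, hDvw, hDvd, hCI, hDIw, hDId, hCE⟩ := hN
  obtain ⟨hA1, hB1, hC1, hD1⟩ := hv
  obtain ⟨hA2, hB2, hC2, hD2⟩ := hw
  exact ⟨hA.fromBlocks (PiecewiseContinuous.fromCols (.const _) (hBw.matrix_mul hC2))
      ((hB1.matrix_mul hCv).fromRows (.const _))
      (hA1.fromBlocks ((hB1.matrix_mul hDvw).matrix_mul hC2) (.const _) hA2),
    (hBw.matrix_mul hD2).fromBlocks (hBd.const_smul _)
      (((hB1.matrix_mul hDvw).matrix_mul hD2).fromRows hB2)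
      (((hB1.matrix_mul hDvd).const_smul _).fromRows (.const _)),
    (hD1.matrix_mul hCv).fromBlocks (hC1.fromCols ((hD1.matrix_mul hDvw).matrix_mul hC2)) hCI
      (PiecewiseContinuous.fromCols (.const _) (hDIw.matrix_mul hC2)),
    ((hD1.matrix_mul hDvw).matrix_mul hD2).fromBlocks ((hD1.matrix_mul hDvd).const_smul _)
      (hDIw.matrix_mul hD2) (hDId.const_smul _)⟩

end Regularity

/-! ### The cost identity -/

section Performance

variable {nN nv nw nd nI nE n1 n2 p1 p2 : Type*}
  [Fintype nN] [Fintype nv] [Fintype nw] [Fintype nd] [Fintype nI] [Fintype nE] [Fintype n1]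
  [Fintype n2] [Fintype p1] [Fintype p2] [DecidableEq nw] [DecidableEq nd] [DecidableEq nv]
  [DecidableEq p1] [DecidableEq p2]
  {N : UncertainLTV nN nv nw nd nI nE} {Ψv : LTV n1 nv p1} {Ψw : LTV n2 nw p2}
  {Mv : ℝ → Matrix p1 p1 ℝ} {Mw : ℝ → Matrix p2 p2 ℝ}
  {Uv : LTV n1 nv nv} {Uw : LTV n2 nw nw} {γ T : ℝ}

theorem diagMultiplier_transpose (hMv : UniformlyPosDef T Mv) (hMw : UniformlyPosDef T Mw) {t : ℝ}
    (ht : t ∈ Icc 0 T) : (diagMultiplier Mv Mw t)ᵀ = diagMultiplier Mv Mw t := by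
  simp [diagMultiplier, fromBlocks_transpose, hMv.exists_coercive.1 t ht,
    hMw.exists_coercive.1 t ht]

theorem IsFactor.regular (hT : 0 < T) (hΨv : Ψv.Regular T) (hMv : PiecewiseContinuous T Mv)
    (hMv_pos : UniformlyPosDef T Mv) (hDv : UniformlyPosDef T (fun t => (Ψv.D t)ᵀ * Ψv.D t))
    (hU : IsFactor Ψv Mv T Uv) :
    Uv.Regular T ∧ PiecewiseContinuous T (fun t => (Uv.D t)⁻¹) := by
  obtain ⟨h, hC, hD, hDi, -⟩ := hU.properties hT hΨv hMv hMv_pos hDv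
  exact ⟨⟨hΨv.1.congr hT fun t ht => (h t ht).1, hΨv.2.1.congr hT fun t ht => (h t ht).2.1, hC, hD⟩,
    hDi⟩

/-- The robust performance cost of an input is the nominal performance cost of the scaled one. -/
theorem robust_cost_eq (hT : 0 < T) (hN : N.Regular T) (hΨv : Ψv.Regular T) (hΨw : Ψw.Regular T)
    (hDv : UniformlyPosDef T (fun t => (Ψv.D t)ᵀ * Ψv.D t))
    (hDw : UniformlyPosDef T (fun t => (Ψw.D t)ᵀ * Ψw.D t))
    (hMv : PiecewiseContinuous T Mv) (hMw : PiecewiseContinuous T Mw)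
    (hMv_pos : UniformlyPosDef T Mv) (hMw_pos : UniformlyPosDef T Mw) (hγ : γ ≠ 0)
    (hUv : IsFactor Ψv Mv T Uv) (hUw : IsFactor Ψw Mw T Uw) {u v : ℝ → nw ⊕ nd → ℝ}
    {x : ℝ → nN ⊕ (n1 ⊕ n2) → ℝ} (hu : IsL2 T u)
    (hx : IsTrajectory (Ext.A N (diagFilter Ψv Ψw)) (Ext.B N (diagFilter Ψv Ψw)) T u x)
    (huv : ∀ t ∈ Icc 0 T,
      v t = inputScalingC nN n1 nd Uw t *ᵥ x t + inputScalingD nd Uw γ t *ᵥ u t) :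
    x T ⬝ᵥ (Ext.F N (n1 ⊕ n2) T *ᵥ x T) + ∫ t in (0 : ℝ)..T,
        quadCost (Ext.costQ N (diagFilter Ψv Ψw) (diagMultiplier Mv Mw) t)
          (Ext.costS N (diagFilter Ψv Ψw) (diagMultiplier Mv Mw) t)
          (Ext.costR N (diagFilter Ψv Ψw) γ (diagMultiplier Mv Mw) t) (x t) (u t)
      = (scaledSystem N Uv Uw γ).outE x T ⬝ᵥ (scaledSystem N Uv Uw γ).outE x T
        + energy T ((scaledSystem N Uv Uw γ).outI v x) - energy T v := by
  obtain ⟨hAe, hBe, hCz, hDz, hCI, hDI⟩ := hN.extended hΨv hΨw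
  obtain ⟨hUv_reg, -⟩ := hUv.regular hT hΨv hMv hMv_pos hDv
  obtain ⟨hUw_reg, -⟩ := hUw.regular hT hΨw hMw hMw_pos hDw
  obtain ⟨-, -, -, -, hv_energy⟩ := hUv.properties hT hΨv hMv hMv_pos hDv
  obtain ⟨hUw_eq, -, -, -, hw_energy⟩ := hUw.properties hT hΨw hMw hMw_pos hDw
  have hxL := hx.isL2
  have hxN : IsL2 T fun t => x t ∘ Sum.inl := hxL.inl
  have hxv : IsL2 T fun t => (x t ∘ Sum.inr) ∘ Sum.inl := hxL.inr.inl
  have hxw : IsL2 T fun t => (x t ∘ Sum.inr) ∘ Sum.inr := hxL.inr.inr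
  have hw : IsL2 T fun t => u t ∘ Sum.inl := hu.inl
  have hd : IsL2 T fun t => u t ∘ Sum.inr := hu.inr
  have hV : IsL2 T fun t => N.outV t (x t ∘ Sum.inl) (u t) :=
    (hxN.mulVec hN.2.2.2.1).add ((hw.mulVec hN.2.2.2.2.1).add (hd.mulVec hN.2.2.2.2.2.1))
  -- The filter components of the extended state are trajectories of `Ψv` driven by `v` and of `Ψw`
  -- driven by `w`, so the energy identity of each factor applies.
  have ev := hv_energy _ _ hV (hx.reindex (A' := Ψv.A) (B' := Ψv.B) hAe hBe hu (Sum.inr ∘ Sum.inl)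
    fun t _ => by rw [extended_rate]; rfl)
  have ew := hw_energy _ _ hw (hx.reindex (A' := Ψw.A) (B' := Ψw.B) hAe hBe hu (Sum.inr ∘ Sum.inr)
    fun t _ => by rw [extended_rate]; rfl)
  set zv : ℝ → p1 → ℝ := fun t => Ψv.C t *ᵥ ((x t ∘ Sum.inr) ∘ Sum.inl)
    + Ψv.D t *ᵥ N.outV t (x t ∘ Sum.inl) (u t) with hzv
  set zw : ℝ → p2 → ℝ := fun t => Ψw.C t *ᵥ ((x t ∘ Sum.inr) ∘ Sum.inr)
    + Ψw.D t *ᵥ (u t ∘ Sum.inl) with hzw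
  set yv : ℝ → nv → ℝ := fun t => Uv.C t *ᵥ ((x t ∘ Sum.inr) ∘ Sum.inl)
    + Uv.D t *ᵥ N.outV t (x t ∘ Sum.inl) (u t) with hyv
  set yw : ℝ → nw → ℝ := fun t => Uw.C t *ᵥ ((x t ∘ Sum.inr) ∘ Sum.inr)
    + Uw.D t *ᵥ (u t ∘ Sum.inl) with hyw
  set e : ℝ → nI → ℝ := fun t => N.CI t *ᵥ (x t ∘ Sum.inl)
    + (N.DIw t *ᵥ (u t ∘ Sum.inl) + N.DId t *ᵥ (u t ∘ Sum.inr)) with he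
  have ev : ∫ t in (0 : ℝ)..T, zv t ⬝ᵥ (Mv t *ᵥ zv t) = energy T yv := ev
  have ew : ∫ t in (0 : ℝ)..T, zw t ⬝ᵥ (Mw t *ᵥ zw t) = energy T yw := ew
  have hzvL : IsL2 T zv := (hxv.mulVec hΨv.2.2.1).add (hV.mulVec hΨv.2.2.2)
  have hzwL : IsL2 T zw := (hxw.mulVec hΨw.2.2.1).add (hw.mulVec hΨw.2.2.2)
  have hyvL : IsL2 T yv := (hxv.mulVec hUv_reg.2.2.1).add (hV.mulVec hUv_reg.2.2.2)
  have hywL : IsL2 T yw := (hxw.mulVec hUw_reg.2.2.1).add (hw.mulVec hUw_reg.2.2.2)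
  have heL : IsL2 T e := (hxN.mulVec hN.2.2.2.2.2.2.1).add
    ((hw.mulVec hN.2.2.2.2.2.2.2.1).add (hd.mulVec hN.2.2.2.2.2.2.2.2.1))
  have hdL : IsL2 T fun t => γ • (u t ∘ Sum.inr) := hd.const_smul γ
  have hout : energy T ((scaledSystem N Uv Uw γ).outI v x) = energy T yv + energy T e := by
    rw [energy, energy, energy, ← intervalIntegral.integral_add
      (hyvL.intervalIntegrable_dotProduct hT.le hyvL) (heL.intervalIntegrable_dotProduct hT.le heL)]
    refine intervalIntegral.integral_congr fun t ht => ?_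
    rw [uIcc_of_le hT.le] at ht
    have h1 := (inputScaling_eq_iff hγ (hUw_eq t ht).2.2 (x t) (u t) (v t)).1 (huv t ht)
    have h2 := scaled_output (N := N) (Uv := Uv) (x t) h1
    simp only [PerfLTV.outI, h2, sumElim_dotProduct_sumElim]
    rfl
  have hin : energy T v = energy T yw + energy T (fun t => γ • (u t ∘ Sum.inr)) := by
    rw [energy, energy, energy, ← intervalIntegral.integral_add
      (hywL.intervalIntegrable_dotProduct hT.le hywL)
      (hdL.intervalIntegrable_dotProduct hT.le hdL)]
    refine intervalIntegral.integral_congr fun t ht => ?_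
    rw [uIcc_of_le hT.le] at ht
    simp only [huv t ht, inputScaling_apply, sumElim_dotProduct_sumElim]
    rfl
  have hfin : x T ⬝ᵥ (Ext.F N (n1 ⊕ n2) T *ᵥ x T)
      = (scaledSystem N Uv Uw γ).outE x T ⬝ᵥ (scaledSystem N Uv Uw γ).outE x T :=
    dotProduct_transpose_mul_mulVec _ _ _ _
  have i1 := heL.intervalIntegrable_dotProduct hT.le heL
  have i2 := hzvL.intervalIntegrable_dotProduct hT.le (hzvL.mulVec hMv)
  have i3 := hzwL.intervalIntegrable_dotProduct hT.le (hzwL.mulVec hMw)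
  have i4 := hdL.intervalIntegrable_dotProduct hT.le hdL
  -- The signs in `diag(M_v, -M_w)` put the energy of `ṽ` on the output side and that of `w̃` on the
  -- input side.
  have hcost : ∫ t in (0 : ℝ)..T,
        quadCost (Ext.costQ N (diagFilter Ψv Ψw) (diagMultiplier Mv Mw) t)
          (Ext.costS N (diagFilter Ψv Ψw) (diagMultiplier Mv Mw) t)
          (Ext.costR N (diagFilter Ψv Ψw) γ (diagMultiplier Mv Mw) t) (x t) (u t)
      = energy T e + energy T yv - energy T yw - energy T (fun t => γ • (u t ∘ Sum.inr)) := by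
    rw [← ev, ← ew, energy, energy, ← intervalIntegral.integral_add i1 i2,
      ← intervalIntegral.integral_sub (i1.add i2) i3,
      ← intervalIntegral.integral_sub ((i1.add i2).sub i3) i4]
    refine intervalIntegral.integral_congr fun t ht => ?_
    rw [uIcc_of_le hT.le] at ht
    simp only [Ext.quadCost_eq (diagMultiplier_transpose hMv_pos hMw_pos ht), extended_output_z,
      extended_output_I, diagMultiplier, fromBlocks_mulVec, sumElim_dotProduct_sumElim,
      Sum.elim_comp_inl, Sum.elim_comp_inr, zero_mulVec, add_zero, zero_add, neg_mulVec,
      dotProduct_neg]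
    simp only [hzv, hzw, he]
    ring
  rw [hfin, hcost, hout, hin]
  ring

end Performance

/-! ### From the matrix inequality to the dissipation inequality -/

namespace Ext

variable {nN nv nw nd nI nE nψ nz : Type*}
  [Fintype nN] [Fintype nv] [Fintype nw] [Fintype nd] [Fintype nI] [Fintype nE] [Fintype nψ]
  [Fintype nz] [DecidableEq nN] [DecidableEq nψ] [DecidableEq nw] [DecidableEq nd]
  {N : UncertainLTV nN nv nw nd nI nE} {Ψ : IQCFilter nψ nv nw nz} {γ T ε : ℝ}
  {M : ℝ → Matrix nz nz ℝ} {P : ℝ → Matrix (nN ⊕ nψ) (nN ⊕ nψ) ℝ}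

theorem dotOn_eq {n : Type*} (hT : 0 < T) {P P' : ℝ → Matrix n n ℝ} {t : ℝ} (ht : t ∈ Icc 0 T)
    (h : ∀ i j, HasDerivWithinAt (P · i j) (P' t i j) (Icc 0 T) t) : dotOn T P t = P' t := by
  ext i j
  exact (h i j).derivWithin (uniqueDiffOn_Icc hT t ht)

theorem dotOn_transpose {n : Type*} {P : ℝ → Matrix n n ℝ} {t : ℝ} (ht : t ∈ Icc 0 T)
    (h : ∀ t ∈ Icc 0 T, (P t)ᵀ = P t) : (dotOn T P t)ᵀ = dotOn T P t := by
  ext i j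
  refine derivWithin_congr (fun s hs => ?_) ?_
  · exact congrFun (congrFun (h s hs) i) j
  · exact congrFun (congrFun (h t ht) i) j

/-- The robust performance DLMI as a dissipation inequality. -/
theorem posSemidef_neg_DLMI_iff {t : ℝ} (ht : t ∈ Icc 0 T) (hM : (M t)ᵀ = M t)
    (hP : ∀ t ∈ Icc 0 T, (P t)ᵀ = P t) :
    (-(ε • 1) - DLMI N Ψ T γ M P t).PosSemidef ↔
      ∀ x u, x ⬝ᵥ (dotOn T P t *ᵥ x) + 2 * (x ⬝ᵥ (P t *ᵥ (A N Ψ t *ᵥ x + B N Ψ t *ᵥ u)))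
        + quadCost (costQ N Ψ M t) (costS N Ψ M t) (costR N Ψ γ M t) x u
          ≤ -ε * (x ⬝ᵥ x + u ⬝ᵥ u) := by
  have hsymm : (-(ε • 1) - DLMI N Ψ T γ M P t).IsHermitian := by
    rw [IsHermitian, conjTranspose_eq_transpose_of_trivial, DLMI_eq P hM, transpose_sub,
      transpose_neg, transpose_smul, transpose_one, fromBlocks_transpose]
    simp only [transpose_add, transpose_mul, transpose_transpose, dotOn_transpose ht hP, hP t ht,
      costQ_symm hM, costR_symm hM]
    congr 3
    abel
  have key : ∀ (x : nN ⊕ nψ → ℝ) (u : nw ⊕ nd → ℝ),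
      Sum.elim x u ⬝ᵥ ((-(ε • 1) - DLMI N Ψ T γ M P t) *ᵥ Sum.elim x u)
        = -ε * (x ⬝ᵥ x + u ⬝ᵥ u)
          - (x ⬝ᵥ (dotOn T P t *ᵥ x) + 2 * (x ⬝ᵥ (P t *ᵥ (A N Ψ t *ᵥ x + B N Ψ t *ᵥ u)))
            + quadCost (costQ N Ψ M t) (costS N Ψ M t) (costR N Ψ γ M t) x u) := fun x u => by
    rw [sub_mulVec, dotProduct_sub, dotProduct_DLMI hM (hP t ht), neg_mulVec, smul_mulVec,
      one_mulVec, dotProduct_neg, dotProduct_smul, sumElim_dotProduct_sumElim, smul_eq_mul]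
    ring
  refine ⟨fun h x u => ?_, fun h => .of_dotProduct_mulVec_nonneg hsymm fun z => ?_⟩
  · have := (posSemidef_iff_dotProduct_mulVec.1 h).2 (Sum.elim x u)
    rw [star_trivial, key] at this
    linarith
  · rw [star_trivial, ← Sum.elim_comp_inl_inr z, key]
    linarith [h (z ∘ Sum.inl) (z ∘ Sum.inr)]

end Ext

/-! ### The equivalence -/

section Performance

variable {nN nv nw nd nI nE n1 n2 p1 p2 : Type*}
  [Fintype nN] [Fintype nv] [Fintype nw] [Fintype nd] [Fintype nI] [Fintype nE] [Fintype n1]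
  [Fintype n2] [Fintype p1] [Fintype p2] [DecidableEq nN] [DecidableEq n1] [DecidableEq n2]
  [DecidableEq nw] [DecidableEq nd] [DecidableEq nv] [DecidableEq p1] [DecidableEq p2]
  {N : UncertainLTV nN nv nw nd nI nE} {Ψv : LTV n1 nv p1} {Ψw : LTV n2 nw p2}
  {Mv : ℝ → Matrix p1 p1 ℝ} {Mw : ℝ → Matrix p2 p2 ℝ}
  {Uv : LTV n1 nv nv} {Uw : LTV n2 nw nw} {γ T : ℝ}

/-- The robust performance DLMI is feasible iff the robust performance cost is strictly negative
along all trajectories of the extended system. -/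
theorem exists_satisfiesDLMI_iff (hT : 0 < T) (hN : N.Regular T) (hΨv : Ψv.Regular T)
    (hΨw : Ψw.Regular T) (hMv : PiecewiseContinuous T Mv) (hMw : PiecewiseContinuous T Mw)
    (hMv_pos : UniformlyPosDef T Mv) (hMw_pos : UniformlyPosDef T Mw) :
    (∃ ε : ℝ, 0 < ε ∧ ∃ P,
      Ext.SatisfiesDLMI N (diagFilter Ψv Ψw) T γ ε (diagMultiplier Mv Mw) P) ↔
    ∃ ε : ℝ, 0 < ε ∧ ∀ u x, IsL2 T u →
      IsTrajectory (Ext.A N (diagFilter Ψv Ψw)) (Ext.B N (diagFilter Ψv Ψw)) T u x →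
      x T ⬝ᵥ (Ext.F N (n1 ⊕ n2) T *ᵥ x T) + ∫ t in (0 : ℝ)..T,
        quadCost (Ext.costQ N (diagFilter Ψv Ψw) (diagMultiplier Mv Mw) t)
          (Ext.costS N (diagFilter Ψv Ψw) (diagMultiplier Mv Mw) t)
          (Ext.costR N (diagFilter Ψv Ψw) γ (diagMultiplier Mv Mw) t) (x t) (u t)
        ≤ -ε * energy T u := by
  have hMp : PiecewiseContinuous T (diagMultiplier Mv Mw) :=
    hMv.fromBlocks (.const _) (.const _) hMw.neg
  have hMs := fun t (ht : t ∈ Icc 0 T) => diagMultiplier_transpose hMv_pos hMw_pos ht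
  obtain ⟨hA, hB, -⟩ := hN.extended hΨv hΨw
  obtain ⟨hQ, hS, hR⟩ := PiecewiseContinuous.cost hN hΨv hΨw hMp γ
  constructor
  · rintro ⟨ε, hε, P, hPs, hPd, hPT, hP⟩
    refine ⟨ε, hε, fun u x hu hx => ?_⟩
    have h1 := cost_le_of_dissipation hT hA hB hQ hS hR (P := P) (P' := Ext.dotOn T P) hPs
      (fun t ht i j => (hPd i j t ht).hasDerivWithinAt) hε.le
      (fun t ht => (Ext.posSemidef_neg_DLMI_iff ht (hMs t ht) hPs).1 (hP t ht)) hu hx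
    have h2 := (posSemidef_iff_dotProduct_mulVec.1 hPT).2 (x T)
    rw [star_trivial, sub_mulVec, dotProduct_sub] at h2
    linarith
  · rintro ⟨ε, hε, h⟩
    obtain ⟨ε', hε', P, P', hPs, hPd, hPT, hP⟩ := exists_dissipation_of_cost_le hT hA hB hQ hS hR
      (fun t ht => Ext.costQ_symm (hMs t ht)) (fun t ht => Ext.costR_symm (hMs t ht))
      (by simp [Ext.F, transpose_mul]) hε h
    refine ⟨ε', hε', P, hPs, fun i j t ht => (hPd t ht i j).differentiableWithinAt, ?_,
      fun t ht => (Ext.posSemidef_neg_DLMI_iff ht (hMs t ht) hPs).2 ?_⟩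
    · rw [hPT, sub_self]
      exact .zero
    · rw [Ext.dotOn_eq hT ht (hPd t ht)]
      exact hP t ht

/-- The robust performance DLMI is feasible iff the scaled system is strictly contractive. -/
theorem exists_satisfiesDLMI_iff_perf_le (hT : 0 < T) (hN : N.Regular T) (hΨv : Ψv.Regular T)
    (hΨw : Ψw.Regular T) (hDv : UniformlyPosDef T (fun t => (Ψv.D t)ᵀ * Ψv.D t))
    (hDw : UniformlyPosDef T (fun t => (Ψw.D t)ᵀ * Ψw.D t))
    (hMv : PiecewiseContinuous T Mv) (hMw : PiecewiseContinuous T Mw)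
    (hMv_pos : UniformlyPosDef T Mv) (hMw_pos : UniformlyPosDef T Mw) (hγ : γ ≠ 0)
    (hUv : IsFactor Ψv Mv T Uv) (hUw : IsFactor Ψw Mw T Uw) :
    (∃ ε : ℝ, 0 < ε ∧ ∃ P,
      Ext.SatisfiesDLMI N (diagFilter Ψv Ψw) T γ ε (diagMultiplier Mv Mw) P) ↔
    ∃ δ : ℝ, 0 < δ ∧ δ ≤ 1 ∧ (scaledSystem N Uv Uw γ).perf T ≤ ENNReal.ofReal (1 - δ) := by
  rw [exists_satisfiesDLMI_iff hT hN hΨv hΨw hMv hMw hMv_pos hMw_pos]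
  obtain ⟨hA, hB, -⟩ := hN.extended hΨv hΨw
  obtain ⟨hUv_reg, -⟩ := hUv.regular hT hΨv hMv hMv_pos hDv
  obtain ⟨hUw_reg, hUw_inv⟩ := hUw.regular hT hΨw hMw hMw_pos hDw
  obtain ⟨hUv_eq, -⟩ := hUv.properties hT hΨv hMv hMv_pos hDv
  obtain ⟨hUw_eq, -⟩ := hUw.properties hT hΨw hMw hMw_pos hDw
  have hUi := hUw_reg.inv hUw_inv
  obtain ⟨hAs, hBs, hCs, hDs⟩ := hN.scaled hUv_reg hUi γ
  have hG : PiecewiseContinuous T (inputScalingC nN n1 nd Uw) := hUw_reg.2.2.1.inputScalingC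
  have hH : PiecewiseContinuous T (inputScalingD nd Uw γ) := hUw_reg.2.2.2.inputScalingD γ
  have hG' : PiecewiseContinuous T (inputScalingC nN n1 nd Uw.inv) := hUi.2.2.1.inputScalingC
  have hH' : PiecewiseContinuous T (inputScalingD nd Uw.inv γ⁻¹) := hUi.2.2.2.inputScalingD γ⁻¹
  have hrate : ∀ t ∈ Icc 0 T, ∀ (x : nN ⊕ (n1 ⊕ n2) → ℝ) (u v : nw ⊕ nd → ℝ),
      u = inputScalingC nN n1 nd Uw.inv t *ᵥ x + inputScalingD nd Uw.inv γ⁻¹ t *ᵥ v →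
      (scaledSystem N Uv Uw γ).A t *ᵥ x + (scaledSystem N Uv Uw γ).B t *ᵥ v
        = Ext.A N (diagFilter Ψv Ψw) t *ᵥ x + Ext.B N (diagFilter Ψv Ψw) t *ᵥ u := by
    intro t ht x u v huv
    rw [scaled_rate x huv, extended_rate, (hUv_eq t ht).1, (hUv_eq t ht).2.1, (hUw_eq t ht).1,
      (hUw_eq t ht).2.1]
  obtain ⟨c, hc, hcv⟩ := IsTrajectory.exists_energy_output_le hT hA hB hG hH
  obtain ⟨c', hc', hcu⟩ := IsTrajectory.exists_energy_output_le hT hAs hBs hG' hH'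
  constructor
  · rintro ⟨ε, hε, h⟩
    -- The scaled input has energy at most `c` times that of the unscaled one, so `κ ‖v‖² ≤ ε ‖u‖²`.
    -- The squared gain is then at most `1 - κ`, and the cap at `1` keeps this nonnegative.
    set κ := min (ε / (c + 1)) 1 with hκ
    have hκ0 : 0 < κ := lt_min (by positivity) one_pos
    have hκ1 : κ ≤ 1 := min_le_right _ _
    have hκε : κ * (c + 1) ≤ ε := (le_div_iff₀ (by positivity)).1 (min_le_left _ _)
    have hsqrt : Real.sqrt (1 - κ) < 1 := by
      rw [Real.sqrt_lt' one_pos]; linarith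
    refine ⟨1 - Real.sqrt (1 - κ), by linarith, by linarith [Real.sqrt_nonneg (1 - κ)], ?_⟩
    rw [sub_sub_cancel]
    refine iSup_le fun v => iSup_le fun x => iSup_le fun hv => iSup_le fun hv0 => iSup_le fun hx =>
      ENNReal.ofReal_le_ofReal (Real.sqrt_le_sqrt ?_)
    rw [div_le_iff₀ hv0]
    have hx : IsTrajectory (scaledSystem N Uv Uw γ).A (scaledSystem N Uv Uw γ).B T v x := hx
    set u : ℝ → nw ⊕ nd → ℝ := fun t =>
      inputScalingC nN n1 nd Uw.inv t *ᵥ x t + inputScalingD nd Uw.inv γ⁻¹ t *ᵥ v t with hu_def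
    have hu : IsL2 T u := (hx.isL2.mulVec hG').add (hv.mulVec hH')
    have huv : ∀ t ∈ Icc 0 T,
        v t = inputScalingC nN n1 nd Uw t *ᵥ x t + inputScalingD nd Uw γ t *ᵥ u t := fun t ht =>
      (inputScaling_eq_iff hγ (hUw_eq t ht).2.2 (x t) (u t) (v t)).2 rfl
    have hxe : IsTrajectory (Ext.A N (diagFilter Ψv Ψw)) (Ext.B N (diagFilter Ψv Ψw)) T u x :=
      hx.congr fun t ht => hrate t ht _ _ _ rfl
    have h1 := h u x hu hxe
    rw [robust_cost_eq hT hN hΨv hΨw hDv hDw hMv hMw hMv_pos hMw_pos hγ hUv hUw hu hxe huv] at h1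
    have h2 := hcv u x hu hxe
    rw [← energy_congr hT.le huv] at h2
    have h3 := energy_nonneg hT.le u
    have h4 : κ * energy T v ≤ ε * energy T u := by
      calc κ * energy T v ≤ κ * ((c + 1) * energy T u) := by
            gcongr; linarith
        _ = κ * (c + 1) * energy T u := by ring
        _ ≤ ε * energy T u := by gcongr
    linarith
  · rintro ⟨δ, hδ0, hδ1, hperf⟩
    -- The gap left by the squared gain; dividing it by `c' + 1` below expresses it through the
    -- unscaled input.
    set κ := 1 - (1 - δ) ^ 2 with hκ
    have hκ0 : 0 < κ := by nlinarith
    refine ⟨κ / (c' + 1), by positivity, fun u x hu hx => ?_⟩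
    set v : ℝ → nw ⊕ nd → ℝ := fun t =>
      inputScalingC nN n1 nd Uw t *ᵥ x t + inputScalingD nd Uw γ t *ᵥ u t with hv_def
    have hv : IsL2 T v := (hx.isL2.mulVec hG).add (hu.mulVec hH)
    have hvu : ∀ t ∈ Icc 0 T, u t
        = inputScalingC nN n1 nd Uw.inv t *ᵥ x t + inputScalingD nd Uw.inv γ⁻¹ t *ᵥ v t :=
      fun t ht => (inputScaling_eq_iff hγ (hUw_eq t ht).2.2 (x t) (u t) (v t)).1 rfl
    have hxs : IsTrajectory (scaledSystem N Uv Uw γ).A (scaledSystem N Uv Uw γ).B T v x :=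
      hx.congr fun t ht => (hrate t ht _ _ _ (hvu t ht)).symm
    rw [robust_cost_eq hT hN hΨv hΨw hDv hDw hMv hMw hMv_pos hMw_pos hγ hUv hUw hu hx
      fun t _ => rfl]
    have h2 := hcu v x hv hxs
    rw [← energy_congr hT.le hvu] at h2
    have hv_nonneg := energy_nonneg hT.le v
    have h3 : κ / (c' + 1) * energy T u ≤ κ * energy T v := by
      calc κ / (c' + 1) * energy T u ≤ κ / (c' + 1) * ((c' + 1) * energy T v) := by
            gcongr; linarith
        _ = κ * energy T v := by field_simp
    have h4 : (scaledSystem N Uv Uw γ).outE x T ⬝ᵥ (scaledSystem N Uv Uw γ).outE x T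
        + energy T ((scaledSystem N Uv Uw γ).outI v x) ≤ (1 - δ) ^ 2 * energy T v := by
      -- The supremum says nothing about inputs of zero energy. For these the boundedness of the
      -- scaled system makes both outputs vanish.
      rcases hv_nonneg.eq_or_lt with h0 | hpos
      · obtain ⟨a, ha, hax⟩ := IsTrajectory.exists_dotProduct_le hT hAs hBs
        obtain ⟨b, hb, hbx⟩ := IsTrajectory.exists_energy_output_le hT hAs hBs hCs hDs
        have h5 := hax v x hv hxs T ⟨hT.le, le_rfl⟩
        have h6 : energy T ((scaledSystem N Uv Uw γ).outI v x) ≤ b * energy T v := hbx v x hv hxs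
        rw [← h0, mul_zero] at h5 h6
        have h7 : x T = 0 :=
          dotProduct_self_eq_zero.1 (le_antisymm h5 (dotProduct_self_nonneg' _))
        rw [← h0, mul_zero, PerfLTV.outE, h7, mulVec_zero, zero_dotProduct, zero_add]
        exact h6
      · rw [PerfLTV.perf] at hperf
        have h5 := iSup_le_iff.1 (iSup_le_iff.1 (iSup_le_iff.1 (iSup_le_iff.1
          (iSup_le_iff.1 hperf v) x) hv) hpos) hxs
        rw [ENNReal.ofReal_le_ofReal_iff (by linarith), Real.sqrt_le_left (by linarith),
          div_le_iff₀ hpos] at h5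
        exact h5
    linarith

end Performance

end FiniteHorizon

end

theorem lemma1 (nN nv nw nd nI nE n1 n2 p1 p2 : ℕ) (T : ℝ) (hT : 0 < T)
    (N : FiniteHorizon.UncertainLTV (Fin nN) (Fin nv) (Fin nw) (Fin nd) (Fin nI) (Fin nE))
    (hN : N.Regular T)
    (Ψv : FiniteHorizon.LTV (Fin n1) (Fin nv) (Fin p1)) (hΨv : Ψv.Regular T)
    (Ψw : FiniteHorizon.LTV (Fin n2) (Fin nw) (Fin p2)) (hΨw : Ψw.Regular T)
    (hDv : FiniteHorizon.UniformlyPosDef T (fun t => (Ψv.D t)ᵀ * Ψv.D t))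
    (hDw : FiniteHorizon.UniformlyPosDef T (fun t => (Ψw.D t)ᵀ * Ψw.D t))
    (Mv : ℝ → Matrix (Fin p1) (Fin p1) ℝ) (Mw : ℝ → Matrix (Fin p2) (Fin p2) ℝ)
    (hMv : FiniteHorizon.PiecewiseContinuous T Mv) (hMw : FiniteHorizon.PiecewiseContinuous T Mw)
    (hMv_pos : FiniteHorizon.UniformlyPosDef T Mv) (hMw_pos : FiniteHorizon.UniformlyPosDef T Mw)
    (γ : ℝ) (hγ : 0 < γ) :
    (∃ Uv, FiniteHorizon.IsFactor Ψv Mv T Uv) ∧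
    (∃ Uw, FiniteHorizon.IsFactor Ψw Mw T Uw) ∧
    ∀ (Uv : FiniteHorizon.LTV (Fin n1) (Fin nv) (Fin nv))
      (Uw : FiniteHorizon.LTV (Fin n2) (Fin nw) (Fin nw)),
      FiniteHorizon.IsFactor Ψv Mv T Uv → FiniteHorizon.IsFactor Ψw Mw T Uw →
      ((∃ ε : ℝ, 0 < ε ∧ ∃ P,
          FiniteHorizon.Ext.SatisfiesDLMI N (FiniteHorizon.diagFilter Ψv Ψw) T γ ε
            (FiniteHorizon.diagMultiplier Mv Mw) P) ↔
        ∃ δ : ℝ, 0 < δ ∧ δ ≤ 1 ∧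
          (FiniteHorizon.scaledSystem N Uv Uw γ).perf T ≤ ENNReal.ofReal (1 - δ)) :=
  ⟨FiniteHorizon.exists_isFactor hT hΨv hMv hMv_pos hDv,
    FiniteHorizon.exists_isFactor hT hΨw hMw hMw_pos hDw, fun _ _ hUv hUw =>
      FiniteHorizon.exists_satisfiesDLMI_iff_perf_le hT hN hΨv hΨw hDv hDw hMv hMw hMv_pos hMw_pos
        hγ.ne' hUv hUw⟩
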